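/- Let $d\ge 4$ be even. For an odd prime power $q$ let $$C=\{x\in\mathbb F_q^d:\ x_1^2+\dots+x_{d-2}^2=x_{d-1}x_d\},$$ and let $\sigma_c$ be the normalized surface measure on $C$, i.e. $\int g\,d\sigma_c=|C|^{-1}\sum_{x\in C}g(x)$. Give $\mathbb F_q^d$ the normalized counting measure $dx$ (total mass $1$), so that $f*\sigma_c(y)=|C|^{-1}\sum_{x\in C}f(y-x)$ for $f:\mathbb F_q^d\to\mathbb C$. For $1\le p,r\le\infty$ let $A_C(p\to r)$ be the smallest constant $A$ such that $$\|f*\sigma_c\|_{L^r(C,\sigma_c)}\le A\,\|f\|_{L^p(\mathbb F_q^d,dx)}\quad\text{for all } f:\mathbb F_q^d\to\mathbb C.$$ Let $\|g\|_{L^{r,\infty}(C,\sigma_c)}=\sup_{t>0}t\,\sigma_c(\{x\in C:|g(x)|>t\})^{1/r}$. Write $X\lesssim Y$ if $X\le KY$ with a constant $K$ that may depend on $d,p,r$, but not on $q$ (nor on the function or set in question). Unless stated otherwise, $q$ ranges over all odd prime powers. Let $\Omega\subset\mathbb R^2$ be the convex hull of $(0,0)$, $(0,1)$, $(\frac{d-1}{d},1)$,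 $$P_1=\Big(\frac{d-1}{d},\frac1{d-2}\Big),\qquad P_2=\Big(\frac{d^2-3d+2}{d^2-2d+2},\frac{d-2}{d^2-2d+2}\Big).$$ Then the following hold, with $1\le p,r\le\infty$ and $1/\infty=0$. 1. If $(1/p,1/r)\in\Omega\setminus\{P_1,P_2\}$, then $A_C(p\to r)\lesssim 1$. 2. Let $Q$ be any infinite set of odd prime powers $q$ such that $-1$ is a square in $\mathbb F_q$ for every $q\in Q$ (for instance the set of all such $q$). If $A_C(p\to r)\lesssim 1$ for $q$ ranging over $Q$, then $(1/p,1/r)\in\Omega$. 3. If $(1/p,1/r)=P_1$, then $\|1_E*\sigma_c\|_{L^r(C,\sigma_c)}\lesssim\|1_E\|_{L^p(\mathbb F_q^d,dx)}$ for all $E\subset\mathbb F_q^d$. 4. If $(1/p,1/r)=P_2$, then $\|f*\sigma_c\|_{L^{r,\infty}(C,\sigma_c)}\lesssim\|f\|_{L^p(\mathbb F_q^d,dx)}$ for all $f:\mathbb F_q^d\to\mathbb C$. -/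

import Mathlib

open MeasureTheory ProbabilityTheory
open scoped ENNReal NNReal

/-- The `L^p` norm, `0 ≤ p ≤ ∞`, of `g` with respect to the normalized counting measure on the
nonempty finite set `S ⊆ X`. For `S = univ` in `𝔽_q^d` this is the norm of `L^p(𝔽_q^d, dx)`; for
a variety `S = V` it is the norm of `L^p(V, σ)`, with `σ` the normalized surface measure. -/
noncomputable def avgLpNorm {X : Type} (S : Finset X) (p : ℝ≥0∞) (g : X → ℂ) : ℝ≥0∞ :=
  letI : MeasurableSpace X := ⊤
  eLpNorm g p (uniformOn (S : Set X))

/-- The weak norm of `L^{r,∞}(S)`, `0 < r < ∞`, for the normalized counting measure `σ` on `S`: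
`sup_{t > 0} t * σ({x : |g x| > t})^(1/r)`. -/
noncomputable def avgWeakLpNorm {X : Type} (S : Finset X) (r : ℝ≥0∞) (g : X → ℂ) : ℝ≥0∞ :=
  letI : MeasurableSpace X := ⊤
  ⨆ t : {t : ℝ≥0 // 0 < t},
    ((t : ℝ≥0) : ℝ≥0∞) * (uniformOn (S : Set X) {x | (t : ℝ≥0) < ‖g x‖₊}) ^ (1 / r.toReal)

/-- The averaging operator `(f * σ)(y) = |V|⁻¹ ∑_{x ∈ V} f (y - x)`. -/
noncomputable def averaging {X : Type} [AddCommGroup X] (V : Finset X) (f : X → ℂ) (y : X) : ℂ :=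
  (V.card : ℂ)⁻¹ * ∑ x ∈ V, f (y - x)

/-- `A_V(p → r)`: the smallest constant `C` such that
`‖f * σ‖_{L^r(V, σ)} ≤ C ‖f‖_{L^p(X, dx)}` for all `f : X → ℂ`. -/
noncomputable def restrictedAvgConst {X : Type} [AddCommGroup X] [Fintype X] (V : Finset X)
    (p r : ℝ≥0∞) : ℝ≥0∞ :=
  sInf {C : ℝ≥0∞ | ∀ f : X → ℂ,
    avgLpNorm V r (averaging V f) ≤ C * avgLpNorm Finset.univ p f}

open Classical in
/-- The cone `x_1² + ⋯ + x_{d-2}² = x_{d-1} x_d` in `F^d` (coordinates are numbered from `0` in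
the code). -/
noncomputable def cone (F : Type) [Field F] [Fintype F] (d : ℕ) (hd : 2 ≤ d) :
    Finset (Fin d → F) :=
  {x | ∑ i : Fin (d - 2), x ⟨i, by omega⟩ ^ 2 = x ⟨d - 2, by omega⟩ * x ⟨d - 1, by omega⟩}

/-- The sizes of the finite fields of odd characteristic. -/
def oddPrimePowers : Set ℕ := {q | IsPrimePow q ∧ Odd q}

/-- `A_C(p → r) ≲ 1` for the cone `C ⊂ 𝔽_q^d`, uniformly in the field sizes `q ∈ Q`: a single
constant works for all finite fields whose cardinality lies in `Q`. -/
def ConeBounded (Q : Set ℕ) (d : ℕ) (hd : 2 ≤ d) (p r : ℝ≥0∞) : Prop :=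
  ∃ K : ℝ≥0, ∀ (F : Type) [Field F] [Fintype F], Fintype.card F ∈ Q →
    restrictedAvgConst (cone F d hd) p r ≤ K

/-- The point `(1/p, 1/r)`, with `1/∞ = 0`. -/
noncomputable def recip (p r : ℝ≥0∞) : ℝ × ℝ := (p⁻¹.toReal, r⁻¹.toReal)

/-- The point `P₁`. -/
noncomputable def pointOne (d : ℕ) : ℝ × ℝ := (((d : ℝ) - 1) / d, 1 / ((d : ℝ) - 2))

/-- The point `P₂`. -/
noncomputable def pointTwo (d : ℕ) : ℝ × ℝ :=
  (((d : ℝ) ^ 2 - 3 * d + 2) / ((d : ℝ) ^ 2 - 2 * d + 2),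
    ((d : ℝ) - 2) / ((d : ℝ) ^ 2 - 2 * d + 2))

/-- The region `Ω`. -/
noncomputable def regionOmega (d : ℕ) : Set (ℝ × ℝ) :=
  convexHull ℝ {(0, 0), (0, 1), (((d : ℝ) - 1) / d, 1), pointOne d, pointTwo d}

/-! ### Real interpolation for positive bilinear forms -/

section Interpolation

/-! Write `d = 2k + 2`, let `Q` be the quadratic form of the cone, and put `x = 1/p`, `y = 1/r`. For
a point `w` of the cone, `Q (w - z) = 0` means `polar Q z w = Q z`. Hence the average of `f` at `w`
is `1/|C|` times the sum of `f` over those `z` whose hyperplane contains `w`, and by duality the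
theorem concerns the bilinear form `incidenceForm` on `ℓ^p × ℓ^{r'}`.

Sufficiency splits the pairs `(z, w)`. The pairs with `z = 0`, and those with `z` singular and `w =
0`, are estimated trivially and cost exactly the edges `d x ≤ d - 1` and `x ≤ (d - 1) y` of `Ω`. For
nonsingular `z`, distinct proportional vectors have disjoint hyperplanes, so the variance bound for
incidences is as good as possible and suffices together with trivial bounds. The core is the case of
nonzero singular `z` and `w`. There the `k`-th moment of the number of points of `E` orthogonal to
`w` is computed by induction over the span of the chosen points (`sum_orthogonalCount_pow_le`). The
moment bound, its version with `E` and `G` exchanged, the variance bound and trivial bounds give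
incidence estimates for sets at two points of the line `d x = (d - 2)(1 + y)` through `P₁` and `P₂`,
or else the count is at most twice its expected value `|E||G|/q`.

These two points lie strictly beyond the edge `P₁P₂` on either side. So both `P₁` and `P₂` are
interior to a segment of set estimates, and since `p < r` there, real interpolation
(`exists_incidenceForm_le`) gives a strong bound, even at the vertices; the restricted and weak
estimates are special cases. The expected value is the form of a constant kernel and is controlled
by `ℓ^1` norms. The rest of `Ω` follows by scaling towards the origin and by nesting of norms.

For necessity, the three nontrivial edges come from the indicator functions of a point, of the cone,
and of a totally singular subspace of dimension `d / 2`, which exists when `-1` is a square. -/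

lemma summable_exp_neg_mul_abs_int {c : ℝ} (hc : 0 < c) :
    Summable fun n : ℤ => Real.exp (-(c * |(n : ℝ)|)) := by
  have h : Summable fun n : ℕ => Real.exp (-(c * (n : ℝ))) := by
    have := summable_geometric_of_lt_one (Real.exp_pos (-c)).le (Real.exp_lt_one_iff.2 (by linarith))
    refine this.congr fun n => ?_
    rw [← Real.exp_nat_mul]
    ring_nf
  refine summable_int_iff_summable_nat_and_neg.2 ⟨?_, ?_⟩ <;> simpa using h

/-- The point is uniformity in the shift `t`: recentring at the integer nearest to the zero of `c k
+ t` costs only a factor `exp |c|`. -/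
lemma exists_sum_exp_neg_abs_le {c : ℝ} (hc : c ≠ 0) :
    ∃ C : ℝ, 0 ≤ C ∧ ∀ (t : ℝ) (S : Finset ℤ), ∑ k ∈ S, Real.exp (-|c * k + t|) ≤ C := by
  have hc' : 0 < |c| := abs_pos.2 hc
  have hs := summable_exp_neg_mul_abs_int hc'
  refine ⟨Real.exp |c| * ∑' n : ℤ, Real.exp (-(|c| * |(n : ℝ)|)),
    mul_nonneg (Real.exp_pos _).le (tsum_nonneg fun n => (Real.exp_pos _).le), fun t S => ?_⟩
  set k₀ : ℤ := round (-t / c) with hk₀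
  have hround : |c * k₀ + t| ≤ |c| := by
    have h1 := abs_sub_round (-t / c)
    have h2 : c * k₀ + t = -c * (-t / c - round (-t / c)) := by
      rw [← hk₀]
      field_simp
      ring
    rw [h2, abs_mul, abs_neg]
    nlinarith
  have hpt (k : ℤ) : Real.exp (-|c * k + t|) ≤
      Real.exp |c| * Real.exp (-(|c| * |((k - k₀ : ℤ) : ℝ)|)) := by
    rw [← Real.exp_add, Real.exp_le_exp]
    have h3 : c * ((k - k₀ : ℤ) : ℝ) = (c * k + t) - (c * k₀ + t) := by
      push_cast
      ring
    have h4 := abs_sub (c * k + t) (c * k₀ + t)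
    rw [← h3, abs_mul] at h4
    linarith
  calc ∑ k ∈ S, Real.exp (-|c * k + t|)
      ≤ ∑ k ∈ S, Real.exp |c| * Real.exp (-(|c| * |((k - k₀ : ℤ) : ℝ)|)) :=
        Finset.sum_le_sum fun k _ => hpt k
    _ = Real.exp |c| * ∑ n ∈ S.map (Equiv.subRight k₀).toEmbedding,
          Real.exp (-(|c| * |(n : ℝ)|)) := by
        rw [Finset.sum_map, Finset.mul_sum]
        rfl
    _ ≤ _ := by
        gcongr
        exact hs.sum_le_tsum _ fun n _ => (Real.exp_pos _).le

open Classical in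
/-- The number of pairs of `E × G` that are related by `R`. -/
noncomputable def incidenceCount {Z Y : Type*} (R : Z → Y → Prop) (E : Finset Z) (G : Finset Y) :
    ℕ :=
  ((E ×ˢ G).filter fun p => R p.1 p.2).card

open Classical in
/-- The bilinear form with kernel the indicator function of the relation `R`. -/
noncomputable def incidenceForm {Z Y : Type*} [Fintype Z] [Fintype Y] (R : Z → Y → Prop)
    (f : Z → ℝ) (g : Y → ℝ) : ℝ :=
  ∑ p : Z × Y, if R p.1 p.2 then f p.1 * g p.2 else 0

open Classical in
/-- The set on which `exp k ≤ f < exp (k + 1)`. -/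
noncomputable def expLevel {Z : Type*} [Fintype Z] (f : Z → ℝ) (k : ℤ) : Finset Z :=
  Finset.univ.filter fun z => 0 < f z ∧ ⌊Real.log (f z)⌋ = k

lemma mem_expLevel {Z : Type*} [Fintype Z] {f : Z → ℝ} {k : ℤ} {z : Z} :
    z ∈ expLevel f k ↔ 0 < f z ∧ ⌊Real.log (f z)⌋ = k := by
  simp [expLevel]

lemma exp_le_of_mem_expLevel {Z : Type*} [Fintype Z] {f : Z → ℝ} {k : ℤ} {z : Z}
    (h : z ∈ expLevel f k) : Real.exp k ≤ f z := by
  obtain ⟨h0, rfl⟩ := mem_expLevel.1 h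
  rw [← Real.le_log_iff_exp_le h0]
  exact Int.floor_le _

lemma le_exp_of_mem_expLevel {Z : Type*} [Fintype Z] {f : Z → ℝ} {k : ℤ} {z : Z}
    (h : z ∈ expLevel f k) : f z ≤ Real.exp (k + 1) := by
  obtain ⟨h0, rfl⟩ := mem_expLevel.1 h
  rw [← Real.log_le_iff_le_exp h0]
  exact (Int.lt_floor_add_one _).le

lemma sum_exp_mul_card_expLevel_le {Z : Type*} [Fintype Z] {f : Z → ℝ} (hf : ∀ z, 0 ≤ f z)
    {p : ℝ} (hp : 0 < p) (S : Finset ℤ) :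
    ∑ k ∈ S, Real.exp (k * p) * (expLevel f k).card ≤ ∑ z, f z ^ p := by
  classical
  calc ∑ k ∈ S, Real.exp (k * p) * (expLevel f k).card
      ≤ ∑ k ∈ S, ∑ z ∈ expLevel f k, f z ^ p := by
        refine Finset.sum_le_sum fun k _ => ?_
        rw [mul_comm, ← nsmul_eq_mul]
        refine Finset.card_nsmul_le_sum _ _ _ fun z hz => ?_
        rw [Real.exp_mul]
        exact Real.rpow_le_rpow (Real.exp_pos _).le (exp_le_of_mem_expLevel hz) hp.le
    _ = ∑ z ∈ S.biUnion (expLevel f), f z ^ p := by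
        rw [Finset.sum_biUnion]
        intro k _ l _ hkl
        refine Finset.disjoint_left.2 fun z hz hz' => hkl ?_
        rw [← (mem_expLevel.1 hz).2, (mem_expLevel.1 hz').2]
    _ ≤ ∑ z, f z ^ p :=
        Finset.sum_le_sum_of_subset_of_nonneg (Finset.subset_univ _)
          fun z _ _ => Real.rpow_nonneg (hf z) p

lemma sum_exp_mul_card_expLevel_le_sum {Z : Type*} [Fintype Z] {f : Z → ℝ} (hf : ∀ z, 0 ≤ f z)
    (S : Finset ℤ) : ∑ k ∈ S, Real.exp k * (expLevel f k).card ≤ ∑ z, f z := by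
  simpa using sum_exp_mul_card_expLevel_le hf one_pos S

lemma incidenceForm_le_sum_expLevel {Z Y : Type*} [Fintype Z] [Fintype Y] (R : Z → Y → Prop)
    {f : Z → ℝ} {g : Y → ℝ} (hf : ∀ z, 0 ≤ f z) (hg : ∀ y, 0 ≤ g y) :
    ∃ S T : Finset ℤ, incidenceForm R f g ≤ ∑ k ∈ S, ∑ l ∈ T,
      Real.exp (k + 1 + (l + 1)) * incidenceCount R (expLevel f k) (expLevel g l) := by
  classical
  set κ : Z → ℤ := fun z => ⌊Real.log (f z)⌋ with hκ
  set μ : Y → ℤ := fun y => ⌊Real.log (g y)⌋ with hμ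
  refine ⟨Finset.univ.image κ, Finset.univ.image μ, ?_⟩
  set P : Finset (Z × Y) :=
    Finset.univ.filter fun p => R p.1 p.2 ∧ 0 < f p.1 ∧ 0 < g p.2 with hP
  have h1 : incidenceForm R f g = ∑ p ∈ P, f p.1 * g p.2 := by
    rw [incidenceForm, hP, Finset.sum_filter]
    refine Finset.sum_congr rfl fun p _ => ?_
    by_cases hR : R p.1 p.2 <;> simp only [hR, true_and, false_and, if_true, if_false]
    split_ifs with h
    · rfl
    · rcases (hf p.1).eq_or_lt with h0 | h0
      · rw [← h0, zero_mul]
      · rcases (hg p.2).eq_or_lt with h0' | h0'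
        · rw [← h0', mul_zero]
        · exact absurd ⟨h0, h0'⟩ h
  rw [h1, ← Finset.sum_product',
    ← Finset.sum_fiberwise_of_maps_to (s := P) (g := fun p => (κ p.1, μ p.2))
      (t := Finset.univ.image κ ×ˢ Finset.univ.image μ) (fun p _ => by simp)]
  refine Finset.sum_le_sum fun kl _ => ?_
  have hset : (P.filter fun p => (κ p.1, μ p.2) = kl) =
      (expLevel f kl.1 ×ˢ expLevel g kl.2).filter fun p => R p.1 p.2 := by
    ext p
    simp only [hP, Finset.mem_filter, Finset.mem_univ, true_and, Finset.mem_product, mem_expLevel,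
      Prod.ext_iff]
    tauto
  rw [hset, incidenceCount, mul_comm (Real.exp _), ← nsmul_eq_mul]
  refine Finset.sum_le_card_nsmul _ _ _ fun p hp => ?_
  simp only [Finset.mem_filter, Finset.mem_product] at hp
  rw [Real.exp_add]
  exact mul_le_mul (le_exp_of_mem_expLevel hp.1.1) (le_exp_of_mem_expLevel hp.1.2) (hg _)
    (Real.exp_pos _).le

/-- Real interpolation for a positive bilinear form: bounds on pairs of sets at two exponent pairs
symmetric about `(a, b)` give a strong bound at `(a, b)`, if `a + b > 1` with room to spare. Pairs
of sets may instead satisfy the bound of a constant kernel `M`. -/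
theorem exists_incidenceForm_le {a b α β : ℝ} (hα : α ≠ 0) (hβ : β ≠ 0) (ha : |α| ≤ a)
    (hb : |β| ≤ b) (hab : 1 ≤ (a - |α|) + (b - |β|)) :
    ∃ C : ℝ, 0 ≤ C ∧ ∀ {Z Y : Type} [Fintype Z] [Fintype Y] (R : Z → Y → Prop)
      (A : Z → Prop) (B : Y → Prop) (κ m M : ℝ), 0 ≤ M →
      (∀ (E : Finset Z) (G : Finset Y), (∀ z ∈ E, A z) → (∀ y ∈ G, B y) →
        0 < incidenceCount R E G →
        (Real.log (incidenceCount R E G) ≤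
            κ + m + (a - α) * Real.log E.card + (b - β) * Real.log G.card ∧
          Real.log (incidenceCount R E G) ≤
            κ - m + (a + α) * Real.log E.card + (b + β) * Real.log G.card) ∨
        (incidenceCount R E G : ℝ) ≤ M * (E.card * G.card)) →
      ∀ (f : Z → ℝ) (g : Y → ℝ), (∀ z, 0 ≤ f z) → (∀ y, 0 ≤ g y) →
        (∀ z, f z ≠ 0 → A z) → (∀ y, g y ≠ 0 → B y) →
        ∑ z, f z ^ (1 / a) ≤ 1 → ∑ y, g y ^ (1 / b) ≤ 1 →
        incidenceForm R f g ≤ C * Real.exp κ + Real.exp 2 * M * ((∑ z, f z) * ∑ y, g y) := by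
  have ha0 : 0 < a := (abs_pos.2 hα).trans_le ha
  have hb0 : 0 < b := (abs_pos.2 hβ).trans_le hb
  obtain ⟨C₁, hC₁, hsum₁⟩ := exists_sum_exp_neg_abs_le (c := α / a) (div_ne_zero hα ha0.ne')
  obtain ⟨C₂, hC₂, hsum₂⟩ := exists_sum_exp_neg_abs_le (c := β / b) (div_ne_zero hβ hb0.ne')
  refine ⟨Real.exp 2 * (C₁ + C₂), by positivity, fun {Z Y} _ _ R A B κ m M hM hR f g hf hg hfA hgB
    hf1 hg1 => ?_⟩
  obtain ⟨S, T, hST⟩ := incidenceForm_le_sum_expLevel R hf hg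
  have hF := (sum_exp_mul_card_expLevel_le hf (one_div_pos.2 ha0) S).trans hf1
  have hG := (sum_exp_mul_card_expLevel_le hg (one_div_pos.2 hb0) T).trans hg1
  have hF' (k : ℤ) : Real.exp (k * (1 / a)) * (expLevel f k).card ≤ 1 := by
    simpa using (sum_exp_mul_card_expLevel_le hf (one_div_pos.2 ha0) {k}).trans hf1
  have hG' (l : ℤ) : Real.exp (l * (1 / b)) * (expLevel g l).card ≤ 1 := by
    simpa using (sum_exp_mul_card_expLevel_le hg (one_div_pos.2 hb0) {l}).trans hg1
  -- `F k` and `H l` are the contributions of the levels to the normalized sums of `f ^ (1 / a)` and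
  -- `g ^ (1 / b)`, so each family has total at most `1`.
  set F : ℤ → ℝ := fun k => Real.exp (k * (1 / a)) * (expLevel f k).card with hFdef
  set H : ℤ → ℝ := fun l => Real.exp (l * (1 / b)) * (expLevel g l).card with hHdef
  have hF0 (k : ℤ) : 0 ≤ F k := by positivity
  have hH0 (l : ℤ) : 0 ≤ H l := by positivity
  have key (k l : ℤ) :
      Real.exp (k + 1 + (l + 1)) * incidenceCount R (expLevel f k) (expLevel g l) ≤
        Real.exp 2 * Real.exp κ * (Real.exp (-|α / a * k + (β / b * l + m)|) * F k +
            Real.exp (-|β / b * l + (α / a * k + m)|) * H l) +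
          Real.exp 2 * M * ((Real.exp k * (expLevel f k).card) *
            (Real.exp l * (expLevel g l).card)) := by
    have hrest : 0 ≤ Real.exp 2 * M * ((Real.exp k * (expLevel f k).card) *
      (Real.exp l * (expLevel g l).card)) := by positivity
    have hmain : 0 ≤ Real.exp 2 * Real.exp κ * (Real.exp (-|α / a * k + (β / b * l + m)|) * F k +
        Real.exp (-|β / b * l + (α / a * k + m)|) * H l) :=
      mul_nonneg (by positivity) (add_nonneg (mul_nonneg (Real.exp_pos _).le (hF0 k))
        (mul_nonneg (Real.exp_pos _).le (hH0 l)))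
    rcases Nat.eq_zero_or_pos (incidenceCount R (expLevel f k) (expLevel g l)) with h0 | hpos
    · rw [h0, Nat.cast_zero, mul_zero]
      exact add_nonneg hmain hrest
    · obtain ⟨hI1, hI2⟩ | hI := hR _ _ (fun z hz => hfA z (mem_expLevel.1 hz).1.ne')
        (fun y hy => hgB y (mem_expLevel.1 hy).1.ne') hpos
      swap
      · refine le_add_of_nonneg_of_le hmain ?_
        calc _ ≤ Real.exp (k + 1 + (l + 1)) *
              (M * ((expLevel f k).card * (expLevel g l).card)) := by gcongr
          _ = _ := by
            rw [show (k : ℝ) + 1 + (l + 1) = 2 + (k + l) by ring, Real.exp_add, Real.exp_add]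
            ring
      refine le_add_of_le_of_nonneg ?_ hrest
      set I : ℝ := ((incidenceCount R (expLevel f k) (expLevel g l) : ℕ) : ℝ) with hI
      have hIpos : 0 < I := by
        rw [hI]
        exact_mod_cast hpos
      obtain ⟨x, hx⟩ := Finset.card_pos.1 hpos
      simp only [Finset.mem_filter, Finset.mem_product] at hx
      have hE : (0 : ℝ) < (expLevel f k).card := by
        exact_mod_cast Finset.card_pos.2 ⟨_, hx.1.1⟩
      have hG : (0 : ℝ) < (expLevel g l).card := by
        exact_mod_cast Finset.card_pos.2 ⟨_, hx.1.2⟩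
      set e := Real.log (expLevel f k).card with he
      set h := Real.log (expLevel g l).card with hh
      have hFe : F k = Real.exp (k / a + e) := by
        rw [hFdef, Real.exp_add, he, Real.exp_log hE]
        ring_nf
      have hHe : H l = Real.exp (l / b + h) := by
        rw [hHdef, Real.exp_add, hh, Real.exp_log hG]
        ring_nf
      have hu : k / a + e ≤ 0 := by
        have : F k ≤ 1 := hF' k
        rwa [hFe, Real.exp_le_one_iff] at this
      have hv : l / b + h ≤ 0 := by
        have : H l ≤ 1 := hG' l
        rwa [hHe, Real.exp_le_one_iff] at this
      set u := k / a + e with hudef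
      set v := l / b + h with hvdef
      have hea : a * e = a * u - k := by rw [hudef]; field_simp; ring
      have hhb : b * h = b * v - l := by rw [hvdef]; field_simp; ring
      have heα : α * e = α * u - α / a * k := by rw [hudef]; field_simp; ring
      have hhβ : β * h = β * v - β / b * l := by rw [hvdef]; field_simp; ring
      -- In terms of `u = log (F k)` and `v = log (H l)` the two set bounds carry the factors `exp
      -- X` and `exp (-X)`. The better one gives the decay `exp (-|X|)` away from a line in the `(k,
      -- l)` plane.
      set X := α / a * k + (β / b * l + m) with hX
      have hX' : β / b * l + (α / a * k + m) = X := by rw [hX]; ring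
      have habs1 := neg_abs_le α
      have habs2 := le_abs_self α
      have habs3 := neg_abs_le β
      have habs4 := le_abs_self β
      -- This is where `a + b > 1` with room to spare enters: the powers of `F k, H l ≤ 1` have
      -- total exponent at least `1`, so their product is at most the larger of the two.
      have hmax : (a - |α|) * u + (b - |β|) * v ≤ max u v := by
        have h1 : (a - |α|) * u ≤ (a - |α|) * max u v :=
          mul_le_mul_of_nonneg_left (le_max_left _ _) (by linarith)
        have h2 : (b - |β|) * v ≤ (b - |β|) * max u v :=
          mul_le_mul_of_nonneg_left (le_max_right _ _) (by linarith)
        have h3 : max u v ≤ 0 := max_le hu hv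
        have h4 := mul_le_mul_of_nonpos_right hab h3
        rw [add_mul] at h4
        linarith
      have hlog : Real.log I ≤ κ - |X| - k - l + max u v := by
        have e1 : (a + α) * u ≤ (a - |α|) * u := mul_le_mul_of_nonpos_right (by linarith) hu
        have e2 : (a - α) * u ≤ (a - |α|) * u := mul_le_mul_of_nonpos_right (by linarith) hu
        have e3 : (b + β) * v ≤ (b - |β|) * v := mul_le_mul_of_nonpos_right (by linarith) hv
        have e4 : (b - β) * v ≤ (b - |β|) * v := mul_le_mul_of_nonpos_right (by linarith) hv
        rw [add_mul, add_mul] at hI2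
        rw [sub_mul, sub_mul] at hI1
        rw [add_mul] at e1 e3
        rw [sub_mul a α u] at e2
        rw [sub_mul b β v] at e4
        rcases abs_cases X with ⟨hX1, -⟩ | ⟨hX1, -⟩ <;> rw [hX1] <;> linarith
      have hlin : (k : ℝ) + 1 + (l + 1) + Real.log I ≤ 2 + κ + (-|X|) + max u v := by linarith
      calc Real.exp (k + 1 + (l + 1)) * I
          = Real.exp (k + 1 + (l + 1) + Real.log I) := by
            rw [Real.exp_add _ (Real.log I), Real.exp_log hIpos]
        _ ≤ Real.exp (2 + κ + (-|X|) + max u v) := Real.exp_le_exp.2 hlin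
        _ = Real.exp 2 * Real.exp κ * (Real.exp (-|X|) * Real.exp (max u v)) := by
            rw [Real.exp_add, Real.exp_add, Real.exp_add]
            ring
        _ ≤ Real.exp 2 * Real.exp κ * (Real.exp (-|X|) * F k + Real.exp (-|X|) * H l) := by
            rw [hFe, hHe, ← mul_add]
            gcongr
            rcases max_cases u v with ⟨h1, -⟩ | ⟨h1, -⟩ <;> rw [h1]
            · linarith [Real.exp_pos v]
            · linarith [Real.exp_pos u]
        _ = _ := by rw [hX']
  -- In the term with `F k` the decay is summed over `l`, in the term with `H l` over `k`. Both sums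
  -- are bounded uniformly in the shift, which absorbs `m`.
  have hfirst : ∑ k ∈ S, ∑ l ∈ T, Real.exp 2 * Real.exp κ *
      (Real.exp (-|α / a * k + (β / b * l + m)|) * F k +
        Real.exp (-|β / b * l + (α / a * k + m)|) * H l) ≤
          Real.exp 2 * (C₁ + C₂) * Real.exp κ := by
    calc _ = Real.exp 2 * Real.exp κ *
          (∑ k ∈ S, (∑ l ∈ T, Real.exp (-|β / b * l + (α / a * k + m)|)) * F k +
            ∑ l ∈ T, (∑ k ∈ S, Real.exp (-|α / a * k + (β / b * l + m)|)) * H l) := by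
          simp_rw [← Finset.mul_sum, Finset.sum_add_distrib, Finset.sum_mul]
          rw [Finset.sum_comm (s := T)]
          congr 2
          · refine Finset.sum_congr rfl fun k _ => Finset.sum_congr rfl fun l _ => ?_
            congr 4
            ring
          · refine Finset.sum_congr rfl fun k _ => Finset.sum_congr rfl fun l _ => ?_
            congr 4
            ring
      _ ≤ Real.exp 2 * Real.exp κ * (∑ k ∈ S, C₂ * F k + ∑ l ∈ T, C₁ * H l) := by
          gcongr with k _ l _
          · exact hsum₂ _ _
          · exact hsum₁ _ _
      _ ≤ Real.exp 2 * Real.exp κ * (C₂ * 1 + C₁ * 1) := by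
          rw [← Finset.mul_sum, ← Finset.mul_sum]
          gcongr
      _ = Real.exp 2 * (C₁ + C₂) * Real.exp κ := by ring
  have hsecond : ∑ k ∈ S, ∑ l ∈ T, Real.exp 2 * M * ((Real.exp k * (expLevel f k).card) *
      (Real.exp l * (expLevel g l).card)) ≤ Real.exp 2 * M * ((∑ z, f z) * ∑ y, g y) := by
    have h0 : ∑ k ∈ S, ∑ l ∈ T, Real.exp 2 * M * ((Real.exp k * (expLevel f k).card) *
        (Real.exp l * (expLevel g l).card)) = Real.exp 2 * M *
          ((∑ k ∈ S, Real.exp k * (expLevel f k).card) *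
            ∑ l ∈ T, Real.exp l * (expLevel g l).card) := by
      rw [Finset.sum_mul_sum, Finset.mul_sum]
      exact Finset.sum_congr rfl fun k _ => (Finset.mul_sum _ _ _).symm
    rw [h0]
    have h1 := sum_exp_mul_card_expLevel_le_sum hf S
    have h2 := sum_exp_mul_card_expLevel_le_sum hg T
    exact mul_le_mul_of_nonneg_left (mul_le_mul h1 h2 (Finset.sum_nonneg fun l _ => by positivity)
      (Finset.sum_nonneg fun z _ => hf z)) (by positivity)
  calc incidenceForm R f g
      ≤ ∑ k ∈ S, ∑ l ∈ T, Real.exp (k + 1 + (l + 1)) *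
          incidenceCount R (expLevel f k) (expLevel g l) := hST
    _ ≤ _ := Finset.sum_le_sum fun k _ => Finset.sum_le_sum fun l _ => key k l
    _ = _ := Finset.sum_congr rfl fun k _ => Finset.sum_add_distrib
    _ = _ := Finset.sum_add_distrib
    _ ≤ _ := add_le_add hfirst hsecond

end Interpolation

/-! ### Zeros of a quadratic form orthogonal to a subspace, and moments -/

section Counting

open QuadraticMap

lemma card_filter_quadratic_eq_zero_le {F : Type*} [Field F] [Fintype F] [DecidableEq F]
    {a : F} (ha : a ≠ 0) (b c : F) :
    (Finset.univ.filter fun t : F => a * t ^ 2 + b * t + c = 0).card ≤ 2 := by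
  have hne : (Polynomial.C a * Polynomial.X ^ 2 + Polynomial.C b * Polynomial.X +
      Polynomial.C c) ≠ 0 := fun h => by
    have := congrArg (fun p => Polynomial.coeff p 2) h
    simp at this
    exact ha this
  refine (Polynomial.card_le_degree_of_subset_roots (p := Polynomial.C a * Polynomial.X ^ 2 +
    Polynomial.C b * Polynomial.X + Polynomial.C c) fun t ht => ?_).trans
      Polynomial.natDegree_quadratic_le
  rw [Polynomial.mem_roots hne, Polynomial.IsRoot.def]
  simpa using ht

lemma card_fiber_mul_card {F V U : Type*} [Field F] [AddCommGroup V] [Module F V] [Fintype V]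
    [AddCommGroup U] [Module F U] [Fintype U] [DecidableEq U] (φ : V →ₗ[F] U)
    (hφ : Function.Surjective φ) (u : U) :
    (Finset.univ.filter fun y => φ y = u).card * Fintype.card U = Fintype.card V := by
  have h := Finset.card_eq_sum_card_fiberwise (f := φ) (s := Finset.univ) (t := Finset.univ)
    (fun _ _ => Finset.mem_coe.2 (Finset.mem_univ _))
  rw [Finset.card_univ] at h
  rw [h, Finset.sum_congr rfl fun b _ =>
    AddMonoidHom.card_fiber_eq_of_mem_range φ (hφ b) (hφ u), Finset.sum_const, Finset.card_univ,
    smul_eq_mul, mul_comm]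

lemma polarBilin_isRefl {F V : Type*} [Field F] [AddCommGroup V] [Module F V]
    (Q : QuadraticForm F V) : (polarBilin Q).IsRefl := fun x y h => by
  simpa [polar_comm _ y x] using h

variable {F V : Type*} [Field F] [AddCommGroup V] [Module F V] [Fintype V]
  {Q : QuadraticForm F V}

/-- If `Q` vanishes on `U`, then so does its polar form, so `U` lies in its own orthogonal space and
has at most half the dimension. -/
lemma exists_ne_zero_of_finrank_lt (hQ : (polarBilin Q).Nondegenerate) {U : Submodule F V}
    (hU : Module.finrank F V < 2 * Module.finrank F U) : ∃ u ∈ U, Q u ≠ 0 := by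
  by_contra! h
  have hle : U ≤ LinearMap.BilinForm.orthogonal (polarBilin Q) U := fun x hx y hy => by
    change polar Q y x = 0
    rw [polar, h _ (U.add_mem hy hx), h _ hx, h _ hy]
    simp
  have h1 := Submodule.finrank_mono hle
  rw [LinearMap.BilinForm.finrank_orthogonal hQ] at h1
  omega

open Classical in
/-- The zeros of `Q` that are orthogonal to the subspace `U`. -/
noncomputable def zerosOrthogonal (Q : QuadraticForm F V) (U : Submodule F V) : Finset V :=
  Finset.univ.filter fun y => Q y = 0 ∧ y ∈ LinearMap.BilinForm.orthogonal (polarBilin Q) U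

lemma mem_zerosOrthogonal {U : Submodule F V} {y : V} :
    y ∈ zerosOrthogonal Q U ↔ Q y = 0 ∧ ∀ u ∈ U, polar Q u y = 0 := by
  simp [zerosOrthogonal, LinearMap.BilinForm.mem_orthogonal_iff]

variable [Fintype F]

/-- Along each line of direction `u`, the form is a quadratic polynomial with leading coefficient `Q
u ≠ 0`, so it has at most two zeros there. Averaging over the translates of `U` by multiples of `u`
gives the bound. -/
lemma card_mul_card_le_of_ne_zero [DecidableEq F] {U : Submodule F V} {u : V}
    (hu : u ∈ U) (hQu : Q u ≠ 0) [DecidablePred (· ∈ U)] :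
    (Finset.univ.filter fun y => Q y = 0 ∧ y ∈ U).card * Fintype.card F ≤
      2 * (Finset.univ.filter fun y => y ∈ U).card := by
  classical
  have htrans (t : F) : (Finset.univ.filter fun y => Q (y + t • u) = 0 ∧ y ∈ U).card =
      (Finset.univ.filter fun y => Q y = 0 ∧ y ∈ U).card := by
    refine Finset.card_equiv (Equiv.addRight (t • u)) fun y => ?_
    simp only [Finset.mem_filter, Finset.mem_univ, true_and, Equiv.coe_addRight]
    rw [U.add_mem_iff_left (U.smul_mem t hu)]
  calc (Finset.univ.filter fun y => Q y = 0 ∧ y ∈ U).card * Fintype.card F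
      = ∑ t : F, (Finset.univ.filter fun y => Q (y + t • u) = 0 ∧ y ∈ U).card := by
        rw [Finset.sum_congr rfl fun t _ => htrans t, Finset.sum_const, Finset.card_univ,
          smul_eq_mul, mul_comm]
    _ = ∑ t : F, ∑ y ∈ Finset.univ.filter (fun y => y ∈ U),
          if Q (y + t • u) = 0 then 1 else 0 := by
        refine Finset.sum_congr rfl fun t _ => ?_
        rw [Finset.card_filter, Finset.sum_filter]
        refine Finset.sum_congr rfl fun y _ => ?_
        by_cases h1 : y ∈ U <;> by_cases h2 : Q (y + t • u) = 0 <;> simp [h1, h2]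
    _ = ∑ y ∈ Finset.univ.filter (fun y => y ∈ U),
          (Finset.univ.filter fun t : F => Q u * t ^ 2 + polar Q y u * t + Q y = 0).card := by
        rw [Finset.sum_comm]
        refine Finset.sum_congr rfl fun y _ => ?_
        rw [Finset.card_filter]
        refine Finset.sum_congr rfl fun t _ => ?_
        rw [QuadraticMap.map_add Q y (t • u), QuadraticMap.map_smul, polar_smul_right, smul_eq_mul,
          smul_eq_mul]
        congr 2
        ring
    _ ≤ ∑ y ∈ Finset.univ.filter (fun y => y ∈ U), 2 :=
        Finset.sum_le_sum fun y _ => card_filter_quadratic_eq_zero_le hQu _ _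
    _ = _ := by rw [Finset.sum_const, smul_eq_mul, mul_comm]

lemma card_filter_mem_eq_pow (U : Submodule F V) [DecidablePred (· ∈ U)] :
    (Finset.univ.filter fun y => y ∈ U).card = Fintype.card F ^ Module.finrank F U := by
  rw [← Module.card_eq_pow_finrank (K := F) (V := U), Fintype.card_subtype]

/-- The orthogonal space of `U` has more than half the dimension, so `Q` does not vanish on it.
Being a zero then saves a further factor of `q`, up to the constant `2`. -/
lemma card_zerosOrthogonal_mul_le (hQ : (polarBilin Q).Nondegenerate) {U : Submodule F V}
    (hU : 2 * Module.finrank F U < Module.finrank F V) :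
    (zerosOrthogonal Q U).card * Fintype.card F ^ (Module.finrank F U + 1) ≤
      2 * Fintype.card F ^ Module.finrank F V := by
  classical
  have hfr := LinearMap.BilinForm.finrank_orthogonal hQ U
  obtain ⟨u, hu, hQu⟩ := exists_ne_zero_of_finrank_lt hQ
    (U := LinearMap.BilinForm.orthogonal (polarBilin Q) U) (by omega)
  have h := card_mul_card_le_of_ne_zero hu hQu
  rw [card_filter_mem_eq_pow, hfr] at h
  calc (zerosOrthogonal Q U).card * Fintype.card F ^ (Module.finrank F U + 1)
      = (zerosOrthogonal Q U).card * Fintype.card F * Fintype.card F ^ Module.finrank F U := by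
        ring
    _ ≤ 2 * Fintype.card F ^ (Module.finrank F V - Module.finrank F U) *
          Fintype.card F ^ Module.finrank F U := Nat.mul_le_mul_right _ h
    _ = 2 * Fintype.card F ^ Module.finrank F V := by
        rw [mul_assoc, ← pow_add]
        congr 2
        omega

open Classical in
/-- The number of points of `E` that are orthogonal to `y`. -/
noncomputable def orthogonalCount (Q : QuadraticForm F V) (E : Finset V) (y : V) : ℕ :=
  (E.filter fun z => polar Q z y = 0).card

/-- Moments of the number of points of `E` orthogonal to a point of the quadric. -/
lemma sum_orthogonalCount_pow_le (hQ : (polarBilin Q).Nondegenerate) {k : ℕ}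
    (hk : Module.finrank F V = 2 * k + 2) {E : Finset V} (hE : (0 : V) ∉ E) (m : ℕ)
    (U : Submodule F V) (hU : Module.finrank F U + m = k) :
    ∑ y ∈ zerosOrthogonal Q U, orthogonalCount Q E y ^ m ≤
      2 * Fintype.card F ^ (k + 1) * E.card ^ m +
        2 * m * min (Fintype.card F ^ (2 * k) * E.card) (Fintype.card F ^ (2 * k + 1)) *
          E.card ^ (m - 1) := by
  classical
  set q := Fintype.card F with hq
  have hq0 : 0 < q := Fintype.card_pos
  induction m generalizing U with
  | zero =>
    have h := card_zerosOrthogonal_mul_le hQ (U := U) (by omega)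
    have hUk : Module.finrank F U = k := by omega
    rw [hUk, hk, ← hq] at h
    simp only [pow_zero, Finset.sum_const, smul_eq_mul, mul_one, mul_zero, zero_mul, add_zero]
    refine Nat.le_of_mul_le_mul_right (c := q ^ (k + 1)) ?_ (by positivity)
    calc _ ≤ _ := h
      _ = _ := by ring
  | succ m ih =>
    set β := min (q ^ (2 * k) * E.card) (q ^ (2 * k + 1)) with hβ
    -- One factor of the power is expanded as a sum over `z ∈ E`. Orthogonality to `z` is then an
    -- additional linear condition, to be absorbed into `U`.
    have hsplit : ∑ y ∈ zerosOrthogonal Q U, orthogonalCount Q E y ^ (m + 1) =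
        ∑ z ∈ E, ∑ y ∈ zerosOrthogonal Q U,
          if polar Q z y = 0 then orthogonalCount Q E y ^ m else 0 := by
      rw [Finset.sum_comm]
      refine Finset.sum_congr rfl fun y _ => ?_
      rw [← Finset.sum_filter, Finset.sum_const, smul_eq_mul, pow_succ, mul_comm]
      rfl
    -- For `z` outside `U` the condition enlarges `U` by one dimension, and the induction hypothesis
    -- applies.
    have hout (z : V) (hz : z ∉ U) : (∑ y ∈ zerosOrthogonal Q U,
        if polar Q z y = 0 then orthogonalCount Q E y ^ m else 0) ≤
          2 * q ^ (k + 1) * E.card ^ m + 2 * m * β * E.card ^ (m - 1) := by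
      have hfr : Module.finrank F ↥(U ⊔ Submodule.span F {z}) + m = k := by
        rw [Submodule.finrank_sup_span_singleton hz]
        omega
      refine le_trans (le_of_eq ?_) (ih _ hfr)
      rw [← Finset.sum_filter]
      refine Finset.sum_congr ?_ fun _ _ => rfl
      ext y
      simp only [Finset.mem_filter, mem_zerosOrthogonal]
      constructor
      · rintro ⟨⟨h1, h2⟩, h3⟩
        refine ⟨h1, fun u hu => ?_⟩
        obtain ⟨a, ha, b, hb, rfl⟩ := Submodule.mem_sup.1 hu
        obtain ⟨c, rfl⟩ := Submodule.mem_span_singleton.1 hb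
        rw [polar_add_left, polar_smul_left, h2 a ha, h3]
        simp
      · rintro ⟨h1, h2⟩
        exact ⟨⟨h1, fun u hu => h2 u (Submodule.mem_sup_left hu)⟩,
          h2 z (Submodule.mem_sup_right (Submodule.mem_span_singleton_self z))⟩
    -- For `z ∈ U` the condition is void, but such `z` are few: at most `q ^ j` with `j = dim U`,
    -- against at most `2 q ^ (2k + 1 - j)` zeros. Since `0 ∉ E`, only `j ≥ 1` matters.
    have hin : (E.filter fun z => z ∈ U).card * (zerosOrthogonal Q U).card ≤ 2 * β := by
      rcases Nat.eq_zero_or_pos (Module.finrank F U) with h0 | hpos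
      · have hbot : U = ⊥ := Submodule.finrank_eq_zero.1 h0
        have : E.filter (fun z => z ∈ U) = ∅ := by
          refine Finset.filter_eq_empty_iff.2 fun z hz hzU => hE ?_
          rw [hbot, Submodule.mem_bot] at hzU
          rwa [← hzU]
        rw [this]
        simp
      · have h := card_zerosOrthogonal_mul_le hQ (U := U) (by omega)
        rw [hk, ← hq] at h
        set j := Module.finrank F U with hj
        have h1 : (E.filter fun z => z ∈ U).card ≤ E.card := Finset.card_filter_le _ _
        have h2 : (E.filter fun z => z ∈ U).card ≤ q ^ j := by
          rw [hq, hj, ← card_filter_mem_eq_pow]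
          exact Finset.card_le_card (Finset.filter_subset_filter _ (Finset.subset_univ _))
        have h3 : (zerosOrthogonal Q U).card * q ^ j ≤ 2 * q ^ (2 * k + 1) := by
          refine Nat.le_of_mul_le_mul_right (c := q) ?_ hq0
          calc _ = (zerosOrthogonal Q U).card * q ^ (j + 1) := by ring
            _ ≤ _ := h
            _ = _ := by ring
        have h4 : (zerosOrthogonal Q U).card ≤ 2 * q ^ (2 * k) := by
          refine Nat.le_of_mul_le_mul_right (c := q) ?_ hq0
          calc (zerosOrthogonal Q U).card * q ≤ (zerosOrthogonal Q U).card * q ^ j := by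
                gcongr
                exact Nat.le_self_pow hpos.ne' q
            _ ≤ _ := h3
            _ = _ := by ring
        rw [hβ, ← Nat.mul_min_mul_left]
        refine le_min ?_ ?_
        · calc _ ≤ E.card * (2 * q ^ (2 * k)) := Nat.mul_le_mul h1 h4
            _ = _ := by ring
        · calc _ ≤ q ^ j * (zerosOrthogonal Q U).card := Nat.mul_le_mul_right _ h2
            _ = (zerosOrthogonal Q U).card * q ^ j := mul_comm _ _
            _ ≤ _ := h3
    have hinz (z : V) : (∑ y ∈ zerosOrthogonal Q U,
        if polar Q z y = 0 then orthogonalCount Q E y ^ m else 0) ≤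
          (zerosOrthogonal Q U).card * E.card ^ m := by
      rw [← smul_eq_mul]
      refine Finset.sum_le_card_nsmul _ _ _ fun y _ => ?_
      split_ifs
      · exact Nat.pow_le_pow_left (Finset.card_filter_le _ _) _
      · exact Nat.zero_le _
    rw [hsplit, ← Finset.sum_filter_add_sum_filter_not E (fun z => z ∈ U)]
    have hA := Finset.sum_le_card_nsmul (E.filter fun z => z ∈ U) _ _ fun z _ => hinz z
    have hB := Finset.sum_le_card_nsmul (E.filter fun z => ¬ z ∈ U) _ _ fun z hz =>
      hout z (Finset.mem_filter.1 hz).2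
    have hcard : (E.filter fun z => ¬ z ∈ U).card ≤ E.card := Finset.card_filter_le _ _
    rw [smul_eq_mul] at hA hB
    -- For `m = 0` the truncated exponent `m - 1` is harmless because of the factor `m`.
    have hm : m * E.card ^ (m - 1) * E.card = m * E.card ^ m := by
      rcases m with _ | m
      · simp
      · rw [mul_assoc, ← pow_succ]
        rfl
    calc _ ≤ (E.filter fun z => z ∈ U).card * ((zerosOrthogonal Q U).card * E.card ^ m) +
          (E.filter fun z => ¬ z ∈ U).card *
            (2 * q ^ (k + 1) * E.card ^ m + 2 * m * β * E.card ^ (m - 1)) := add_le_add hA hB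
      _ ≤ 2 * β * E.card ^ m + E.card *
            (2 * q ^ (k + 1) * E.card ^ m + 2 * m * β * E.card ^ (m - 1)) := by
          rw [← mul_assoc]
          gcongr
      _ = 2 * β * E.card ^ m + (2 * q ^ (k + 1) * E.card ^ (m + 1) +
            2 * β * (m * E.card ^ (m - 1) * E.card)) := by ring
      _ = _ := by
          rw [hm, Nat.add_sub_cancel]
          ring

end Counting

/-! ### Variance of the number of hyperplanes through a point -/

section SecondMoment

open QuadraticMap

variable {F V : Type*} [Field F] [AddCommGroup V] [Module F V]

open Classical in
/-- The number of `z ∈ E` whose hyperplane `{y | polar Q z y = Q z}` contains `y`. -/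
noncomputable def hyperplaneCount (Q : QuadraticForm F V) (E : Finset V) (y : V) : ℕ :=
  (E.filter fun z => polar Q z y = Q z).card

lemma incidenceCount_eq_sum (Q : QuadraticForm F V) (E G : Finset V) :
    incidenceCount (fun z y => polar Q z y = Q z) E G = ∑ y ∈ G, hyperplaneCount Q E y := by
  classical
  simp_rw [incidenceCount, hyperplaneCount, Finset.card_filter]
  rw [Finset.sum_product_right]

variable [Fintype V] {Q : QuadraticForm F V}

/-- Otherwise `z` is orthogonal to everything orthogonal to `w`, hence lies in the double orthogonal
space of the line of `w`, which is that line. -/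
lemma exists_polar_ne_zero (hQ : (polarBilin Q).Nondegenerate) {z w : V}
    (hzw : z ∉ Submodule.span F {w}) : ∃ y, polar Q w y = 0 ∧ polar Q z y ≠ 0 := by
  by_contra! h
  refine hzw ?_
  rw [← LinearMap.BilinForm.orthogonal_orthogonal hQ (polarBilin_isRefl Q) (Submodule.span F {w})]
  refine LinearMap.BilinForm.mem_orthogonal_iff.2 fun y hy => ?_
  have h1 := LinearMap.BilinForm.mem_orthogonal_iff.1 hy w (Submodule.mem_span_singleton_self w)
  change polar Q y z = 0
  rw [polar_comm]
  exact h y h1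

variable [Fintype F]

lemma card_polar_eq (hQ : (polarBilin Q).Nondegenerate) [DecidableEq F] {z : V} (hz : z ≠ 0)
    (a : F) : (Finset.univ.filter fun y => polar Q z y = a).card * Fintype.card F =
      Fintype.card F ^ Module.finrank F V := by
  obtain ⟨y, -, hy⟩ := exists_polar_ne_zero hQ (z := z) (w := 0) (by simpa using hz)
  rw [← Module.card_eq_pow_finrank]
  refine card_fiber_mul_card (polarBilin Q z) (fun c => ⟨(c / polar Q z y) • y, ?_⟩) a
  rw [map_smul, polarBilin_apply_apply, smul_eq_mul, div_mul_cancel₀ _ hy]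

lemma card_polar_eq_and (hQ : (polarBilin Q).Nondegenerate) [DecidableEq F] {z w : V}
    (hz : z ≠ 0) (hw : w ∉ Submodule.span F {z}) (a b : F) :
    (Finset.univ.filter fun y => polar Q z y = a ∧ polar Q w y = b).card *
      Fintype.card F ^ 2 = Fintype.card F ^ Module.finrank F V := by
  have hz' : z ∉ Submodule.span F {w} := fun h => by
    obtain ⟨c, rfl⟩ := Submodule.mem_span_singleton.1 h
    refine hw (Submodule.mem_span_singleton.2 ⟨c⁻¹, ?_⟩)
    have : c ≠ 0 := fun h0 => hz (by rw [h0, zero_smul])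
    rw [smul_smul, inv_mul_cancel₀ this, one_smul]
  obtain ⟨y, hy, hy'⟩ := exists_polar_ne_zero hQ hw
  obtain ⟨x, hx, hx'⟩ := exists_polar_ne_zero hQ hz'
  have h := card_fiber_mul_card ((polarBilin Q z).prod (polarBilin Q w))
    (fun c => ⟨(c.1 / polar Q z x) • x + (c.2 / polar Q w y) • y, ?_⟩) (a, b)
  · rw [Fintype.card_prod, ← pow_two, Module.card_eq_pow_finrank (K := F) (V := V)] at h
    rw [← h]
    congr 3
    ext t
    simp [Prod.ext_iff]
  · ext
    · simp [hy, div_mul_cancel₀ _ hx']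
    · simp [hx, div_mul_cancel₀ _ hy']

open Classical in
-- Hyperplanes of nonproportional vectors meet in exactly `q ^ (D - 2)` points, as if independent,
-- so these pairs cancel against the square of the mean. Only proportional pairs whose hyperplanes
-- meet contribute to the variance, and `m` bounds their number per vector.
lemma sum_hyperplaneCount_sub_sq_le (hQ : (polarBilin Q).Nondegenerate) {E : Finset V}
    (hE : ∀ z ∈ E, z ≠ 0) {m : ℕ} (hm : ∀ z ∈ E, (E.filter fun w => w ∈ Submodule.span F {z} ∧
      ∃ y, polar Q z y = Q z ∧ polar Q w y = Q w).card ≤ m) :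
    (∑ y, ((hyperplaneCount Q E y : ℝ) - E.card / Fintype.card F) ^ 2) * Fintype.card F ≤
      m * (Fintype.card F : ℝ) ^ Module.finrank F V * E.card := by
  set q := Fintype.card F with hq
  set D := Module.finrank F V with hD
  have hq0 : 0 < q := Fintype.card_pos
  have hqR : (0 : ℝ) < q := by exact_mod_cast hq0
  have hfirst : (∑ y, (hyperplaneCount Q E y : ℝ)) * q = (q : ℝ) ^ D * E.card := by
    have h1 : ∑ y, hyperplaneCount Q E y =
        ∑ z ∈ E, (Finset.univ.filter fun y => polar Q z y = Q z).card := by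
      simp_rw [hyperplaneCount, Finset.card_filter]
      rw [Finset.sum_comm]
    have h2 : (∑ y, hyperplaneCount Q E y) * q = q ^ D * E.card := by
      rw [h1, Finset.sum_mul, Finset.sum_congr rfl fun z hz => card_polar_eq hQ (hE z hz) (Q z),
        Finset.sum_const, smul_eq_mul, mul_comm]
    exact_mod_cast h2
  have hpair (z : V) (hz : z ∈ E) : (∑ w ∈ E,
      (Finset.univ.filter fun y => polar Q z y = Q z ∧ polar Q w y = Q w).card) * q ^ 2 ≤
        E.card * q ^ D + m * (q ^ D * q) := by
    rw [Finset.sum_mul]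
    have hpt (w : V) (_ : w ∈ E) :
        (Finset.univ.filter fun y => polar Q z y = Q z ∧ polar Q w y = Q w).card * q ^ 2 ≤
          q ^ D + if w ∈ Submodule.span F {z} ∧
            ∃ y, polar Q z y = Q z ∧ polar Q w y = Q w then q ^ D * q else 0 := by
      by_cases hw : w ∈ Submodule.span F {z}
      · by_cases hy : ∃ y, polar Q z y = Q z ∧ polar Q w y = Q w
        · rw [if_pos ⟨hw, hy⟩]
          refine le_add_left ?_
          rw [pow_two, ← mul_assoc, ← card_polar_eq hQ (hE z hz) (Q z)]
          gcongr with y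
          exact fun h => h.1
        · rw [if_neg fun h => hy h.2]
          push Not at hy
          rw [Finset.filter_eq_empty_iff.2 fun y _ h => hy y h.1 h.2]
          simp
      · rw [card_polar_eq_and hQ (hE z hz) hw]
        exact Nat.le_add_right _ _
    refine (Finset.sum_le_sum hpt).trans ?_
    rw [Finset.sum_add_distrib, Finset.sum_const, smul_eq_mul, ← Finset.sum_filter,
      Finset.sum_const, smul_eq_mul]
    gcongr
    exact hm z hz
  have hsecond : (∑ y, (hyperplaneCount Q E y : ℝ) ^ 2) * (q : ℝ) ^ 2 ≤
      E.card * (E.card * (q : ℝ) ^ D + m * ((q : ℝ) ^ D * q)) := by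
    have h1 : ∑ y, hyperplaneCount Q E y ^ 2 = ∑ z ∈ E, ∑ w ∈ E,
        (Finset.univ.filter fun y => polar Q z y = Q z ∧ polar Q w y = Q w).card := by
      simp_rw [hyperplaneCount, Finset.card_filter, pow_two, Finset.sum_mul_sum]
      rw [Finset.sum_comm]
      refine Finset.sum_congr rfl fun z _ => ?_
      rw [Finset.sum_comm]
      refine Finset.sum_congr rfl fun w _ => Finset.sum_congr rfl fun y _ => ?_
      by_cases h1 : polar Q z y = Q z <;> by_cases h2 : polar Q w y = Q w <;> simp [h1, h2]
    have h2 : (∑ y, hyperplaneCount Q E y ^ 2) * q ^ 2 ≤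
        E.card * (E.card * q ^ D + m * (q ^ D * q)) := by
      rw [h1, Finset.sum_mul, ← smul_eq_mul (E.card)]
      exact Finset.sum_le_card_nsmul _ _ _ hpair
    exact_mod_cast h2
  have hcardV : (Fintype.card V : ℝ) = (q : ℝ) ^ D := by
    exact_mod_cast Module.card_eq_pow_finrank (K := F) (V := V)
  have hexp : ∑ y, ((hyperplaneCount Q E y : ℝ) - E.card / q) ^ 2 =
      ∑ y, (hyperplaneCount Q E y : ℝ) ^ 2 -
        2 * (E.card / q) * ∑ y, (hyperplaneCount Q E y : ℝ) + (q : ℝ) ^ D * (E.card / q) ^ 2 := by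
    simp_rw [sub_sq]
    rw [Finset.sum_add_distrib, Finset.sum_sub_distrib, Finset.sum_const, Finset.card_univ,
      nsmul_eq_mul, hcardV, Finset.mul_sum]
    congr 2
    exact Finset.sum_congr rfl fun y _ => by ring
  have hS1 : ∑ y, (hyperplaneCount Q E y : ℝ) = (q : ℝ) ^ D * E.card / q := by
    rw [← hfirst]
    field_simp
  rw [hexp, hS1]
  refine le_of_mul_le_mul_right ?_ hqR
  have e1 : (∑ y, (hyperplaneCount Q E y : ℝ) ^ 2 - 2 * (E.card / q : ℝ) *
      ((q : ℝ) ^ D * E.card / q) + (q : ℝ) ^ D * (E.card / q : ℝ) ^ 2) * q * q =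
      (∑ y, (hyperplaneCount Q E y : ℝ) ^ 2) * (q : ℝ) ^ 2 - (q : ℝ) ^ D * (E.card : ℝ) ^ 2 := by
    field_simp
    ring
  rw [e1]
  nlinarith

open Classical in
lemma incidenceCount_sub_sq_le (hQ : (polarBilin Q).Nondegenerate) {E : Finset V}
    (hE : ∀ z ∈ E, z ≠ 0) {m : ℕ} (hm : ∀ z ∈ E, (E.filter fun w => w ∈ Submodule.span F {z} ∧
      ∃ y, polar Q z y = Q z ∧ polar Q w y = Q w).card ≤ m) (G : Finset V) :
    ((incidenceCount (fun z y => polar Q z y = Q z) E G : ℝ) -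
        E.card * G.card / Fintype.card F) ^ 2 * Fintype.card F ≤
      m * (Fintype.card F : ℝ) ^ Module.finrank F V * E.card * G.card := by
  have h := sum_hyperplaneCount_sub_sq_le hQ hE hm
  have h1 : (incidenceCount (fun z y => polar Q z y = Q z) E G : ℝ) -
      E.card * G.card / Fintype.card F =
        ∑ y ∈ G, ((hyperplaneCount Q E y : ℝ) - E.card / Fintype.card F) := by
    rw [incidenceCount_eq_sum, Finset.sum_sub_distrib, Finset.sum_const, nsmul_eq_mul]
    push_cast
    ring
  have h2 : (∑ y ∈ G, ((hyperplaneCount Q E y : ℝ) - E.card / Fintype.card F)) ^ 2 ≤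
      G.card * ∑ y, ((hyperplaneCount Q E y : ℝ) - E.card / Fintype.card F) ^ 2 := by
    refine sq_sum_le_card_mul_sum_sq.trans ?_
    gcongr
    exact Finset.subset_univ G
  rw [h1]
  calc _ ≤ (G.card * ∑ y, ((hyperplaneCount Q E y : ℝ) - E.card / Fintype.card F) ^ 2) *
        Fintype.card F := by gcongr
    _ = G.card * ((∑ y, ((hyperplaneCount Q E y : ℝ) - E.card / Fintype.card F) ^ 2) *
        Fintype.card F) := by ring
    _ ≤ G.card * (m * (Fintype.card F : ℝ) ^ Module.finrank F V * E.card) := by gcongr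
    _ = _ := by ring

/-- Incidences with points off the quadric. -/
lemma incidenceCount_sub_sq_le_of_ne_zero (hQ : (polarBilin Q).Nondegenerate) {E : Finset V}
    (hE : ∀ z ∈ E, Q z ≠ 0) (G : Finset V) :
    ((incidenceCount (fun z y => polar Q z y = Q z) E G : ℝ) -
        E.card * G.card / Fintype.card F) ^ 2 * Fintype.card F ≤
      (Fintype.card F : ℝ) ^ Module.finrank F V * E.card * G.card := by
  classical
  have h0 (z : V) (hz : z ∈ E) : z ≠ 0 := by
    rintro rfl
    exact hE _ hz (QuadraticMap.map_zero Q)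
  have h := incidenceCount_sub_sq_le hQ h0 (m := 1) (fun z hz => ?_) G
  · simpa using h
  · refine Finset.card_le_one_iff_subset_singleton.2 ⟨z, fun w hw => ?_⟩
    simp only [Finset.mem_filter] at hw
    obtain ⟨hwE, hspan, y, h1, h2⟩ := hw
    obtain ⟨c, rfl⟩ := Submodule.mem_span_singleton.1 hspan
    -- A common point of the hyperplanes of `z` and `c • z` forces `c * Q z = c * c * Q z`, hence `c
    -- = 1`. Thus `m = 1`, which saves a factor of `q` over singular vectors.
    rw [polar_smul_left, h1, QuadraticMap.map_smul, smul_eq_mul, smul_eq_mul] at h2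
    have h3 : c = c * c := mul_right_cancel₀ (hE z hz) h2
    have hc : c ≠ 0 := fun hc => h0 _ hwE (by rw [hc, zero_smul])
    have h4 : c = 1 := mul_left_cancel₀ hc (by rw [← h3, mul_one])
    simp [h4]

/-- Incidences with nonzero points. -/
lemma incidenceCount_sub_sq_le_of_zero_notMem (hQ : (polarBilin Q).Nondegenerate) {E : Finset V}
    (hE : (0 : V) ∉ E) (G : Finset V) :
    ((incidenceCount (fun z y => polar Q z y = Q z) E G : ℝ) -
        E.card * G.card / Fintype.card F) ^ 2 ≤
      (Fintype.card F : ℝ) ^ Module.finrank F V * E.card * G.card := by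
  classical
  have h := incidenceCount_sub_sq_le hQ (E := E) (m := Fintype.card F)
    (fun z hz h0 => hE (h0 ▸ hz)) (fun z hz => ?_) G
  · have hqR : (0 : ℝ) < Fintype.card F := by exact_mod_cast Fintype.card_pos
    refine le_of_mul_le_mul_right (h.trans (le_of_eq ?_)) hqR
    ring
  · have hz0 : z ≠ 0 := fun h0 => hE (h0 ▸ hz)
    calc _ ≤ (Finset.univ.filter fun w => w ∈ Submodule.span F {z}).card :=
          Finset.card_le_card fun w hw => by simpa using (Finset.mem_filter.1 hw).2.1
      _ = Fintype.card F := by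
          rw [card_filter_mem_eq_pow, finrank_span_singleton hz0, pow_one]

end SecondMoment

/-! ### Linear programming with the logarithms of the set bounds -/

section Exponents

/-- The logarithmic slack at `(x, y)` in the set bound
`I ≤ q ^ ((2k+1)(1+y) - (2k+2)x) * |E| ^ x * |G| ^ (1-y)`, where `L, e, g, i` are the logarithms of
`q, |E|, |G|, I`. -/
noncomputable def logSlack (k L e g i x y : ℝ) : ℝ :=
  ((2 * k + 1) * (1 + y) - (2 * k + 2) * x) * L + x * e + (1 - y) * g - i

variable {k L e g i K : ℝ}

/-- A nonnegative combination of the hypotheses: the trivial bound `h₁`, the variance bound `h₃`,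
and the two alternatives `hm` of the `k`-th moment. When the second term of the moment dominates,
both sides of its minimum are needed and `h₃` is not. -/
lemma logSlack_upper_vertex (hk : 1 ≤ k) (hK : 0 ≤ K) (h₁ : i ≤ e + g)
    (h₃ : 2 * i ≤ (2 * k + 2) * L + e + g + K)
    (hm : k * i ≤ (k - 1) * g + (k + 1) * L + k * e + K ∨
      (k * i ≤ (k - 1) * g + 2 * k * L + k * e + K ∧
        k * i ≤ (k - 1) * g + (2 * k + 1) * L + (k - 1) * e + K)) :
    -(k * K) ≤ logSlack k L e g i (k * (2 * k - 1) / (2 * k ^ 2 - 1)) (k / (2 * k ^ 2 - 1)) := by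
  have hD : 0 < 2 * k ^ 2 - 1 := by nlinarith
  have heq : logSlack k L e g i (k * (2 * k - 1) / (2 * k ^ 2 - 1)) (k / (2 * k ^ 2 - 1)) =
      ((k + 1) * (2 * k - 1) * L + k * (2 * k - 1) * e + (2 * k + 1) * (k - 1) * g -
        (2 * k ^ 2 - 1) * i) / (2 * k ^ 2 - 1) := by
    rw [logSlack]
    field_simp
    ring
  have hkK : k * K ≤ k * K * (2 * k ^ 2 - 1) := le_mul_of_one_le_right (by positivity) (by nlinarith)
  have hk1 : 0 ≤ k - 1 := by linarith
  rw [heq, le_div_iff₀ hD]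
  rcases hm with hm | ⟨hm, hm'⟩
  · have e1 := mul_le_mul_of_nonneg_left h₃ hk1
    have e2 := mul_le_mul_of_nonneg_left h₁ (mul_nonneg (by linarith : 0 ≤ 2 * k - 1) hk1)
    linarith
  · have e1 := mul_le_mul_of_nonneg_left hm' hk1
    have e2 := mul_le_mul_of_nonneg_left h₁ (mul_nonneg hk1 (by linarith : 0 ≤ k + 1))
    linarith

/-- Here the moment bound is the one with `E` and `G` exchanged. -/
lemma logSlack_lower_vertex (hk : 1 ≤ k) (hK : 0 ≤ K) (h₁ : i ≤ e + g)
    (h₂ : i ≤ 2 * k * L + g + K) (h₃ : 2 * i ≤ (2 * k + 2) * L + e + g + K)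
    (hm : k * i ≤ (k - 1) * e + (k + 1) * L + k * g + K ∨
      k * i ≤ (k - 1) * e + (2 * k + 1) * L + (k - 1) * g + K) :
    -(k * K) ≤ logSlack k L e g i ((2 * k - 1) / (2 * k)) ((k - 1) / (2 * k ^ 2)) := by
  have hk0 : 0 < k := by linarith
  have hk1 : 0 ≤ k - 1 := by linarith
  have heq : logSlack k L e g i ((2 * k - 1) / (2 * k)) ((k - 1) / (2 * k ^ 2)) =
      (k * ((k + 1) * (2 * k - 1) * L + k * (2 * k - 1) * e + (2 * k ^ 2 - k + 1) * g -
        2 * k ^ 2 * i)) / (2 * k ^ 3) := by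
    rw [logSlack]
    field_simp
    ring
  have hquad : 0 ≤ 2 * k ^ 2 - 3 * k + 2 := by nlinarith [sq_nonneg (k - 1)]
  have hkK : (3 * k ^ 2 - 3 * k + 2) * K ≤ k * K * (2 * k ^ 3) := by
    have : 3 * k ^ 2 - 3 * k + 2 ≤ k * (2 * k ^ 3) := by
      have h : 0 ≤ (k - 1) * (2 * k ^ 3 + 2 * k ^ 2 - k + 2) :=
        mul_nonneg hk1 (by nlinarith [pow_pos hk0 3])
      linarith
    calc _ ≤ k * (2 * k ^ 3) * K := mul_le_mul_of_nonneg_right this hK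
      _ = _ := by ring
  rw [heq, le_div_iff₀ (by positivity)]
  have hquadK : 0 ≤ (2 * k ^ 2 - 3 * k + 2) * K := mul_nonneg hquad hK
  have hkk : 0 ≤ (k - 1) * K := mul_nonneg hk1 hK
  rcases hm with hm | hm
  · have e3 := mul_le_mul_of_nonneg_left h₃ (mul_nonneg hk0.le hk1)
    have hc : 0 ≤ 2 * k ^ 2 - 2 * k + 2 := by nlinarith
    -- At `|E| = q ^ (k + 1)`, the size of a totally singular subspace of half the dimension, the
    -- moment bound and the trivial bound `|E||G|` coincide. Above it the former is better, below it
    -- the latter.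
    rcases le_total ((k + 1) * L) e with he | he
    · have e1 := mul_le_mul_of_nonneg_left hm hc
      have e2 := mul_le_mul_of_nonneg_left he hquad
      linarith
    · have e1 := mul_le_mul_of_nonneg_left h₁ (mul_nonneg hk0.le hc)
      have e2 := mul_le_mul_of_nonneg_left he hk0.le
      nlinarith
  · have e1 := mul_le_mul_of_nonneg_left hm (mul_nonneg hk0.le hk1)
    have e2 := mul_le_mul_of_nonneg_left h₁ (mul_nonneg hk0.le
      (by nlinarith : 0 ≤ k ^ 2 + k - 1))
    have e3 := mul_le_mul_of_nonneg_left h₂ hk0.le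
    have : k ^ 2 * K ≤ (3 * k ^ 2 - 3 * k + 2) * K :=
      mul_le_mul_of_nonneg_right (by nlinarith) hK
    linarith

/-- A target exponent pair lies above a scaled point of the open segment between the two vertices
with the same abscissa. -/
lemma exists_scaled_mem_segment (hk : 1 ≤ k) {x y : ℝ} (hx0 : 0 < x)
    (hx : x ≤ (2 * k + 1) / (2 * k + 2)) (h₁ : x ≤ (2 * k + 1) * y)
    (h₂ : (k + 1) * x ≤ k * (1 + y)) :
    ∃ t s : ℝ, 0 < t ∧ t ≤ 1 ∧ 0 < s ∧ s < 1 ∧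
      x = t * ((1 - s) * ((2 * k - 1) / (2 * k)) + s * (k * (2 * k - 1) / (2 * k ^ 2 - 1))) ∧
      t * ((1 - s) * ((k - 1) / (2 * k ^ 2)) + s * (k / (2 * k ^ 2 - 1))) ≤ y := by
  have hk0 : 0 < k := by linarith
  have hD : 0 < 2 * k ^ 2 - 1 := by nlinarith
  have hN : 0 < 2 * k ^ 2 + 2 * k + 1 := by positivity
  set a := (2 * k - 1) / (2 * k) with ha
  set b := k * (2 * k - 1) / (2 * k ^ 2 - 1) with hb
  -- This is the abscissa of `P₂`. The next inequalities place the abscissae `c` of `P₂` and `(2k +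
  -- 1) / (2k + 2)` of `P₁` strictly between those of the two vertices.
  set c := k * (2 * k + 1) / (2 * k ^ 2 + 2 * k + 1) with hc
  have hac : a < c := by
    rw [ha, hc, div_lt_div_iff₀ (by positivity) hN]
    nlinarith
  have hcx : c ≤ (2 * k + 1) / (2 * k + 2) := by
    rw [hc, div_le_div_iff₀ hN (by positivity)]
    nlinarith
  have hxb : (2 * k + 1) / (2 * k + 2) < b := by
    rw [hb, div_lt_div_iff₀ (by positivity) hD]
    nlinarith
  have hy2 : (k - 1) / (2 * k ^ 2) = (k + 1) / k * a - 1 := by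
    rw [ha]
    field_simp
    ring
  have hy1 : k / (2 * k ^ 2 - 1) = (k + 1) / k * b - 1 := by
    rw [hb, div_eq_iff hD.ne', sub_mul, one_mul, mul_assoc, div_mul_cancel₀ _ hD.ne']
    field_simp
    ring
  have hseg (s : ℝ) : (1 - s) * ((k - 1) / (2 * k ^ 2)) + s * (k / (2 * k ^ 2 - 1)) =
      (k + 1) / k * ((1 - s) * a + s * b) - 1 := by
    rw [hy2, hy1]
    ring
  have hmem (w : ℝ) (hw : c ≤ w) (hw' : w ≤ (2 * k + 1) / (2 * k + 2)) :
      0 < (w - a) / (b - a) ∧ (w - a) / (b - a) < 1 ∧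
        w = (1 - (w - a) / (b - a)) * a + (w - a) / (b - a) * b := by
    have hba : 0 < b - a := by linarith
    refine ⟨div_pos (by linarith) hba, (div_lt_one hba).2 (by linarith), ?_⟩
    field_simp
    ring
  rcases le_total c x with hcx' | hcx'
  · obtain ⟨hs0, hs1, hs⟩ := hmem x hcx' hx
    refine ⟨1, (x - a) / (b - a), one_pos, le_rfl, hs0, hs1, by rw [one_mul, ← hs], ?_⟩
    rw [one_mul, hseg, ← hs, div_mul_eq_mul_div, sub_le_iff_le_add, div_le_iff₀ hk0]
    linarith
  · obtain ⟨hs0, hs1, hs⟩ := hmem c le_rfl hcx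
    have hc0 : 0 < c := by positivity
    refine ⟨x / c, (c - a) / (b - a), div_pos hx0 hc0, (div_le_one hc0).2 hcx', hs0, hs1,
      by rw [← hs, div_mul_cancel₀ _ hc0.ne'], ?_⟩
    -- To the left of `P₂` the point used is a multiple of `P₂`, on the edge from the origin with
    -- slope `1 / (2k + 1)`.
    have hval : x / c * ((k + 1) / k * c - 1) = x / (2 * k + 1) := by
      rw [hc]
      field_simp
      ring
    rw [hseg, ← hs, hval, div_le_iff₀ (by positivity)]
    linarith

/-- Around a target exponent pair there is a segment on which the slack is controlled by its
values at the origin and at the two vertices. -/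
lemma exists_direction_of_vertices (hk : 1 ≤ k) {x y : ℝ} (hx0 : 0 < x) (hy1 : y ≤ 1)
    (hx : x ≤ (2 * k + 1) / (2 * k + 2)) (h₁ : x ≤ (2 * k + 1) * y)
    (h₂ : (k + 1) * x ≤ k * (1 + y)) :
    ∃ v w : ℝ, v ≠ 0 ∧ w ≠ 0 ∧ ∀ ε : ℝ, |ε| ≤ 1 → ∀ L e g i K : ℝ, 0 ≤ K →
      g ≤ (2 * k + 1) * L + K →
      -K ≤ logSlack k L e g i 0 0 →
      -K ≤ logSlack k L e g i (k * (2 * k - 1) / (2 * k ^ 2 - 1)) (k / (2 * k ^ 2 - 1)) →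
      -K ≤ logSlack k L e g i ((2 * k - 1) / (2 * k)) ((k - 1) / (2 * k ^ 2)) →
      -(2 * K) ≤ logSlack k L e g i (x + ε * v) (y + ε * w) := by
  obtain ⟨t, s, ht0, ht1, hs0, hs1, hxt, hyt⟩ := exists_scaled_mem_segment hk hx0 hx h₁ h₂
  have hk0 : 0 < k := by linarith
  have hD : 0 < 2 * k ^ 2 - 1 := by nlinarith
  have hba : (2 * k - 1) / (2 * k) < k * (2 * k - 1) / (2 * k ^ 2 - 1) := by
    rw [div_lt_div_iff₀ (by positivity) hD]
    nlinarith
  have hba' : (k - 1) / (2 * k ^ 2) < k / (2 * k ^ 2 - 1) := by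
    rw [div_lt_div_iff₀ (by positivity) hD]
    nlinarith [pow_pos hk0 3]
  have hp : 0 ≤ (k - 1) / (2 * k ^ 2) := div_nonneg (by linarith) (by positivity)
  have hp' : 0 ≤ k / (2 * k ^ 2 - 1) := by positivity
  set a := (2 * k - 1) / (2 * k) with ha
  set b := k * (2 * k - 1) / (2 * k ^ 2 - 1) with hb
  set a' := (k - 1) / (2 * k ^ 2) with ha'
  set b' := k / (2 * k ^ 2 - 1) with hb'
  set δ := min s (1 - s) with hδ
  have hδ0 : 0 < δ := lt_min hs0 (by linarith)
  refine ⟨t * δ * (b - a), t * δ * (b' - a'), by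
    have : 0 < b - a := by linarith
    positivity, by
    have : 0 < b' - a' := by linarith
    positivity, fun ε hε L e g i K hK hg h0 hup hlow => ?_⟩
  have hεδ : |ε * δ| ≤ δ := by
    rw [abs_mul, abs_of_pos hδ0]
    exact mul_le_of_le_one_left hδ0.le hε
  obtain ⟨hεδ1, hεδ2⟩ := abs_le.1 hεδ
  have hr0 : 0 ≤ s + ε * δ := by linarith [min_le_left s (1 - s)]
  have hr1 : 0 ≤ 1 - (s + ε * δ) := by linarith [min_le_right s (1 - s)]
  set r := s + ε * δ with hr
  set η := y - t * ((1 - s) * a' + s * b') with hη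
  have hη0 : 0 ≤ η := by linarith
  have hη1 : η ≤ 1 := by
    have : 0 ≤ t * ((1 - s) * a' + s * b') := by
      have : 0 ≤ 1 - s := by linarith
      positivity
    linarith
  -- The slack is affine in the exponent pair. Moving up by `η` adds `η * ((2k + 1) * L - g)`, which
  -- is essentially nonnegative because `G` lies on the quadric.
  have hid : logSlack k L e g i (x + ε * (t * δ * (b - a))) (y + ε * (t * δ * (b' - a'))) =
      t * ((1 - r) * logSlack k L e g i a a' + r * logSlack k L e g i b b') +
        (1 - t) * logSlack k L e g i 0 0 + η * ((2 * k + 1) * L - g) := by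
    rw [hη, hr, hxt]
    simp only [logSlack]
    ring
  rw [hid]
  have e1 := mul_le_mul_of_nonneg_left hlow hr1
  have e2 := mul_le_mul_of_nonneg_left hup hr0
  have e3 : -K ≤ (1 - r) * logSlack k L e g i a a' + r * logSlack k L e g i b b' := by linarith
  have e4 := mul_le_mul_of_nonneg_left e3 ht0.le
  have e5 := mul_le_mul_of_nonneg_left h0 (by linarith : 0 ≤ 1 - t)
  have e6 : η * (-K) ≤ η * ((2 * k + 1) * L - g) := mul_le_mul_of_nonneg_left (by linarith) hη0
  have e7 : η * K ≤ 1 * K := mul_le_mul_of_nonneg_right hη1 hK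
  linarith

/-- Around a target exponent pair there is a segment on which the slack is controlled by its
values at `(0, 0)`, `(1, 0)` and `(1/2, 1/2)`. -/
lemma exists_direction_of_l2 (hk : 1 ≤ k) {x y : ℝ} (hx0 : 0 < x) (hy1 : y ≤ 1)
    (hx : x ≤ (2 * k + 1) / (2 * k + 2)) (h₁ : x ≤ (2 * k + 1) * y) :
    ∃ v w c : ℝ, v ≠ 0 ∧ w ≠ 0 ∧ ∀ ε : ℝ, |ε| ≤ 1 → ∀ L e g i K : ℝ, 0 ≤ K →
      g ≤ (2 * k + 1) * L + K →
      -K ≤ logSlack k L e g i 0 0 →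
      -L ≤ logSlack k L e g i 1 0 →
      k * L - K ≤ logSlack k L e g i (1 / 2) (1 / 2) →
      -(2 * K) - ε * c * L ≤ logSlack k L e g i (x + ε * v) (y + ε * w) := by
  have hk0 : 0 < k := by linarith
  set t := x * (2 * k + 2) / (2 * k + 1) with ht
  have ht0 : 0 < t := by positivity
  have ht1 : t ≤ 1 := by
    rw [le_div_iff₀ (by positivity)] at hx
    rw [ht, div_le_one (by positivity)]
    exact hx
  -- The direction runs along the segment from `(1, 0)` to `(1/2, 1/2)`. At its fraction `1 / (k +
  -- 1)` the loss `L` at the first end balances the gain `k * L` at the second. That balance point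
  -- has coordinates `(2k + 1) / (2k + 2)` and `1 / (2k + 2)`, and `t` scales it to abscissa `x`.
  -- Off balance the slack varies linearly, which is recorded by `c`.
  refine ⟨t / (k + 1) / 2, -(t / (k + 1) / 2), t, by positivity, by
    rw [neg_ne_zero]
    positivity, fun ε hε L e g i K hK hg h0 h10 h22 => ?_⟩
  obtain ⟨hε1, hε2⟩ := abs_le.1 hε
  set r := (1 - ε) / (k + 1) with hr
  have hr0 : 0 ≤ r := div_nonneg (by linarith) (by linarith)
  have hr1 : 0 ≤ 1 - r := by
    rw [hr, sub_nonneg, div_le_one (by positivity)]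
    linarith
  set η := y - t / (2 * k + 2) with hη
  have htx : t / (2 * k + 2) = x / (2 * k + 1) := by
    rw [ht]
    field_simp
  have hη0 : 0 ≤ η := by
    rw [hη, htx, sub_nonneg, div_le_iff₀ (by positivity)]
    linarith
  have hη1 : η ≤ 1 := by
    have : 0 ≤ t / (2 * k + 2) := by positivity
    linarith
  have hid : logSlack k L e g i (x + ε * (t / (k + 1) / 2)) (y + ε * -(t / (k + 1) / 2)) =
      t * ((1 - r) * logSlack k L e g i 1 0 + r * logSlack k L e g i (1 / 2) (1 / 2)) +
        (1 - t) * logSlack k L e g i 0 0 + η * ((2 * k + 1) * L - g) := by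
    have hxt : x = t * (2 * k + 1) / (2 * k + 2) := by
      rw [ht]
      field_simp
    rw [hη, hr, hxt]
    simp only [logSlack]
    field_simp
    ring
  rw [hid]
  have e1 := mul_le_mul_of_nonneg_left h10 hr1
  have e2 := mul_le_mul_of_nonneg_left h22 hr0
  have hrk : r * k * L = L * (1 - ε) - r * L := by
    rw [hr]
    field_simp
    ring
  have hrK : r * K ≤ 1 * K := mul_le_mul_of_nonneg_right (by linarith) hK
  have e3 : -K - ε * L ≤ (1 - r) * logSlack k L e g i 1 0 +
      r * logSlack k L e g i (1 / 2) (1 / 2) := by linarith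
  have e4 := mul_le_mul_of_nonneg_left e3 ht0.le
  have e5 := mul_le_mul_of_nonneg_left h0 (by linarith : 0 ≤ 1 - t)
  have e6 : η * (-K) ≤ η * ((2 * k + 1) * L - g) := mul_le_mul_of_nonneg_left (by linarith) hη0
  have e7 : η * K ≤ 1 * K := mul_le_mul_of_nonneg_right hη1 hK
  linarith

end Exponents

/-! ### Incidence bounds for sets in logarithmic form -/

section LogBounds

open QuadraticMap

lemma card_pos_of_incidenceCount_pos {Z Y : Type*} {R : Z → Y → Prop} {E : Finset Z}
    {G : Finset Y} (h : 0 < incidenceCount R E G) : 0 < E.card ∧ 0 < G.card := by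
  obtain ⟨p, hp⟩ := Finset.card_pos.1 h
  simp only [Finset.mem_filter, Finset.mem_product] at hp
  exact ⟨Finset.card_pos.2 ⟨_, hp.1.1⟩, Finset.card_pos.2 ⟨_, hp.1.2⟩⟩

lemma log_incidenceCount_le {Z Y : Type*} {R : Z → Y → Prop} {E : Finset Z}
    {G : Finset Y} (h : 0 < incidenceCount R E G) :
    Real.log (incidenceCount R E G) ≤ Real.log E.card + Real.log G.card := by
  obtain ⟨hE, hG⟩ := card_pos_of_incidenceCount_pos h
  have h1 : incidenceCount R E G ≤ E.card * G.card := by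
    classical
    rw [← Finset.card_product]
    exact Finset.card_filter_le _ _
  rw [← Real.log_mul (by positivity) (by positivity)]
  exact Real.log_le_log (by exact_mod_cast h) (by exact_mod_cast h1)

variable {F V : Type*} [Field F] [AddCommGroup V] [Module F V] {Q : QuadraticForm F V}

lemma incidenceCount_comm_of_singular {E G : Finset V} (hE : ∀ z ∈ E, Q z = 0)
    (hG : ∀ y ∈ G, Q y = 0) : incidenceCount (fun z y => polar Q z y = Q z) E G =
      incidenceCount (fun z y => polar Q z y = Q z) G E := by
  classical
  refine Finset.card_equiv (Equiv.prodComm V V) fun p => ?_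
  simp only [Finset.mem_filter, Finset.mem_product, Equiv.prodComm_apply, Prod.fst_swap,
    Prod.snd_swap]
  constructor
  · rintro ⟨⟨h1, h2⟩, h3⟩
    exact ⟨⟨h2, h1⟩, by rw [polar_comm, h3, hE _ h1, hG _ h2]⟩
  · rintro ⟨⟨h1, h2⟩, h3⟩
    exact ⟨⟨h2, h1⟩, by rw [polar_comm, h3, hE _ h2, hG _ h1]⟩

variable [Fintype F]

/-- A bound on all `hyperplaneCount`s bounds the number of incidences. -/
lemma log_incidenceCount_le_of_forall {E G : Finset V}
    (h : 0 < incidenceCount (fun z y => polar Q z y = Q z) E G) {n : ℕ}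
    (hn : ∀ y ∈ G, hyperplaneCount Q E y ≤ 2 * Fintype.card F ^ n) :
    Real.log (incidenceCount (fun z y => polar Q z y = Q z) E G) ≤
      n * Real.log (Fintype.card F) + Real.log G.card + Real.log 2 := by
  obtain ⟨hE, hG⟩ := card_pos_of_incidenceCount_pos h
  have hq : (0 : ℝ) < Fintype.card F := by exact_mod_cast Fintype.card_pos
  have h1 : incidenceCount (fun z y => polar Q z y = Q z) E G ≤
      G.card * (2 * Fintype.card F ^ n) := by
    rw [incidenceCount_eq_sum, ← smul_eq_mul]
    exact Finset.sum_le_card_nsmul _ _ _ hn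
  have h2 : (incidenceCount (fun z y => polar Q z y = Q z) E G : ℝ) ≤
      G.card * (2 * (Fintype.card F : ℝ) ^ n) := by exact_mod_cast h1
  have h3 := Real.log_le_log (by exact_mod_cast h) h2
  rw [Real.log_mul (by positivity) (by positivity), Real.log_mul (by norm_num) (by positivity),
    Real.log_pow] at h3
  linarith

variable [Fintype V]

/-- All absolute constants of the set bounds are absorbed into `log (4k)`, and after division by the
exponents into `k * log (4k)`. -/
lemma one_le_log_slack_const {k : ℕ} (hk : 1 ≤ k) :
    Real.log 4 ≤ Real.log (4 * k) ∧ Real.log 2 ≤ Real.log (4 * k) ∧ 0 ≤ Real.log (4 * k) ∧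
      Real.log (4 * k) ≤ k * Real.log (4 * k) := by
  have hk' : (1 : ℝ) ≤ k := by exact_mod_cast hk
  have h0 : 0 ≤ Real.log (4 * k) := Real.log_nonneg (by linarith)
  exact ⟨Real.log_le_log (by norm_num) (by linarith), Real.log_le_log (by norm_num) (by linarith),
    h0, le_mul_of_one_le_left h0 hk'⟩

lemma card_zeros_le (hQ : (polarBilin Q).Nondegenerate) {k : ℕ}
    (hk : Module.finrank F V = 2 * k + 2) {G : Finset V} (hG : ∀ y ∈ G, Q y = 0) :
    (G.card : ℝ) ≤ 2 * (Fintype.card F : ℝ) ^ (2 * k + 1) := by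
  have h := card_zerosOrthogonal_mul_le hQ (U := ⊥) (by simp [hk])
  have hsub : G ⊆ zerosOrthogonal Q ⊥ := fun y hy =>
    mem_zerosOrthogonal.2 ⟨hG y hy, fun u hu => by
      rw [(Submodule.mem_bot F).1 hu]
      simp⟩
  rw [finrank_bot, hk] at h
  have h2 : (zerosOrthogonal Q ⊥).card ≤ 2 * Fintype.card F ^ (2 * k + 1) := by
    refine Nat.le_of_mul_le_mul_right (c := Fintype.card F) ?_ Fintype.card_pos
    calc _ = (zerosOrthogonal Q ⊥).card * Fintype.card F ^ (0 + 1) := by ring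
      _ ≤ _ := h
      _ = _ := by ring
  exact_mod_cast (Finset.card_le_card hsub).trans h2

lemma log_card_zeros_le (hQ : (polarBilin Q).Nondegenerate) {k : ℕ}
    (hk : Module.finrank F V = 2 * k + 2) {G : Finset V} (hG : ∀ y ∈ G, Q y = 0)
    (hG0 : 0 < G.card) :
    Real.log G.card ≤ (2 * k + 1) * Real.log (Fintype.card F) + Real.log 2 := by
  have hq : (0 : ℝ) < Fintype.card F := by exact_mod_cast Fintype.card_pos
  have h := Real.log_le_log (by exact_mod_cast hG0) (card_zeros_le hQ hk hG)
  rw [Real.log_mul (by norm_num) (by positivity), Real.log_pow] at h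
  push_cast at h
  linarith

open Classical in
-- For singular `z` the incidence is orthogonality to `y`, so the zeros orthogonal to the line of
-- `y` are counted.
lemma hyperplaneCount_le_of_singular (hQ : (polarBilin Q).Nondegenerate) {k : ℕ}
    (hk1 : 1 ≤ k) (hk : Module.finrank F V = 2 * k + 2) {E : Finset V} (hE : ∀ z ∈ E, Q z = 0)
    {y : V} (hy : y ≠ 0) : hyperplaneCount Q E y ≤ 2 * Fintype.card F ^ (2 * k) := by
  have hfr : Module.finrank F (Submodule.span F {y}) = 1 := finrank_span_singleton hy
  have h := card_zerosOrthogonal_mul_le hQ (U := Submodule.span F {y}) (by omega)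
  rw [hfr, hk] at h
  refine Nat.le_of_mul_le_mul_right (c := Fintype.card F ^ 2) ?_
    (pow_pos Fintype.card_pos 2)
  calc _ ≤ (zerosOrthogonal Q (Submodule.span F {y})).card * Fintype.card F ^ (1 + 1) := by
        refine Nat.mul_le_mul_right _ (Finset.card_le_card fun z hz => ?_)
        obtain ⟨hzE, hzy⟩ := Finset.mem_filter.1 hz
        refine mem_zerosOrthogonal.2 ⟨hE z hzE, fun u hu => ?_⟩
        obtain ⟨c, rfl⟩ := Submodule.mem_span_singleton.1 hu
        rw [polar_smul_left, polar_comm, hzy, hE z hzE, smul_zero]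
    _ ≤ _ := h
    _ = _ := by ring

open Classical in
-- As `y` is singular, `z ↦ y - z` maps the vectors counted into the quadric.
lemma hyperplaneCount_le (hQ : (polarBilin Q).Nondegenerate) {k : ℕ}
    (hk : Module.finrank F V = 2 * k + 2) {E : Finset V} {y : V} (hy : Q y = 0) :
    hyperplaneCount Q E y ≤ 2 * Fintype.card F ^ (2 * k + 1) := by
  have h := card_zeros_le hQ hk
    (G := (E.filter fun z => polar Q z y = Q z).image fun z => y - z) fun w hw => by
      obtain ⟨z, hz, rfl⟩ := Finset.mem_image.1 hw
      rw [sub_eq_add_neg, QuadraticMap.map_add Q y (-z), polar_neg_right, polar_comm,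
        (Finset.mem_filter.1 hz).2, hy, QuadraticMap.map_neg]
      ring
  rw [Finset.card_image_of_injective _ sub_right_injective] at h
  exact_mod_cast h

/-- Either the count is at most twice its mean, or the deviation is at least half the count. -/
lemma le_or_log_le_of_sub_sq_le {I E G q A : ℝ} (hI : 0 < I) (hE : 0 < E) (hG : 0 < G)
    (hA : 0 < A) (h : (I - E * G / q) ^ 2 ≤ A * E * G) :
    I ≤ 2 / q * (E * G) ∨
      2 * Real.log I ≤ Real.log A + Real.log E + Real.log G + Real.log 4 := by
  rcases le_or_gt I (2 / q * (E * G)) with h1 | h1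
  · exact Or.inl h1
  · right
    have h2 : 0 ≤ I / 2 := by positivity
    have h3 : I / 2 ≤ I - E * G / q := by
      have : 2 / q * (E * G) = 2 * (E * G / q) := by ring
      linarith
    have h4 : I ^ 2 ≤ 4 * (A * E * G) := by nlinarith [pow_le_pow_left₀ h2 h3 2]
    have h5 := Real.log_le_log (by positivity) h4
    rw [Real.log_pow, Real.log_mul (by norm_num) (by positivity),
      Real.log_mul (by positivity) hG.ne', Real.log_mul hA.ne' hE.ne'] at h5
    push_cast at h5
    linarith

/-- The power mean inequality over `G`, followed by the moment estimate with trivial `U`, as high as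
the dimension permits. -/
lemma incidenceCount_pow_le (hQ : (polarBilin Q).Nondegenerate) {k : ℕ}
    (hk : Module.finrank F V = 2 * k + 2) {E G : Finset V} (hE : ∀ z ∈ E, Q z = 0 ∧ z ≠ 0)
    (hG : ∀ y ∈ G, Q y = 0) (hk1 : 1 ≤ k) :
    (incidenceCount (fun z y => polar Q z y = Q z) E G) ^ k ≤ G.card ^ (k - 1) *
      (2 * Fintype.card F ^ (k + 1) * E.card ^ k +
        2 * k * min (Fintype.card F ^ (2 * k) * E.card) (Fintype.card F ^ (2 * k + 1)) *
          E.card ^ (k - 1)) := by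
  have h0 : (0 : V) ∉ E := fun h => (hE 0 h).2 rfl
  have hmom := sum_orthogonalCount_pow_le hQ hk h0 k ⊥ (by simp)
  have hsub : G ⊆ zerosOrthogonal Q ⊥ := fun y hy =>
    mem_zerosOrthogonal.2 ⟨hG y hy, fun u hu => by
      rw [(Submodule.mem_bot F).1 hu]
      simp⟩
  have hcount (y : V) : hyperplaneCount Q E y = orthogonalCount Q E y := by
    classical
    unfold hyperplaneCount orthogonalCount
    congr 1
    exact Finset.filter_congr fun z hz => by rw [(hE z hz).1]
  rw [incidenceCount_eq_sum]
  simp_rw [hcount]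
  have hpow : (∑ y ∈ G, orthogonalCount Q E y) ^ k ≤
      G.card ^ (k - 1) * ∑ y ∈ G, orthogonalCount Q E y ^ k := by
    obtain ⟨n, rfl⟩ : ∃ n, k = n + 1 := ⟨k - 1, by omega⟩
    rw [Nat.add_sub_cancel]
    rcases Finset.eq_empty_or_nonempty G with rfl | hne
    · simp
    have h := pow_sum_div_card_le_sum_pow (s := G)
      (f := fun y => (orthogonalCount Q E y : ℝ)) (fun _ _ => Nat.cast_nonneg _) n
    rw [div_le_iff₀ (by
      have : (0 : ℝ) < G.card := by exact_mod_cast hne.card_pos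
      positivity)] at h
    have h' : ((∑ y ∈ G, orthogonalCount Q E y : ℕ) : ℝ) ^ (n + 1) ≤
        (G.card : ℝ) ^ n * ((∑ y ∈ G, orthogonalCount Q E y ^ (n + 1) : ℕ) : ℝ) := by
      push_cast
      linarith
    exact_mod_cast h'
  exact hpow.trans (Nat.mul_le_mul_left _ ((Finset.sum_le_sum_of_subset hsub).trans hmom))

/-- The alternatives record which of the two terms of the moment estimate dominates. In the second,
both entries of the minimum are available. -/
lemma log_incidenceCount_moment (hQ : (polarBilin Q).Nondegenerate) {k : ℕ}
    (hk : Module.finrank F V = 2 * k + 2) (hk1 : 1 ≤ k) {E G : Finset V}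
    (hE : ∀ z ∈ E, Q z = 0 ∧ z ≠ 0) (hG : ∀ y ∈ G, Q y = 0) {L e g i : ℝ}
    (hI : 0 < incidenceCount (fun z y => polar Q z y = Q z) E G)
    (hL : L = Real.log (Fintype.card F)) (he : e = Real.log E.card) (hg : g = Real.log G.card)
    (hi : i = Real.log (incidenceCount (fun z y => polar Q z y = Q z) E G)) :
    k * i ≤ (k - 1) * g + (k + 1) * L + k * e + Real.log (4 * k) ∨
      (k * i ≤ (k - 1) * g + 2 * k * L + k * e + Real.log (4 * k) ∧
        k * i ≤ (k - 1) * g + (2 * k + 1) * L + (k - 1) * e + Real.log (4 * k)) := by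
  obtain ⟨hE0, hG0⟩ := card_pos_of_incidenceCount_pos hI
  have hmain := incidenceCount_pow_le hQ hk hE hG hk1
  obtain ⟨hc4, -, -, -⟩ := one_le_log_slack_const hk1
  obtain ⟨n, rfl⟩ : ∃ n, k = n + 1 := ⟨k - 1, by omega⟩
  rw [Nat.add_sub_cancel] at hmain
  set I := incidenceCount (fun z y => polar Q z y = Q z) E G
  set q := Fintype.card F
  have hq0 : 0 < q := Fintype.card_pos
  have hq : (0 : ℝ) < q := by exact_mod_cast hq0
  have hE' : (0 : ℝ) < E.card := by exact_mod_cast hE0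
  have hG' : (0 : ℝ) < G.card := by exact_mod_cast hG0
  have hI' : (0 : ℝ) < (I : ℝ) ^ (n + 1) := by positivity
  have hlogI : Real.log ((I : ℝ) ^ (n + 1)) = ((n + 1 : ℕ) : ℝ) * i := by rw [Real.log_pow, hi]
  rcases le_total (2 * q ^ (n + 1 + 1) * E.card ^ (n + 1))
    (2 * (n + 1) * min (q ^ (2 * (n + 1)) * E.card) (q ^ (2 * (n + 1) + 1)) * E.card ^ n)
    with hle | hle
  · right
    have h1 : I ^ (n + 1) ≤ G.card ^ n * (4 * (n + 1) *
        min (q ^ (2 * (n + 1)) * E.card) (q ^ (2 * (n + 1) + 1)) * E.card ^ n) := by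
      refine hmain.trans (Nat.mul_le_mul_left _ ?_)
      linarith
    constructor
    · have h2 : I ^ (n + 1) ≤ G.card ^ n * (4 * (n + 1) *
          (q ^ (2 * (n + 1)) * E.card) * E.card ^ n) := by
        refine h1.trans ?_
        gcongr
        exact min_le_left _ _
      have h3 : (I : ℝ) ^ (n + 1) ≤ (G.card : ℝ) ^ n * (4 * ((n + 1 : ℕ) : ℝ) *
          ((q : ℝ) ^ (2 * (n + 1)) * E.card) * (E.card : ℝ) ^ n) := by exact_mod_cast h2
      have h4 := Real.log_le_log hI' h3
      rw [hlogI, Real.log_mul (by positivity) (by positivity), Real.log_mul (by positivity)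
        (by positivity), Real.log_mul (by positivity) (by positivity),
        Real.log_mul (pow_ne_zero _ hq.ne') hE'.ne', Real.log_pow, Real.log_pow, Real.log_pow,
        ← hg, ← he, ← hL] at h4
      push_cast at h4 ⊢
      linarith
    · have h2 : I ^ (n + 1) ≤ G.card ^ n * (4 * (n + 1) *
          q ^ (2 * (n + 1) + 1) * E.card ^ n) := by
        refine h1.trans ?_
        gcongr
        exact min_le_right _ _
      have h3 : (I : ℝ) ^ (n + 1) ≤ (G.card : ℝ) ^ n * (4 * ((n + 1 : ℕ) : ℝ) *
          (q : ℝ) ^ (2 * (n + 1) + 1) * (E.card : ℝ) ^ n) := by exact_mod_cast h2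
      have h4 := Real.log_le_log hI' h3
      rw [hlogI, Real.log_mul (by positivity) (by positivity), Real.log_mul (by positivity)
        (by positivity), Real.log_mul (by positivity) (by positivity), Real.log_pow, Real.log_pow,
        Real.log_pow, ← hg, ← he, ← hL] at h4
      push_cast at h4 ⊢
      linarith
  · left
    have h1 : I ^ (n + 1) ≤ G.card ^ n * (4 * q ^ (n + 1 + 1) * E.card ^ (n + 1)) := by
      refine hmain.trans (Nat.mul_le_mul_left _ ?_)
      linarith
    have h3 : (I : ℝ) ^ (n + 1) ≤ (G.card : ℝ) ^ n * (4 * (q : ℝ) ^ (n + 1 + 1) *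
        (E.card : ℝ) ^ (n + 1)) := by exact_mod_cast h1
    have h4 := Real.log_le_log hI' h3
    rw [hlogI, Real.log_mul (by positivity) (by positivity), Real.log_mul (by positivity)
      (by positivity), Real.log_mul (by norm_num) (by positivity), Real.log_pow, Real.log_pow,
      Real.log_pow, ← hg, ← he, ← hL] at h4
    push_cast at h4 hc4 ⊢
    linarith

/-- Incidences between nonzero singular points. -/
lemma singular_alternative (hQ : (polarBilin Q).Nondegenerate) {k : ℕ}
    (hk : Module.finrank F V = 2 * k + 2) (hk1 : 1 ≤ k) {E G : Finset V}
    (hE : ∀ z ∈ E, Q z = 0 ∧ z ≠ 0) (hG : ∀ y ∈ G, Q y = 0 ∧ y ≠ 0) {L e g i K : ℝ}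
    (hI : 0 < incidenceCount (fun z y => polar Q z y = Q z) E G)
    (hL : L = Real.log (Fintype.card F)) (he : e = Real.log E.card) (hg : g = Real.log G.card)
    (hi : i = Real.log (incidenceCount (fun z y => polar Q z y = Q z) E G))
    (hK : K = k * Real.log (4 * k)) :
    (g ≤ (2 * k + 1) * L + K ∧ -K ≤ logSlack k L e g i 0 0 ∧
      -K ≤ logSlack k L e g i (k * (2 * k - 1) / (2 * k ^ 2 - 1)) (k / (2 * k ^ 2 - 1)) ∧
      -K ≤ logSlack k L e g i ((2 * k - 1) / (2 * k)) ((k - 1) / (2 * k ^ 2))) ∨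
    (incidenceCount (fun z y => polar Q z y = Q z) E G : ℝ) ≤
      2 / Fintype.card F * (E.card * G.card) := by
  obtain ⟨hE0, hG0⟩ := card_pos_of_incidenceCount_pos hI
  obtain ⟨hc4, hc2, hc0, hck⟩ := one_le_log_slack_const hk1
  have hk1' : (1 : ℝ) ≤ k := by exact_mod_cast hk1
  have hq : (0 : ℝ) < Fintype.card F := by exact_mod_cast Fintype.card_pos
  have hL0 : 0 ≤ L := by
    rw [hL]
    exact Real.log_nonneg (by exact_mod_cast Fintype.card_pos)
  have hsq := incidenceCount_sub_sq_le_of_zero_notMem hQ (fun h => (hE 0 h).2 rfl) G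
  rcases le_or_log_le_of_sub_sq_le (by exact_mod_cast hI) (by exact_mod_cast hE0)
    (by exact_mod_cast hG0) (by positivity) hsq with hmean | h₃
  · exact Or.inr hmean
  left
  rw [Real.log_pow, hk, ← hi, ← hL, ← he, ← hg] at h₃
  push_cast at h₃
  have h₁ := log_incidenceCount_le hI
  rw [← hi, ← he, ← hg] at h₁
  have h₂ := log_incidenceCount_le_of_forall (n := 2 * k) hI fun y hy =>
    hyperplaneCount_le_of_singular hQ hk1 hk (fun z hz => (hE z hz).1) (hG y hy).2
  rw [← hi, ← hL, ← hg] at h₂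
  push_cast at h₂
  have hg' := log_card_zeros_le hQ hk (fun y hy => (hG y hy).1) hG0
  rw [← hg, ← hL] at hg'
  have hm := log_incidenceCount_moment hQ hk hk1 hE (fun y hy => (hG y hy).1) hI hL he hg hi
  -- Between singular vectors the incidence relation is symmetric, so the moment bound also holds
  -- with `E` and `G` exchanged.
  have hcomm := incidenceCount_comm_of_singular (fun z hz => (hE z hz).1) (fun y hy => (hG y hy).1)
  have hm' := log_incidenceCount_moment hQ hk hk1 hG (fun y hy => (hE y hy).1) (i := i)
    (by rwa [← hcomm]) hL hg he (by rw [hi, hcomm])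
  rw [hK]
  refine ⟨by linarith, ?_, logSlack_upper_vertex hk1' hc0 h₁ (by linarith) hm,
    logSlack_lower_vertex hk1' hc0 h₁ (by linarith) (by linarith) ?_⟩
  · rw [logSlack]
    have := mul_nonneg (by linarith : (0 : ℝ) ≤ 2 * k + 1) hL0
    linarith
  · rcases hm' with hm' | hm'
    · exact Or.inl hm'
    · exact Or.inr hm'.2

/-- Incidences between nonsingular vectors and singular points. -/
lemma nonsingular_alternative (hQ : (polarBilin Q).Nondegenerate) {k : ℕ}
    (hk : Module.finrank F V = 2 * k + 2) (hk1 : 1 ≤ k) {E G : Finset V}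
    (hE : ∀ z ∈ E, Q z ≠ 0) (hG : ∀ y ∈ G, Q y = 0) {L e g i K : ℝ}
    (hI : 0 < incidenceCount (fun z y => polar Q z y = Q z) E G)
    (hL : L = Real.log (Fintype.card F)) (he : e = Real.log E.card) (hg : g = Real.log G.card)
    (hi : i = Real.log (incidenceCount (fun z y => polar Q z y = Q z) E G))
    (hK : K = k * Real.log (4 * k)) :
    (g ≤ (2 * k + 1) * L + K ∧ -K ≤ logSlack k L e g i 0 0 ∧ -L ≤ logSlack k L e g i 1 0 ∧
      k * L - K ≤ logSlack k L e g i (1 / 2) (1 / 2)) ∨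
    (incidenceCount (fun z y => polar Q z y = Q z) E G : ℝ) ≤
      2 / Fintype.card F * (E.card * G.card) := by
  obtain ⟨hE0, hG0⟩ := card_pos_of_incidenceCount_pos hI
  obtain ⟨hc4, hc2, hc0, hck⟩ := one_le_log_slack_const hk1
  have hq : (0 : ℝ) < Fintype.card F := by exact_mod_cast Fintype.card_pos
  have hsq := incidenceCount_sub_sq_le_of_ne_zero hQ hE G
  rw [hk, ← le_div_iff₀ hq, show (Fintype.card F : ℝ) ^ (2 * k + 2) * E.card * G.card /
    Fintype.card F = (Fintype.card F : ℝ) ^ (2 * k + 1) * E.card * G.card by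
      field_simp
      ring] at hsq
  rcases le_or_log_le_of_sub_sq_le (by exact_mod_cast hI) (by exact_mod_cast hE0)
    (by exact_mod_cast hG0) (by positivity) hsq with hmean | h₃
  · exact Or.inr hmean
  left
  rw [Real.log_pow, ← hi, ← hL, ← he, ← hg] at h₃
  push_cast at h₃
  have h₁ := log_incidenceCount_le hI
  rw [← hi, ← he, ← hg] at h₁
  have h₂ := log_incidenceCount_le_of_forall (n := 2 * k + 1) hI fun y hy =>
    hyperplaneCount_le hQ hk (hG y hy)
  rw [← hi, ← hL, ← hg] at h₂
  push_cast at h₂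
  have hg' := log_card_zeros_le hQ hk hG hG0
  rw [← hg, ← hL] at hg'
  rw [hK]
  simp only [logSlack]
  exact ⟨by linarith, by linarith, by linarith, by linarith⟩

end LogBounds

/-! ### From set bounds to the bilinear estimate -/

section StrongBound

open QuadraticMap

/-- The exponent pairs `(1/p, 1/r)` with `r > p` for which averages over a cone in dimension
`2 * k + 2` are bounded. -/
structure AdmissibleExponents (k x y : ℝ) : Prop where
  pos : 0 < x
  lt : y < x
  le_right : x ≤ (2 * k + 1) / (2 * k + 2)
  le_mul : x ≤ (2 * k + 1) * y
  le_line : (k + 1) * x ≤ k * (1 + y)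

lemma AdmissibleExponents.lt_one {k x y : ℝ} (hk : 1 ≤ k) (h : AdmissibleExponents k x y) :
    x < 1 := by
  refine h.le_right.trans_lt ?_
  rw [div_lt_one (by linarith)]
  linarith

lemma AdmissibleExponents.snd_pos {k x y : ℝ} (hk : 1 ≤ k) (h : AdmissibleExponents k x y) :
    0 < y := by
  by_contra! hy
  have := mul_nonneg (by linarith : (0 : ℝ) ≤ 2 * k + 1) (neg_nonneg.2 hy)
  linarith [h.pos, h.le_mul]

lemma sum_le_card_rpow {Z : Type*} (s : Finset Z) {x : ℝ} (hx0 : 0 < x) (hx1 : x < 1) {f : Z → ℝ}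
    (hf : ∀ z, 0 ≤ f z) (hsum : ∑ z ∈ s, f z ^ (1 / x) ≤ 1) :
    ∑ z ∈ s, f z ≤ (s.card : ℝ) ^ (1 - x) := by
  have h := Real.inner_le_Lp_mul_Lq_of_nonneg s
    (Real.holderConjugate_one_div hx0 (sub_pos.2 hx1) (by ring)) (fun z _ => hf z)
    (g := fun _ => 1) (fun _ _ => zero_le_one)
  simp only [mul_one, Real.one_rpow, Finset.sum_const, nsmul_eq_mul, one_div_one_div] at h
  have h1 : (∑ z ∈ s, f z ^ (1 / x)) ^ x ≤ 1 :=
    Real.rpow_le_one (Finset.sum_nonneg fun z _ => Real.rpow_nonneg (hf z) _) hsum hx0.le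
  exact h.trans (mul_le_of_le_one_left (Real.rpow_nonneg (Nat.cast_nonneg _) _) h1)

lemma natCast_pow_rpow_eq_exp {q : ℕ} (hq : 0 < q) (n : ℕ) (s : ℝ) :
    ((q : ℝ) ^ n) ^ s = Real.exp (n * s * Real.log q) := by
  have hq' : (0 : ℝ) < q := by exact_mod_cast hq
  rw [← Real.rpow_natCast, ← Real.rpow_mul hq'.le, Real.rpow_def_of_pos hq', mul_comm]

variable {F V : Type} [Field F] [Fintype F] [AddCommGroup V] [Module F V] [Fintype V]
  {Q : QuadraticForm F V}

lemma sum_le_exp_of_finrank {n : ℕ} (hn : Module.finrank F V = n) {x : ℝ} (hx0 : 0 < x)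
    (hx1 : x < 1) {f : V → ℝ} (hf : ∀ z, 0 ≤ f z) (hsum : ∑ z, f z ^ (1 / x) ≤ 1) :
    ∑ z, f z ≤ Real.exp (n * (1 - x) * Real.log (Fintype.card F)) := by
  refine (sum_le_card_rpow _ hx0 hx1 hf hsum).trans (le_of_eq ?_)
  rw [Finset.card_univ, Module.card_eq_pow_finrank (K := F), hn, ← natCast_pow_rpow_eq_exp
    Fintype.card_pos]
  push_cast
  rfl

lemma sum_le_exp_of_zeros (hQ : (polarBilin Q).Nondegenerate) {k : ℕ}
    (hk : Module.finrank F V = 2 * k + 2) {x : ℝ} (hx0 : 0 < x) (hx1 : x < 1) {f : V → ℝ}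
    (hf : ∀ z, 0 ≤ f z) (hfQ : ∀ z, f z ≠ 0 → Q z = 0) (hsum : ∑ z, f z ^ (1 / x) ≤ 1) :
    ∑ z, f z ≤ 2 * Real.exp ((2 * k + 1) * (1 - x) * Real.log (Fintype.card F)) := by
  classical
  set S : Finset V := Finset.univ.filter fun z => Q z = 0 with hS
  have h1 : ∑ z, f z = ∑ z ∈ S, f z :=
    (Finset.sum_subset (Finset.subset_univ S) fun z _ hz => by
      by_contra h
      exact hz (by simp [hS, hfQ z h])).symm
  have h2 : ∑ z ∈ S, f z ^ (1 / x) ≤ 1 :=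
    (Finset.sum_le_sum_of_subset_of_nonneg (Finset.subset_univ S) fun z _ _ =>
      Real.rpow_nonneg (hf z) _).trans hsum
  have h3 := card_zeros_le hQ hk (G := S) fun z hz => (Finset.mem_filter.1 hz).2
  rw [h1]
  calc ∑ z ∈ S, f z ≤ (S.card : ℝ) ^ (1 - x) := sum_le_card_rpow S hx0 hx1 hf h2
    _ ≤ (2 * (Fintype.card F : ℝ) ^ (2 * k + 1)) ^ (1 - x) :=
        Real.rpow_le_rpow (Nat.cast_nonneg _) h3 (by linarith)
    _ = 2 ^ (1 - x) * Real.exp ((2 * k + 1) * (1 - x) * Real.log (Fintype.card F)) := by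
        rw [Real.mul_rpow (by norm_num) (by positivity), natCast_pow_rpow_eq_exp Fintype.card_pos]
        push_cast
        rfl
    _ ≤ 2 ^ (1 : ℝ) * Real.exp ((2 * k + 1) * (1 - x) * Real.log (Fintype.card F)) := by
        gcongr
        · norm_num
        · linarith
    _ = _ := by rw [Real.rpow_one]

/-- The exponent of `q` in the strong bound at `(x, y)`. -/
noncomputable def boundExponent (k x y : ℝ) : ℝ := (2 * k + 1) * (1 + y) - (2 * k + 2) * x

/-- The set bounds along a segment through `(x, y)` may lose a power of `q` linear in `ε`: equal
steps in opposite directions lose opposite powers, which the interpolation tolerates. -/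
lemma exists_incidenceForm_le_of_alternative {k : ℕ} (hk1 : 1 ≤ k) {x y : ℝ}
    (hxy : AdmissibleExponents k x y) {v w : ℝ} (c K : ℝ) (hv : v ≠ 0) (hw : w ≠ 0) :
    ∃ C : ℝ, ∀ (F V : Type) [Field F] [Fintype F] [AddCommGroup V] [Module F V] [Fintype V]
      (Q : QuadraticForm F V), (polarBilin Q).Nondegenerate → Module.finrank F V = 2 * k + 2 →
      ∀ A B : V → Prop, (∀ y, B y → Q y = 0) →
      (∀ ε : ℝ, |ε| ≤ 1 → ∀ E G : Finset V, (∀ z ∈ E, A z) → (∀ y ∈ G, B y) →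
        0 < incidenceCount (fun z y => polar Q z y = Q z) E G →
        -K - ε * c * Real.log (Fintype.card F) ≤
            logSlack k (Real.log (Fintype.card F)) (Real.log E.card) (Real.log G.card)
              (Real.log (incidenceCount (fun z y => polar Q z y = Q z) E G))
              (x + ε * v) (y + ε * w) ∨
          (incidenceCount (fun z y => polar Q z y = Q z) E G : ℝ) ≤
            2 / Fintype.card F * (E.card * G.card)) →
      ∀ f g : V → ℝ, (∀ z, 0 ≤ f z) → (∀ y, 0 ≤ g y) → (∀ z, f z ≠ 0 → A z) →
        (∀ y, g y ≠ 0 → B y) → ∑ z, f z ^ (1 / x) ≤ 1 → ∑ z, g z ^ (1 / (1 - y)) ≤ 1 →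
        incidenceForm (fun z y => polar Q z y = Q z) f g ≤
          C * Real.exp (boundExponent k x y * Real.log (Fintype.card F)) := by
  have hk1' : (1 : ℝ) ≤ k := by exact_mod_cast hk1
  have hx1 := hxy.lt_one hk1'
  have hy0 := hxy.snd_pos hk1'
  have hlt := hxy.lt
  have hvw : 0 < |v| + |w| := add_pos (abs_pos.2 hv) (abs_pos.2 hw)
  -- The step is short enough for the room required by interpolation, which is `a + b - 1 = x - y`
  -- with `a = x` and `b = 1 - y`.
  set ε := min 1 ((x - y) / (|v| + |w|)) with hε
  have hε0 : 0 < ε := lt_min one_pos (div_pos (by linarith) hvw)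
  have hε1 : |ε| ≤ 1 := by
    rw [abs_of_pos hε0]
    exact min_le_left _ _
  have hεvw : ε * |v| + ε * |w| ≤ x - y := by
    rw [← mul_add, ← le_div_iff₀ hvw]
    exact min_le_right _ _
  have hεv : 0 ≤ ε * |v| := by positivity
  have hεw : 0 ≤ ε * |w| := by positivity
  have hα : |-(ε * v)| = ε * |v| := by rw [abs_neg, abs_mul, abs_of_pos hε0]
  have hβ : |ε * w| = ε * |w| := by rw [abs_mul, abs_of_pos hε0]
  obtain ⟨C, hC0, hC⟩ := exists_incidenceForm_le (a := x) (b := 1 - y) (α := -(ε * v))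
    (β := ε * w) (neg_ne_zero.2 (mul_ne_zero hε0.ne' hv)) (mul_ne_zero hε0.ne' hw)
    (by rw [hα]; linarith) (by rw [hβ]; linarith) (by rw [hα, hβ]; linarith)
  refine ⟨C * Real.exp K + 4 * Real.exp 2, fun F V _ _ _ _ _ Q hQ hfr A B hB halt f g hf hg hfA
    hgB hf1 hg1 => ?_⟩
  set L := Real.log (Fintype.card F) with hL
  have hq : (0 : ℝ) < Fintype.card F := by exact_mod_cast Fintype.card_pos
  have hform := hC (fun z y => polar Q z y = Q z) A B (K + boundExponent k x y * L)
    (ε * ((2 * k + 1) * w - (2 * k + 2) * v) * L + ε * c * L) (2 / Fintype.card F)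
    (by positivity) (fun E G hE hG hI => by
      rcases halt ε hε1 E G hE hG hI with h1 | h1
      · rcases halt (-ε) (by rwa [abs_neg]) E G hE hG hI with h2 | h2
        · left
          rw [logSlack] at h1 h2
          rw [boundExponent]
          constructor <;> linarith
        · exact Or.inr h2
      · exact Or.inr h1) f g hf hg hfA hgB hf1 hg1
  have hsumf := sum_le_exp_of_finrank hfr hxy.pos hx1 hf hf1
  have hsumg := sum_le_exp_of_zeros hQ hfr (by linarith : 0 < 1 - y) (by linarith) hg
    (fun z hz => hB z (hgB z hz)) hg1
  rw [← hL] at hsumf hsumg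
  -- By Hölder, the expected value costs exactly the exponent `boundExponent`, for every pair `(x,
  -- y)`.
  have hmean : Real.exp 2 * (2 / Fintype.card F) * ((∑ z, f z) * ∑ z, g z) ≤
      4 * Real.exp 2 * Real.exp (boundExponent k x y * L) := by
    have hqL : (2 / Fintype.card F : ℝ) = 2 * Real.exp (-L) := by
      rw [Real.exp_neg, hL, Real.exp_log hq]
      ring
    calc _ ≤ Real.exp 2 * (2 / Fintype.card F) *
          (Real.exp (((2 * k + 2 : ℕ) : ℝ) * (1 - x) * L) *
            (2 * Real.exp ((2 * k + 1) * (1 - (1 - y)) * L))) := by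
          gcongr
          exact Finset.sum_nonneg fun z _ => hg z
      _ = 4 * Real.exp 2 * (Real.exp (-L) * (Real.exp (((2 * k + 2 : ℕ) : ℝ) * (1 - x) * L) *
            Real.exp ((2 * k + 1) * (1 - (1 - y)) * L))) := by
          rw [hqL]
          ring
      _ = _ := by
          rw [← Real.exp_add, ← Real.exp_add, boundExponent]
          congr 2
          push_cast
          ring
  calc _ ≤ _ := hform
    _ ≤ C * Real.exp (K + boundExponent k x y * L) +
          4 * Real.exp 2 * Real.exp (boundExponent k x y * L) := by gcongr
    _ = _ := by
        rw [Real.exp_add]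
        ring

lemma incidenceForm_add_left {Z Y : Type*} [Fintype Z] [Fintype Y] (R : Z → Y → Prop)
    (f₁ f₂ : Z → ℝ) (g : Y → ℝ) :
    incidenceForm R (f₁ + f₂) g = incidenceForm R f₁ g + incidenceForm R f₂ g := by
  simp only [incidenceForm, ← Finset.sum_add_distrib]
  refine Finset.sum_congr rfl fun p _ => ?_
  split_ifs <;> simp [add_mul]

lemma incidenceForm_add_right {Z Y : Type*} [Fintype Z] [Fintype Y] (R : Z → Y → Prop)
    (f : Z → ℝ) (g₁ g₂ : Y → ℝ) :
    incidenceForm R f (g₁ + g₂) = incidenceForm R f g₁ + incidenceForm R f g₂ := by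
  simp only [incidenceForm, ← Finset.sum_add_distrib]
  refine Finset.sum_congr rfl fun p _ => ?_
  split_ifs <;> simp [mul_add]

lemma incidenceForm_le_sum_mul_sum {Z Y : Type*} [Fintype Z] [Fintype Y] (R : Z → Y → Prop)
    {f : Z → ℝ} {g : Y → ℝ} (hf : ∀ z, 0 ≤ f z) (hg : ∀ y, 0 ≤ g y) :
    incidenceForm R f g ≤ (∑ z, f z) * ∑ y, g y := by
  rw [Finset.sum_mul_sum, ← Finset.sum_product', Finset.univ_product_univ, incidenceForm]
  refine Finset.sum_le_sum fun p _ => ?_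
  split_ifs
  · exact le_rfl
  · exact mul_nonneg (hf _) (hg _)

lemma sum_le_one_of_support_subsingleton {Z : Type*} [Fintype Z] {x : ℝ} (hx : 0 < x) {f : Z → ℝ}
    (hf : ∀ z, 0 ≤ f z) (z₀ : Z) (hsupp : ∀ z, f z ≠ 0 → z = z₀)
    (hsum : ∑ z, f z ^ (1 / x) ≤ 1) : ∑ z, f z ≤ 1 := by
  rw [Finset.sum_eq_single z₀ (fun z _ hz => by_contra fun h => hz (hsupp z h)) (by simp)]
  have h : f z₀ ^ (1 / x) ≤ 1 := (Finset.single_le_sum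
    (fun z _ => Real.rpow_nonneg (hf z) (1 / x)) (Finset.mem_univ z₀)).trans hsum
  by_contra! h1
  exact absurd h (not_le.2 (Real.one_lt_rpow h1 (by positivity)))

lemma sum_indicator_rpow_le_one {Z : Type*} [Fintype Z] {s : ℝ} (hs : 0 < s) {f : Z → ℝ}
    (hf : ∀ z, 0 ≤ f z) (hsum : ∑ z, f z ^ s ≤ 1) (A : Set Z) :
    ∑ z, A.indicator f z ^ s ≤ 1 := by
  refine (Finset.sum_le_sum fun z _ => ?_).trans hsum
  exact Real.rpow_le_rpow (Set.indicator_nonneg (fun z _ => hf z) z)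
    (Set.indicator_le_self' (fun z _ => hf z) z) hs.le

/-- The strong bound for the form of incidences with a quadric, uniformly in the field. -/
theorem exists_incidenceForm_quadric_le {k : ℕ} (hk1 : 1 ≤ k) {x y : ℝ}
    (hxy : AdmissibleExponents k x y) :
    ∃ C : ℝ, 0 ≤ C ∧ ∀ (F V : Type) [Field F] [Fintype F] [AddCommGroup V] [Module F V]
      [Fintype V] (Q : QuadraticForm F V), (polarBilin Q).Nondegenerate →
      Module.finrank F V = 2 * k + 2 →
      ∀ f g : V → ℝ, (∀ z, 0 ≤ f z) → (∀ y, 0 ≤ g y) → (∀ y, g y ≠ 0 → Q y = 0) →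
        ∑ z, f z ^ (1 / x) ≤ 1 → ∑ z, g z ^ (1 / (1 - y)) ≤ 1 →
        incidenceForm (fun z y => polar Q z y = Q z) f g ≤
          C * Real.exp (boundExponent k x y * Real.log (Fintype.card F)) := by
  have hk1' : (1 : ℝ) ≤ k := by exact_mod_cast hk1
  have hx1 := hxy.lt_one hk1'
  have hx0 := hxy.pos
  have hy0 := hxy.snd_pos hk1'
  have hlt := hxy.lt
  obtain ⟨-, -, hc0, -⟩ := one_le_log_slack_const hk1
  set K := k * Real.log (4 * k) with hK
  have hK0 : 0 ≤ K := by positivity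
  obtain ⟨v, w, hv, hw, hdir⟩ := exists_direction_of_vertices hk1' hx0 (by linarith) hxy.le_right
    hxy.le_mul hxy.le_line
  obtain ⟨v', w', c', hv', hw', hdir'⟩ := exists_direction_of_l2 hk1' hx0 (by linarith)
    hxy.le_right hxy.le_mul
  obtain ⟨C₁, hC₁⟩ := exists_incidenceForm_le_of_alternative hk1 hxy 0 (2 * K) hv hw
  obtain ⟨C₂, hC₂⟩ := exists_incidenceForm_le_of_alternative hk1 hxy c' (2 * K) hv' hw'
  refine ⟨|C₁| + |C₂| + 4, by positivity, fun F V _ _ _ _ _ Q hQ hfr f g hf hg hgQ hf1 hg1 => ?_⟩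
  set L := Real.log (Fintype.card F) with hL
  have hL0 : 0 ≤ L := Real.log_nonneg (by exact_mod_cast Fintype.card_pos)
  -- The origin is incident to all singular points and would spoil the bounds at the two outer
  -- vertices, so it is separated on both sides.
  set f₀ : V → ℝ := ({0} : Set V).indicator f with hf₀
  set f₁ : V → ℝ := {z | Q z = 0 ∧ z ≠ 0}.indicator f with hf₁
  set f₂ : V → ℝ := {z | Q z ≠ 0}.indicator f with hf₂
  set g₀ : V → ℝ := ({0} : Set V).indicator g with hg₀
  set g₁ : V → ℝ := {y | Q y = 0 ∧ y ≠ 0}.indicator g with hg₁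
  have hfsplit : f = f₀ + (f₁ + f₂) := by
    ext z
    by_cases h0 : z = 0
    · simp [hf₀, hf₁, hf₂, h0]
    · by_cases hz : Q z = 0 <;> simp [hf₀, hf₁, hf₂, h0, hz]
  have hgsplit : g = g₀ + g₁ := by
    ext z
    by_cases h0 : z = 0
    · simp [hg₀, hg₁, h0]
    · by_cases hz : Q z = 0
      · simp [hg₀, hg₁, h0, hz]
      · have : g z = 0 := by_contra fun h => hz (hgQ z h)
        simp [hg₀, hg₁, h0, hz, this]
  have hf₀0 (z) : 0 ≤ f₀ z := Set.indicator_nonneg (fun z _ => hf z) z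
  have hf₁0 (z) : 0 ≤ f₁ z := Set.indicator_nonneg (fun z _ => hf z) z
  have hf₂0 (z) : 0 ≤ f₂ z := Set.indicator_nonneg (fun z _ => hf z) z
  have hg₀0 (z) : 0 ≤ g₀ z := Set.indicator_nonneg (fun z _ => hg z) z
  have hg₁0 (z) : 0 ≤ g₁ z := Set.indicator_nonneg (fun z _ => hg z) z
  have hmem (A : Set V) (h : V → ℝ) (z : V) (hz : A.indicator h z ≠ 0) : z ∈ A :=
    Set.mem_of_indicator_ne_zero hz
  have hxi : 0 < 1 / x := by positivity
  have hyi : 0 < 1 / (1 - y) := one_div_pos.2 (by linarith)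
  have hf₀s := sum_indicator_rpow_le_one hxi hf hf1 {0}
  have hf₁s := sum_indicator_rpow_le_one hxi hf hf1 {z | Q z = 0 ∧ z ≠ 0}
  have hf₂s := sum_indicator_rpow_le_one hxi hf hf1 {z | Q z ≠ 0}
  have hg₀s := sum_indicator_rpow_le_one hyi hg hg1 {0}
  have hg₁s := sum_indicator_rpow_le_one hyi hg hg1 {y | Q y = 0 ∧ y ≠ 0}
  set R : V → V → Prop := fun z y => polar Q z y = Q z with hR
  set N := Real.exp (boundExponent k x y * L) with hN
  have hN0 : 0 < N := Real.exp_pos _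
  have hright : (2 * (k : ℝ) + 2) * x ≤ 2 * k + 1 := by
    have := hxy.le_right
    rw [le_div_iff₀ (by positivity)] at this
    linarith
  -- The trivial bound suffices exactly when `(2k + 2) x ≤ 2k + 1`.
  have b0 : incidenceForm R f₀ g ≤ 2 * N := by
    have h1 := sum_le_one_of_support_subsingleton hx0 hf₀0 0 (hmem {0} f) hf₀s
    have h2 := sum_le_exp_of_zeros hQ hfr (by linarith : 0 < 1 - y) (by linarith) hg hgQ hg1
    refine (incidenceForm_le_sum_mul_sum R hf₀0 hg).trans ?_
    calc (∑ z, f₀ z) * ∑ z, g z ≤ 1 * (2 * Real.exp ((2 * k + 1) * (1 - (1 - y)) * L)) :=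
          mul_le_mul h1 h2 (Finset.sum_nonneg fun z _ => hg z) zero_le_one
      _ ≤ 2 * N := by
          rw [one_mul, hN, boundExponent]
          gcongr
          linarith
  -- The trivial bound suffices exactly when `x ≤ (2k + 1) y`.
  have b1 : incidenceForm R f₁ g₀ ≤ 2 * N := by
    have h1 := sum_le_one_of_support_subsingleton (by linarith : 0 < 1 - y) hg₀0 0
      (hmem {0} g) hg₀s
    have h2 := sum_le_exp_of_zeros hQ hfr hx0 hx1 hf₁0
      (fun z hz => (hmem {z | Q z = 0 ∧ z ≠ 0} f z hz).1) hf₁s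
    refine (incidenceForm_le_sum_mul_sum R hf₁0 hg₀0).trans ?_
    calc (∑ z, f₁ z) * ∑ z, g₀ z ≤ 2 * Real.exp ((2 * k + 1) * (1 - x) * L) * 1 :=
          mul_le_mul h2 h1 (Finset.sum_nonneg fun z _ => hg₀0 z) (by positivity)
      _ ≤ 2 * N := by
          rw [mul_one, hN, boundExponent]
          gcongr
          linarith [hxy.le_mul]
  have b2 : incidenceForm R f₁ g₁ ≤ C₁ * N := by
    refine hC₁ F V Q hQ hfr (fun z => Q z = 0 ∧ z ≠ 0) (fun z => Q z = 0 ∧ z ≠ 0)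
      (fun y hy => hy.1) (fun ε hε E G hE hG hI => ?_) f₁ g₁ hf₁0 hg₁0
      (hmem {z | Q z = 0 ∧ z ≠ 0} f) (hmem {z | Q z = 0 ∧ z ≠ 0} g) hf₁s hg₁s
    rcases singular_alternative hQ hfr hk1 hE hG hI rfl rfl rfl rfl rfl with ⟨h1, h2, h3, h4⟩ | h
    · left
      have := hdir ε hε _ _ _ _ K hK0 h1 h2 h3 h4
      simpa using this
    · exact Or.inr h
  have b3 : incidenceForm R f₂ g ≤ C₂ * N := by
    refine hC₂ F V Q hQ hfr (fun z => Q z ≠ 0) (fun z => Q z = 0)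
      (fun y hy => hy) (fun ε hε E G hE hG hI => ?_) f₂ g hf₂0 hg
      (hmem {z | Q z ≠ 0} f) hgQ hf₂s hg1
    rcases nonsingular_alternative hQ hfr hk1 hE hG hI rfl rfl rfl rfl rfl with
      ⟨h1, h2, h3, h4⟩ | h
    · exact Or.inl (hdir' ε hε _ _ _ _ K hK0 h1 h2 h3 h4)
    · exact Or.inr h
  have hsplit : incidenceForm R f g = incidenceForm R f₀ g +
      ((incidenceForm R f₁ g₀ + incidenceForm R f₁ g₁) + incidenceForm R f₂ g) := by
    conv_lhs => rw [hfsplit]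
    rw [incidenceForm_add_left, incidenceForm_add_left, ← incidenceForm_add_right, ← hgsplit]
  have e1 := mul_le_mul_of_nonneg_right (le_abs_self C₁) hN0.le
  have e2 := mul_le_mul_of_nonneg_right (le_abs_self C₂) hN0.le
  rw [hsplit]
  linarith

end StrongBound

/-! ### Duality, and norms for normalized counting measure -/

section Norms

open QuadraticMap

open Classical in
lemma sum_mul_sum_eq_incidenceForm {Z Y : Type*} [Fintype Z] [Fintype Y] (R : Z → Y → Prop)
    (f : Z → ℝ) (g : Y → ℝ) :
    ∑ y, (∑ z with R z y, f z) * g y = incidenceForm R f g := by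
  rw [incidenceForm, Fintype.sum_prod_type_right]
  refine Finset.sum_congr rfl fun y _ => ?_
  rw [Finset.sum_mul, Finset.sum_filter]

open Classical in
/-- The `ℓ^p → ℓ^r` bound for the incidences of points of a quadric. -/
theorem exists_sum_rpow_quadric_le {k : ℕ} (hk1 : 1 ≤ k) {x y : ℝ}
    (hxy : AdmissibleExponents k x y) :
    ∃ C : ℝ, 0 ≤ C ∧ ∀ (F V : Type) [Field F] [Fintype F] [AddCommGroup V] [Module F V]
      [Fintype V] (Q : QuadraticForm F V), (polarBilin Q).Nondegenerate →
      Module.finrank F V = 2 * k + 2 →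
      ∀ (f : V → ℝ) (S : Finset V), (∀ z, 0 ≤ f z) → (∀ w ∈ S, Q w = 0) →
        (∑ w ∈ S, (∑ z with polar Q z w = Q z, f z) ^ (1 / y)) ^ y ≤
          C * Real.exp (boundExponent k x y * Real.log (Fintype.card F)) *
            (∑ z, f z ^ (1 / x)) ^ x := by
  obtain ⟨C, hC0, hC⟩ := exists_incidenceForm_quadric_le hk1 hxy
  have hk1' : (1 : ℝ) ≤ k := by exact_mod_cast hk1
  have hx1 := hxy.lt_one hk1'
  have hx0 := hxy.pos
  have hy0 := hxy.snd_pos hk1'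
  have hlt := hxy.lt
  have hxi : 0 < 1 / x := by positivity
  have hyi : 0 < 1 / y := by positivity
  refine ⟨C, hC0, fun F V _ _ _ _ _ Q hQ hfr f S hf hS => ?_⟩
  set N := C * Real.exp (boundExponent k x y * Real.log (Fintype.card F)) with hN
  have hN0 : 0 ≤ N := by positivity
  set T := ∑ z, f z ^ (1 / x) with hT
  have hT0 : 0 ≤ T := Finset.sum_nonneg fun z _ => Real.rpow_nonneg (hf z) _
  have hM (w : V) : 0 ≤ ∑ z with polar Q z w = Q z, f z := Finset.sum_nonneg fun z _ => hf z
  rcases hT0.eq_or_lt with hT00 | hTpos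
  · have hf0 (z : V) : f z = 0 := by
      have h := (Finset.sum_eq_zero_iff_of_nonneg fun z _ => Real.rpow_nonneg (hf z) _).1
        hT00.symm z (Finset.mem_univ z)
      exact ((Real.rpow_eq_zero (hf z) hxi.ne').1 h)
    have h0 : ∑ w ∈ S, (∑ z with polar Q z w = Q z, f z) ^ (1 / y) = 0 :=
      Finset.sum_eq_zero fun w _ => by
        rw [Finset.sum_eq_zero fun z _ => hf0 z, Real.zero_rpow hyi.ne']
    rw [h0, Real.zero_rpow hy0.ne']
    positivity
  -- The extremal function of Hölder's inequality turns the form estimate into the norm estimate.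
  obtain ⟨⟨g, hg1, hg2⟩, -⟩ := NNReal.isGreatest_Lp S
    (fun w => ⟨∑ z with polar Q z w = Q z, f z, hM w⟩)
    (Real.holderConjugate_one_div hy0 (sub_pos.2 (hlt.trans hx1)) (by ring))
  have hg2' : ∑ w ∈ S, (∑ z with polar Q z w = Q z, f z) * (g w : ℝ) =
      (∑ w ∈ S, (∑ z with polar Q z w = Q z, f z) ^ (1 / y)) ^ y := by
    have := congrArg ((↑) : ℝ≥0 → ℝ) hg2
    simp only [one_div_one_div] at this
    push_cast at this
    exact this
  rw [← hg2']
  set g' : V → ℝ := fun w => if w ∈ S then (g w : ℝ) else 0 with hg'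
  have hyi' : 0 < 1 / (1 - y) := one_div_pos.2 (by linarith)
  have hg'1 : ∑ w, g' w ^ (1 / (1 - y)) ≤ 1 := by
    have h1 : ∑ w, g' w ^ (1 / (1 - y)) = ∑ w ∈ S, (g w : ℝ) ^ (1 / (1 - y)) := by
      rw [← Finset.sum_subset (Finset.subset_univ S) fun w _ hw => by
        simp only [hg', if_neg hw]
        exact Real.zero_rpow hyi'.ne']
      exact Finset.sum_congr rfl fun w hw => by simp only [hg', if_pos hw]
    rw [h1]
    exact_mod_cast hg1
  have hTx : 0 < T ^ x := Real.rpow_pos_of_pos hTpos x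
  have hfT : ∑ z, (f z / T ^ x) ^ (1 / x) ≤ 1 := by
    have (z : V) : (f z / T ^ x) ^ (1 / x) = f z ^ (1 / x) / T := by
      rw [Real.div_rpow (hf z) hTx.le, ← Real.rpow_mul hT0, mul_one_div_cancel hx0.ne',
        Real.rpow_one]
    simp_rw [this]
    rw [← Finset.sum_div, div_self hTpos.ne']
  have key := hC F V Q hQ hfr (fun z => f z / T ^ x) g' (fun z => div_nonneg (hf z) hTx.le)
    (fun w => by
      simp only [hg']
      split_ifs
      · exact (g w).2
      · exact le_rfl)
    (fun w hw => hS w (by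
      by_contra h
      exact hw (if_neg h))) hfT hg'1
  rw [← sum_mul_sum_eq_incidenceForm] at key
  have hlhs : ∑ w, (∑ z with polar Q z w = Q z, f z / T ^ x) * g' w =
      (∑ w ∈ S, (∑ z with polar Q z w = Q z, f z) * (g w : ℝ)) / T ^ x := by
    rw [← Finset.sum_subset (Finset.subset_univ S) fun w _ hw => by
      simp only [hg', if_neg hw, mul_zero], Finset.sum_div]
    refine Finset.sum_congr rfl fun w hw => ?_
    simp only [hg', if_pos hw]
    rw [← Finset.sum_div]
    ring
  rw [hlhs, div_le_iff₀ hTx] at key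
  exact key

lemma avgLpNorm_eq {X : Type} (S : Finset X) {p : ℝ≥0∞} (hp : p ≠ 0)
    (hp' : p ≠ ∞) (hS : S.Nonempty) (g : X → ℂ) :
    avgLpNorm S p g =
      ENNReal.ofReal (((S.card : ℝ)⁻¹ * ∑ x ∈ S, ‖g x‖ ^ p.toReal) ^ (1 / p.toReal)) := by
  let _ : MeasurableSpace X := ⊤
  have hp0 : 0 < p.toReal := ENNReal.toReal_pos hp hp'
  change eLpNorm g p (uniformOn (S : Set X)) = _
  rw [eLpNorm_eq_lintegral_rpow_enorm_toReal hp hp', uniformOn, ProbabilityTheory.cond, lintegral_smul_measure,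
    lintegral_finset]
  have hcard : (0 : ℝ) < S.card := by exact_mod_cast hS.card_pos
  rw [← ENNReal.ofReal_rpow_of_nonneg (by positivity) (by positivity),
    ENNReal.ofReal_mul (by positivity), ENNReal.ofReal_inv_of_pos hcard, ENNReal.ofReal_natCast,
    ENNReal.ofReal_sum_of_nonneg fun x _ => by positivity]
  congr 2
  · rw [Measure.count_apply_finset]
  · refine Finset.sum_congr rfl fun x _ => ?_
    rw [Measure.count_singleton, mul_one, ← ofReal_norm,
      ENNReal.ofReal_rpow_of_nonneg (norm_nonneg _) hp0.le]

lemma avgLpNorm_mono_exponent {X : Type} {S : Finset X} (hS : S.Nonempty) {p r : ℝ≥0∞}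
    (hpr : p ≤ r) (g : X → ℂ) : avgLpNorm S p g ≤ avgLpNorm S r g := by
  let _ : MeasurableSpace X := ⊤
  have : IsProbabilityMeasure (uniformOn (S : Set X)) :=
    isProbabilityMeasure_uniformOn' S.finite_toSet hS S.measurableSet
  exact eLpNorm_le_eLpNorm_of_exponent_le hpr measurable_from_top.aestronglyMeasurable

lemma avgWeakLpNorm_le {X : Type} (S : Finset X) {r : ℝ≥0∞} (hr : r ≠ 0) (hr' : r ≠ ∞)
    (g : X → ℂ) : avgWeakLpNorm S r g ≤ avgLpNorm S r g := by
  let _ : MeasurableSpace X := ⊤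
  refine iSup_le fun t => ?_
  have h := mul_meas_ge_le_pow_eLpNorm' (uniformOn (S : Set X)) hr hr'
    (measurable_from_top (f := g)).aestronglyMeasurable ((t : ℝ≥0) : ℝ≥0∞)
  have hr0 : 0 < r.toReal := ENNReal.toReal_pos hr hr'
  have h2 : uniformOn (S : Set X) {x | (t : ℝ≥0) < ‖g x‖₊} ≤
      uniformOn (S : Set X) {x | ((t : ℝ≥0) : ℝ≥0∞) ≤ ‖g x‖ₑ} :=
    measure_mono fun x hx => by
      simp only [Set.mem_ofPred_eq] at hx ⊢
      rw [enorm_eq_nnnorm]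
      exact_mod_cast hx.le
  have h3 := ENNReal.rpow_le_rpow h (one_div_nonneg.2 hr0.le)
  rw [ENNReal.mul_rpow_of_nonneg _ _ (one_div_nonneg.2 hr0.le), ← ENNReal.rpow_mul,
    ← ENNReal.rpow_mul, mul_one_div_cancel hr0.ne', ENNReal.rpow_one, ENNReal.rpow_one] at h3
  exact le_trans (by gcongr) h3

/-- Every point has positive mass, so the essential supremum is a supremum. -/
lemma enorm_le_avgLpNorm_top {X : Type} [Fintype X] (f : X → ℂ) (z : X) :
    ‖f z‖ₑ ≤ avgLpNorm Finset.univ ∞ f := by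
  classical
  let _ : MeasurableSpace X := ⊤
  change ‖f z‖ₑ ≤ eLpNorm f ∞ (uniformOn ((Finset.univ : Finset X) : Set X))
  rw [eLpNorm_exponent_top]
  by_contra! h
  have h1 := meas_eLpNormEssSup_lt (f := f) (μ := uniformOn ((Finset.univ : Finset X) : Set X))
  have h2 : uniformOn ((Finset.univ : Finset X) : Set X) {z} = 0 :=
    measure_mono_null (Set.singleton_subset_iff.2 h) h1
  rw [uniformOn_eq_zero_iff (Finset.finite_toSet _)] at h2
  simp at h2

lemma avgLpNorm_le_of_forall {X : Type} {S : Finset X} (hS : S.Nonempty) (r : ℝ≥0∞) {g : X → ℂ}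
    {c : ℝ≥0∞} (hg : ∀ x, ‖g x‖ₑ ≤ c) : avgLpNorm S r g ≤ c := by
  refine (avgLpNorm_mono_exponent hS le_top g).trans ?_
  let _ : MeasurableSpace X := ⊤
  change eLpNorm g ∞ (uniformOn (S : Set X)) ≤ c
  rw [eLpNorm_exponent_top]
  exact eLpNormEssSup_le_of_ae_enorm_bound (Filter.Eventually.of_forall hg)

lemma averaging_enorm_le {X : Type} [AddCommGroup X] {S : Finset X} {f : X → ℂ}
    {c : ℝ≥0∞} (hf : ∀ x, ‖f x‖ₑ ≤ c) (y : X) : ‖averaging S f y‖ₑ ≤ c := by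
  rcases S.eq_empty_or_nonempty with rfl | hS
  · simp [averaging]
  rcases eq_or_ne c ∞ with rfl | hc
  · exact le_top
  lift c to ℝ≥0 using hc
  have hf' (x : X) : ‖f x‖ ≤ c := by
    have := hf x
    rw [enorm_eq_nnnorm] at this
    exact_mod_cast this
  have hcard : (0 : ℝ) < S.card := by exact_mod_cast hS.card_pos
  have h : ‖averaging S f y‖ ≤ c := by
    rw [averaging, norm_mul, norm_inv, Complex.norm_natCast, inv_mul_le_iff₀ hcard]
    refine (norm_sum_le _ _).trans ?_
    rw [← nsmul_eq_mul]
    exact Finset.sum_le_card_nsmul _ _ _ fun x _ => hf' _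
  rw [enorm_eq_nnnorm]
  exact_mod_cast h

end Norms

/-! ### The cone as a nondegenerate quadric -/

section Cone

open QuadraticMap

/-- The quadratic form `x_1² + ⋯ + x_{d-2}² - x_{d-1} x_d`, whose zeros form the cone. -/
noncomputable def coneForm (F : Type) [Field F] (d : ℕ) (hd : 2 ≤ d) :
    QuadraticForm F (Fin d → F) :=
  (∑ i : Fin (d - 2), linMulLin (LinearMap.proj (⟨i, by omega⟩ : Fin d))
      (LinearMap.proj (⟨i, by omega⟩ : Fin d))) -
    linMulLin (LinearMap.proj (⟨d - 2, by omega⟩ : Fin d))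
      (LinearMap.proj (⟨d - 1, by omega⟩ : Fin d))

lemma coneForm_apply {F : Type} [Field F] {d : ℕ} (hd : 2 ≤ d) (x : Fin d → F) :
    coneForm F d hd x = ∑ i : Fin (d - 2), x ⟨i, by omega⟩ ^ 2 -
      x ⟨d - 2, by omega⟩ * x ⟨d - 1, by omega⟩ := by
  simp [coneForm, pow_two]

lemma mem_cone {F : Type} [Field F] [Fintype F] {d : ℕ} (hd : 2 ≤ d) {x : Fin d → F} :
    x ∈ cone F d hd ↔ coneForm F d hd x = 0 := by
  rw [coneForm_apply, sub_eq_zero, cone]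
  simp

lemma polar_coneForm {F : Type} [Field F] {d : ℕ} (hd : 2 ≤ d) (x y : Fin d → F) :
    polar (coneForm F d hd) x y = 2 * ∑ i : Fin (d - 2), x ⟨i, by omega⟩ * y ⟨i, by omega⟩ -
      x ⟨d - 2, by omega⟩ * y ⟨d - 1, by omega⟩ - x ⟨d - 1, by omega⟩ * y ⟨d - 2, by omega⟩ := by
  have h : ∑ i : Fin (d - 2), (x ⟨i, by omega⟩ + y ⟨i, by omega⟩) ^ 2 =
      ∑ i : Fin (d - 2), x ⟨i, by omega⟩ ^ 2 + ∑ i : Fin (d - 2), y ⟨i, by omega⟩ ^ 2 +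
        2 * ∑ i : Fin (d - 2), x ⟨i, by omega⟩ * y ⟨i, by omega⟩ := by
    rw [Finset.mul_sum, ← Finset.sum_add_distrib, ← Finset.sum_add_distrib]
    exact Finset.sum_congr rfl fun i _ => by ring
  rw [polar, coneForm_apply, coneForm_apply, coneForm_apply]
  simp only [Pi.add_apply]
  rw [h]
  ring

lemma two_ne_zero_of_odd_card {F : Type} [Field F] [Fintype F] (hF : Odd (Fintype.card F)) :
    (2 : F) ≠ 0 := by
  refine Ring.two_ne_zero fun h => ?_
  have := FiniteField.even_card_iff_char_two.1 h
  rw [Nat.odd_iff] at hF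
  omega

lemma coneForm_nondegenerate {F : Type} [Field F] {d : ℕ} (hd : 2 ≤ d) (h2 : (2 : F) ≠ 0) :
    (polarBilin (coneForm F d hd)).Nondegenerate := by
  have hleft (x : Fin d → F) (hx : ∀ y, polar (coneForm F d hd) x y = 0) : x = 0 := by
    ext j
    rw [Pi.zero_apply]
    rcases lt_trichotomy (j : ℕ) (d - 2) with hj | hj | hj
    · have h := hx (Pi.single j 1)
      rw [polar_coneForm, Finset.sum_eq_single (⟨j, hj⟩ : Fin (d - 2))] at h
      · have e1 : (Pi.single j 1 : Fin d → F) ⟨d - 1, by omega⟩ = 0 :=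
          Pi.single_eq_of_ne (by simp only [ne_eq, Fin.ext_iff]; omega) _
        have e2 : (Pi.single j 1 : Fin d → F) ⟨d - 2, by omega⟩ = 0 :=
          Pi.single_eq_of_ne (by simp only [ne_eq, Fin.ext_iff]; omega) _
        rw [e1, e2] at h
        simpa [h2] using h
      · intro i _ hi
        rw [Pi.single_eq_of_ne, mul_zero]
        simpa [Fin.ext_iff] using hi
      · simp
    · have h := hx (Pi.single ⟨d - 1, by omega⟩ 1)
      rw [polar_coneForm, Finset.sum_eq_zero, Pi.single_eq_same, Pi.single_eq_of_ne] at h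
      · have hj' : j = ⟨d - 2, by omega⟩ := Fin.ext hj
        rw [hj']
        simpa using h
      · simp only [ne_eq, Fin.ext_iff]
        omega
      · intro i _
        rw [Pi.single_eq_of_ne, mul_zero]
        simp only [ne_eq, Fin.ext_iff]
        omega
    · have h := hx (Pi.single ⟨d - 2, by omega⟩ 1)
      rw [polar_coneForm, Finset.sum_eq_zero, Pi.single_eq_same, Pi.single_eq_of_ne] at h
      · have hj' : j = ⟨d - 1, by omega⟩ := Fin.ext (by simp only; omega)
        rw [hj']
        simpa using h
      · simp only [ne_eq, Fin.ext_iff]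
        omega
      · intro i _
        rw [Pi.single_eq_of_ne, mul_zero]
        simp only [ne_eq, Fin.ext_iff]
        omega
  refine ⟨fun x hx => hleft x hx, fun x hx => hleft x fun y => ?_⟩
  rw [polar_comm]
  exact hx y

lemma zero_mem_cone {F : Type} [Field F] [Fintype F] {d : ℕ} (hd : 2 ≤ d) :
    (0 : Fin d → F) ∈ cone F d hd :=
  (mem_cone hd).2 (QuadraticMap.map_zero _)

/-- The points with nonzero last coordinate are parametrized freely by that coordinate and the first
`d - 2`; moreover `q - 1 ≥ q / 2`. -/
lemma pow_le_two_mul_card_cone {F : Type} [Field F] [Fintype F] {d : ℕ} (hd : 2 ≤ d) :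
    (Fintype.card F : ℝ) ^ (d - 1) ≤ 2 * (cone F d hd).card := by
  classical
  set φ : (Fin (d - 2) → F) × Fˣ → (Fin d → F) := fun p i =>
    if h : (i : ℕ) < d - 2 then p.1 ⟨i, h⟩ else
      if (i : ℕ) = d - 2 then (∑ j, p.1 j ^ 2) / (p.2 : F) else p.2 with hφ
  have h1 (p) (i : Fin (d - 2)) : φ p ⟨i, by omega⟩ = p.1 i := by
    simp [hφ]
  have h2 (p) : φ p ⟨d - 2, by omega⟩ = (∑ j, p.1 j ^ 2) / (p.2 : F) := by
    simp [hφ]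
  have h3 (p) : φ p ⟨d - 1, by omega⟩ = p.2 := by
    simp only [hφ]
    rw [dif_neg (by omega), if_neg (by omega)]
  have hinj : Function.Injective φ := fun p p' hpp => by
    refine Prod.ext (funext fun i => ?_) (Units.ext ?_)
    · rw [← h1, ← h1, hpp]
    · rw [← h3, ← h3, hpp]
  have hsub : Finset.univ.image φ ⊆ cone F d hd := fun x hx => by
    obtain ⟨p, -, rfl⟩ := Finset.mem_image.1 hx
    rw [mem_cone, coneForm_apply, h2, h3, div_mul_cancel₀ _ p.2.ne_zero]
    simp_rw [h1]
    exact sub_self _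
  have hcard := Finset.card_le_card hsub
  rw [Finset.card_image_of_injective _ hinj, Finset.card_univ, Fintype.card_prod,
    Fintype.card_pi_const, Fintype.card_units] at hcard
  have hq : 2 ≤ Fintype.card F := Fintype.one_lt_card
  have : Fintype.card F ^ (d - 1) ≤ 2 * (cone F d hd).card := by
    calc Fintype.card F ^ (d - 1) = Fintype.card F ^ (d - 2) * Fintype.card F := by
          rw [← pow_succ]
          congr 1
          omega
      _ ≤ Fintype.card F ^ (d - 2) * (2 * (Fintype.card F - 1)) := by
          gcongr
          omega
      _ = 2 * (Fintype.card F ^ (d - 2) * (Fintype.card F - 1)) := by ring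
      _ ≤ _ := by gcongr
  exact_mod_cast this

open Classical in
-- The substitution `z = y - x`: since `Q y = 0`, the condition `Q (y - z) = 0` reads `polar Q z y =
-- Q z`.
lemma norm_averaging_cone_le {F : Type} [Field F] [Fintype F] {d : ℕ} (hd : 2 ≤ d)
    (f : (Fin d → F) → ℂ) {y : Fin d → F} (hy : y ∈ cone F d hd) :
    ‖averaging (cone F d hd) f y‖ ≤ ((cone F d hd).card : ℝ)⁻¹ *
      ∑ z with polar (coneForm F d hd) z y = coneForm F d hd z, ‖f z‖ := by
  rw [averaging, norm_mul, norm_inv, Complex.norm_natCast]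
  gcongr
  refine (norm_sum_le _ _).trans (le_of_eq ?_)
  refine Finset.sum_equiv (Equiv.subLeft y) (fun x => ?_) fun x _ => rfl
  have hQ : coneForm F d hd (y - x) =
      coneForm F d hd y + coneForm F d hd x - polar (coneForm F d hd) y x := by
    rw [sub_eq_add_neg, QuadraticMap.map_add (coneForm F d hd) y (-x), polar_neg_right,
      QuadraticMap.map_neg]
    ring
  have hpol : polar (coneForm F d hd) (y - x) y =
      2 * coneForm F d hd y - polar (coneForm F d hd) y x := by
    rw [polar_sub_left, polar_self, polar_comm _ x y, nsmul_eq_mul, Nat.cast_ofNat]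
  rw [mem_cone] at hy ⊢
  simp only [Finset.mem_filter, Finset.mem_univ, true_and, Equiv.subLeft_apply]
  rw [hQ, hpol, hy]
  constructor
  · intro h
    rw [h]
    ring
  · intro h
    linear_combination -h

/-- The strong bound for averages over the cone. -/
theorem exists_avgLpNorm_cone_le {d k : ℕ} (hd : 2 ≤ d) (hk1 : 1 ≤ k) (hdk : d = 2 * k + 2)
    {x y : ℝ} (hxy : AdmissibleExponents k x y) :
    ∃ K : ℝ≥0, ∀ p r : ℝ≥0∞, recip p r = (x, y) →
      ∀ (F : Type) [Field F] [Fintype F], Odd (Fintype.card F) → ∀ f : (Fin d → F) → ℂ,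
        avgLpNorm (cone F d hd) r (averaging (cone F d hd) f) ≤ K * avgLpNorm Finset.univ p f := by
  classical
  have hk1' : (1 : ℝ) ≤ k := by exact_mod_cast hk1
  have hx0 := hxy.pos
  have hy0 := hxy.snd_pos hk1'
  have hy1 : y < 1 := hxy.lt.trans (hxy.lt_one hk1')
  obtain ⟨C, hC0, hC⟩ := exists_sum_rpow_quadric_le hk1 hxy
  refine ⟨(4 * C).toNNReal, fun p r hpr F _ _ hF f => ?_⟩
  rw [recip, Prod.mk.injEq, ENNReal.toReal_inv, ENNReal.toReal_inv] at hpr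
  obtain ⟨hp, hr⟩ := hpr
  have hp0 : p.toReal ≠ 0 := fun h => by rw [h, inv_zero] at hp; exact hx0.ne hp
  have hr0 : r.toReal ≠ 0 := fun h => by rw [h, inv_zero] at hr; exact hy0.ne hr
  obtain ⟨hp0', hptop⟩ := ENNReal.toReal_ne_zero.1 hp0
  obtain ⟨hr0', hrtop⟩ := ENNReal.toReal_ne_zero.1 hr0
  have hp' : p.toReal = 1 / x := by rw [← hp, one_div, inv_inv]
  have hr' : r.toReal = 1 / y := by rw [← hr, one_div, inv_inv]
  set S := cone F d hd with hS
  have hSne : S.Nonempty := ⟨0, zero_mem_cone hd⟩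
  rw [avgLpNorm_eq S hr0' hrtop hSne, avgLpNorm_eq _ hp0' hptop Finset.univ_nonempty, hp', hr',
    one_div_one_div, one_div_one_div, Finset.card_univ]
  change _ ≤ ENNReal.ofReal (4 * C) * _
  rw [← ENNReal.ofReal_mul (by positivity)]
  refine ENNReal.ofReal_le_ofReal ?_
  have hfr : Module.finrank F (Fin d → F) = 2 * k + 2 := by rw [Module.finrank_fin_fun, hdk]
  have hmain := hC F (Fin d → F) (coneForm F d hd)
    (coneForm_nondegenerate hd (two_ne_zero_of_odd_card hF)) hfr (fun z => ‖f z‖) S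
    (fun z => norm_nonneg _) (fun w hw => (mem_cone hd).1 hw)
  have hcard : (0 : ℝ) < S.card := by exact_mod_cast hSne.card_pos
  have hq : (0 : ℝ) < Fintype.card F := by exact_mod_cast Fintype.card_pos
  set L := Real.log (Fintype.card F) with hL
  set M : (Fin d → F) → ℝ := fun w =>
    ∑ z with polar (coneForm F d hd) z w = coneForm F d hd z, ‖f z‖ with hM
  have hM0 (w) : 0 ≤ M w := Finset.sum_nonneg fun z _ => norm_nonneg _
  set T := ∑ z, ‖f z‖ ^ (1 / x) with hT
  have hT0 : 0 ≤ T := Finset.sum_nonneg fun z _ => Real.rpow_nonneg (norm_nonneg _) _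
  have hyi : 0 < 1 / y := by positivity
  have hScard : (S.card : ℝ)⁻¹ ≤ 2 * Real.exp (-((2 * k + 1) * L)) := by
    have h := pow_le_two_mul_card_cone (F := F) hd
    have hqpow : (Fintype.card F : ℝ) ^ (d - 1) = Real.exp ((2 * k + 1) * L) := by
      rw [show d - 1 = 2 * k + 1 by omega, ← Real.exp_log (pow_pos hq (2 * k + 1)), Real.log_pow]
      push_cast
      rfl
    rw [hqpow, ← hS] at h
    rw [Real.exp_neg, inv_le_iff_one_le_mul₀ hcard, mul_assoc, mul_left_comm,
      ← div_eq_inv_mul, le_div_iff₀ (Real.exp_pos _)]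
    linarith
  have hN0 : 0 < (S.card : ℝ)⁻¹ := inv_pos.2 hcard
  have hav (w) (hw : w ∈ S) : ‖averaging S f w‖ ≤ (S.card : ℝ)⁻¹ * M w :=
    norm_averaging_cone_le hd f hw
  generalize (S.card : ℝ)⁻¹ = N at hScard hN0 hav ⊢
  have hleft : (N * ∑ w ∈ S, ‖averaging S f w‖ ^ (1 / y)) ^ y ≤
      (N) ^ (1 + y) * (∑ w ∈ S, M w ^ (1 / y)) ^ y := by
    calc (N * ∑ w ∈ S, ‖averaging S f w‖ ^ (1 / y)) ^ y
        ≤ (N * ∑ w ∈ S, (N * M w) ^ (1 / y)) ^ y := by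
          gcongr with w hw
          exact hav w hw
      _ = (N * ((N) ^ (1 / y) * ∑ w ∈ S, M w ^ (1 / y))) ^ y := by
          rw [Finset.mul_sum (a := (N) ^ (1 / y))]
          congr 3
          ext w
          rw [Real.mul_rpow (by positivity) (hM0 w)]
      _ = _ := by
          rw [← mul_assoc, Real.mul_rpow (by positivity)
            (Finset.sum_nonneg fun w _ => Real.rpow_nonneg (hM0 w) _)]
          congr 1
          rw [Real.mul_rpow (by positivity) (by positivity), ← Real.rpow_mul (by positivity),
            one_div_mul_cancel hy0.ne', Real.rpow_one, Real.rpow_add (by positivity),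
            Real.rpow_one, mul_comm]
  -- One power of `1/|C|` comes from the averaging operator, and `y` from the normalized norm. With
  -- the factor `q ^ (-(2k + 2) x)` on the other side they cancel `boundExponent` exactly.
  have hSpow : (N) ^ (1 + y) ≤ 4 * Real.exp (-((2 * k + 1) * (1 + y) * L)) := by
    calc (N) ^ (1 + y) ≤ (2 * Real.exp (-((2 * k + 1) * L))) ^ (1 + y) := by
          gcongr
      _ = 2 ^ (1 + y) * Real.exp (-((2 * k + 1) * (1 + y) * L)) := by
          rw [Real.mul_rpow (by norm_num) (Real.exp_pos _).le, ← Real.exp_mul]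
          congr 2
          ring
      _ ≤ 2 ^ (2 : ℝ) * Real.exp (-((2 * k + 1) * (1 + y) * L)) := by
          gcongr
          · norm_num
          · linarith
      _ = _ := by norm_num
  have hright : ((Fintype.card (Fin d → F) : ℝ)⁻¹ * T) ^ x =
      Real.exp (-((2 * k + 2) * x * L)) * T ^ x := by
    rw [Real.mul_rpow (by positivity) hT0, Real.inv_rpow (by positivity), Real.exp_neg,
      Module.card_eq_pow_finrank (K := F), hfr, Nat.cast_pow,
      natCast_pow_rpow_eq_exp Fintype.card_pos]
    push_cast
    rfl
  rw [hright]
  calc _ ≤ _ := hleft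
    _ ≤ 4 * Real.exp (-((2 * k + 1) * (1 + y) * L)) *
          (C * Real.exp (boundExponent k x y * L) * T ^ x) := by
        gcongr
    _ = 4 * C * ((Real.exp (-((2 * k + 1) * (1 + y) * L)) *
          Real.exp (boundExponent k x y * L)) * T ^ x) := by ring
    _ = _ := by
        rw [← Real.exp_add, boundExponent]
        congr 4
        ring

end Cone

/-! ### Geometry of the region and sufficiency -/

section Region

lemma Convex.mk_affine_mem {H : Set (ℝ × ℝ)} (hH : Convex ℝ H) {x₁ x₂ x : ℝ} (m c : ℝ)
    (h₁ : (x₁, m * x₁ + c) ∈ H) (h₂ : (x₂, m * x₂ + c) ∈ H) (hlt : x₁ < x₂) (hx₁ : x₁ ≤ x)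
    (hx₂ : x ≤ x₂) : (x, m * x + c) ∈ H := by
  have h0 : 0 < x₂ - x₁ := sub_pos.2 hlt
  have h := hH h₁ h₂ (a := (x₂ - x) / (x₂ - x₁)) (b := (x - x₁) / (x₂ - x₁))
    (div_nonneg (by linarith) h0.le) (div_nonneg (by linarith) h0.le) (by field_simp; ring)
  convert h using 1
  ext <;> simp <;> field_simp <;> ring

lemma Convex.mk_mem_of_le_of_le {H : Set (ℝ × ℝ)} (hH : Convex ℝ H) {x y₁ y₂ y : ℝ}
    (h₁ : (x, y₁) ∈ H) (h₂ : (x, y₂) ∈ H) (hy₁ : y₁ ≤ y) (hy₂ : y ≤ y₂) : (x, y) ∈ H := by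
  rcases hy₁.eq_or_lt with rfl | hlt
  · exact h₁
  have h0 : 0 < y₂ - y₁ := by linarith
  have h := hH h₁ h₂ (a := (y₂ - y) / (y₂ - y₁)) (b := (y - y₁) / (y₂ - y₁))
    (div_nonneg (by linarith) h0.le) (div_nonneg (by linarith) h0.le) (by field_simp; ring)
  convert h using 1
  ext <;> simp <;> field_simp <;> ring

lemma convex_setOf_mul_add_mul_le (a b c : ℝ) : Convex ℝ {p : ℝ × ℝ | a * p.1 + b * p.2 ≤ c} :=
  convex_halfSpace_le
    (a • LinearMap.fst ℝ ℝ ℝ + b • LinearMap.snd ℝ ℝ ℝ : ℝ × ℝ →ₗ[ℝ] ℝ).isLinear c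

/-- The region `Ω` is cut out by its edges. -/
lemma mem_regionOmega_iff {d : ℕ} (hd : 4 ≤ d) {x y : ℝ} :
    (x, y) ∈ regionOmega d ↔ 0 ≤ x ∧ y ≤ 1 ∧ (d : ℝ) * x ≤ d - 1 ∧ x ≤ (d - 1) * y ∧
      (d : ℝ) * x ≤ (d - 2) * (1 + y) := by
  have hD : (4 : ℝ) ≤ d := by exact_mod_cast hd
  rw [regionOmega, pointOne, pointTwo]
  generalize (d : ℝ) = D at hD
  have h2 : 0 < D - 2 := by linarith
  have h0 : 0 < D := by linarith
  have hE : 0 < D ^ 2 - 2 * D + 2 := by nlinarith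
  constructor
  · intro h
    have hle (a b c : ℝ) (h1 : 0 ≤ c) (h2 : b ≤ c) (h3 : a * ((D - 1) / D) + b ≤ c)
        (h4 : a * ((D - 1) / D) + b * (1 / (D - 2)) ≤ c)
        (h5 : a * ((D ^ 2 - 3 * D + 2) / (D ^ 2 - 2 * D + 2)) +
          b * ((D - 2) / (D ^ 2 - 2 * D + 2)) ≤ c) : a * x + b * y ≤ c := by
      refine convexHull_min ?_ (convex_setOf_mul_add_mul_le a b c) h
      rintro p (rfl | rfl | rfl | rfl | rfl)
      · simpa using h1
      · simpa using h2
      · simpa using h3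
      · exact h4
      · exact h5
    have hA : 0 ≤ (D - 1) / D := div_nonneg (by linarith) h0.le
    have hA1 : D * ((D - 1) / D) = D - 1 := by field_simp
    have hA2 : (D - 1) / D ≤ 1 := (div_le_one h0).2 (by linarith)
    have hB : 0 < 1 / (D - 2) := by positivity
    have hB1 : (D - 2) * (1 / (D - 2)) = 1 := by field_simp
    have hBle : 1 / (D - 2) ≤ 1 := (div_le_one h2).2 (by linarith)
    have hX : 0 ≤ (D ^ 2 - 3 * D + 2) / (D ^ 2 - 2 * D + 2) :=
      div_nonneg (by nlinarith) hE.le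
    have hY : (D - 2) / (D ^ 2 - 2 * D + 2) ≤ 1 := (div_le_one hE).2 (by nlinarith)
    have hXY : (D ^ 2 - 3 * D + 2) / (D ^ 2 - 2 * D + 2) =
        (D - 1) * ((D - 2) / (D ^ 2 - 2 * D + 2)) := by
      field_simp
      ring
    have hXY2 : D * ((D ^ 2 - 3 * D + 2) / (D ^ 2 - 2 * D + 2)) =
        (D - 2) * (1 + (D - 2) / (D ^ 2 - 2 * D + 2)) := by
      field_simp
      ring
    have hXD : D * ((D ^ 2 - 3 * D + 2) / (D ^ 2 - 2 * D + 2)) ≤ D - 1 := by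
      rw [← mul_div_assoc, div_le_iff₀ hE]
      nlinarith
    refine ⟨?_, ?_, ?_, ?_, ?_⟩
    · have := hle (-1) 0 0 (by linarith) (by linarith) (by linarith) (by linarith) (by linarith)
      linarith
    · have := hle 0 1 1 (by linarith) (by linarith) (by linarith) (by linarith) (by linarith)
      linarith
    · have := hle D 0 (D - 1) (by linarith) (by linarith) (by linarith) (by linarith)
        (by linarith)
      linarith
    · have := hle 1 (-(D - 1)) 0 (by linarith) (by linarith) (by nlinarith) (by nlinarith)
        (by linarith)
      linarith
    · have := hle D (-(D - 2)) (D - 2) (by linarith) (by linarith) (by linarith) (by linarith)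
        (by linarith)
      linarith
  · rintro ⟨hx0, hy1, hxD, hxy, hline⟩
    set H := convexHull ℝ ({(0, 0), (0, 1), ((D - 1) / D, 1), ((D - 1) / D, 1 / (D - 2)),
      ((D ^ 2 - 3 * D + 2) / (D ^ 2 - 2 * D + 2), (D - 2) / (D ^ 2 - 2 * D + 2))} :
        Set (ℝ × ℝ)) with hH
    have hHc : Convex ℝ H := convex_convexHull ℝ _
    have hx' : x ≤ (D - 1) / D := (le_div_iff₀' h0).2 hxD
    have hmem : ∀ p ∈ ({(0, 0), (0, 1), ((D - 1) / D, 1), ((D - 1) / D, 1 / (D - 2)),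
      ((D ^ 2 - 3 * D + 2) / (D ^ 2 - 2 * D + 2), (D - 2) / (D ^ 2 - 2 * D + 2))} :
        Set (ℝ × ℝ)), p ∈ H := fun p hp => subset_convexHull ℝ _ hp
    simp only [Set.mem_insert_iff, Set.mem_singleton_iff, forall_eq_or_imp, forall_eq] at hmem
    obtain ⟨hO, hA, hB, hP1, hP2⟩ := hmem
    have htop : (x, 1) ∈ H := by
      have h := hHc.mk_affine_mem 0 1 (x₁ := 0) (x₂ := (D - 1) / D) (x := x) (by simpa using hA)
        (by simpa using hB) (div_pos (by linarith) h0) hx0 hx'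
      simpa using h
    -- The lower boundary breaks at the abscissa of `P₂`. On either side `(x, y)` lies vertically
    -- between a point of an edge and a point of the top side.
    rcases le_total x ((D ^ 2 - 3 * D + 2) / (D ^ 2 - 2 * D + 2)) with hc | hc
    · have h := hHc.mk_affine_mem (1 / (D - 1)) 0 (x₁ := 0) (x := x) (by simpa using hO)
        (x₂ := (D ^ 2 - 3 * D + 2) / (D ^ 2 - 2 * D + 2)) (by
          convert hP2 using 2
          have : D - 1 ≠ 0 := by linarith
          field_simp
          ring) (div_pos (by nlinarith) hE) hx0 hc
      refine hHc.mk_mem_of_le_of_le h htop ?_ hy1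
      rw [add_zero, one_div, ← div_eq_inv_mul, div_le_iff₀ (by linarith)]
      linarith
    · have h := hHc.mk_affine_mem (D / (D - 2)) (-1) (x := x)
        (x₁ := (D ^ 2 - 3 * D + 2) / (D ^ 2 - 2 * D + 2)) (x₂ := (D - 1) / D) (by
          convert hP2 using 2
          field_simp
          ring) (by
          convert hP1 using 2
          field_simp
          ring) (by
          rw [div_lt_div_iff₀ hE h0]
          nlinarith) hc hx'
      refine hHc.mk_mem_of_le_of_le h htop ?_ hy1
      rw [div_mul_eq_mul_div, ← sub_eq_add_neg, sub_le_iff_le_add, div_le_iff₀ h2]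
      linarith

lemma two_mul_add_two_cast_ge {d k : ℕ} (hk : 1 ≤ k) (hdk : d = 2 * k + 2) :
    (d : ℝ) = 2 * k + 2 ∧ (1 : ℝ) ≤ k := by
  refine ⟨by rw [hdk]; push_cast; ring, by exact_mod_cast hk⟩

/-- The ordinate is lowered to the lower boundary of `Ω`, which lies strictly below the diagonal for
`x > 0`. This secures `r > p`. -/
lemma exists_admissibleExponents {d k : ℕ} (hk : 1 ≤ k) (hdk : d = 2 * k + 2) {x y : ℝ}
    (hxy : (x, y) ∈ regionOmega d) (hx : 0 < x) :
    ∃ y' ≤ y, AdmissibleExponents k x y' := by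
  obtain ⟨hdk', hk'⟩ := two_mul_add_two_cast_ge hk hdk
  obtain ⟨-, hy1, h1, h2, h3⟩ := (mem_regionOmega_iff (by omega)).1 hxy
  rw [hdk'] at h1 h2 h3
  refine ⟨max (x / (2 * k + 1)) ((k + 1) * x / k - 1), max_le ?_ ?_, hx, max_lt ?_ ?_, ?_, ?_, ?_⟩
  · rw [div_le_iff₀ (by positivity)]
    linarith
  · rw [sub_le_iff_le_add, div_le_iff₀ (by positivity)]
    linarith
  · rw [div_lt_iff₀ (by positivity)]
    nlinarith
  · rw [sub_lt_iff_lt_add, div_lt_iff₀ (by positivity)]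
    nlinarith
  · rw [le_div_iff₀ (by positivity)]
    linarith
  · have := le_max_left (x / (2 * k + 1)) ((k + 1) * x / k - 1)
    rw [div_le_iff₀ (by positivity)] at this
    linarith
  · have := le_max_right (x / (2 * k + 1)) ((k + 1) * x / k - 1)
    rw [sub_le_iff_le_add, div_le_iff₀ (by positivity)] at this
    linarith

lemma pointOne_admissible {d k : ℕ} (hk : 1 ≤ k) (hdk : d = 2 * k + 2) :
    AdmissibleExponents k (pointOne d).1 (pointOne d).2 := by
  obtain ⟨hdk', hk'⟩ := two_mul_add_two_cast_ge hk hdk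
  rw [pointOne, hdk']
  have h1 : (2 * k + 2 - 1 : ℝ) / (2 * k + 2) = (2 * k + 1) / (2 * k + 2) := by ring
  have h2 : (1 : ℝ) / (2 * k + 2 - 2) = 1 / (2 * k) := by ring
  rw [h1, h2]
  refine ⟨by positivity, ?_, le_rfl, ?_, le_of_eq ?_⟩
  · rw [div_lt_div_iff₀ (by positivity) (by positivity)]
    nlinarith
  · rw [mul_one_div, div_le_div_iff₀ (by positivity) (by positivity)]
    nlinarith
  · field_simp

lemma pointTwo_admissible {d k : ℕ} (hk : 1 ≤ k) (hdk : d = 2 * k + 2) :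
    AdmissibleExponents k (pointTwo d).1 (pointTwo d).2 := by
  obtain ⟨hdk', hk'⟩ := two_mul_add_two_cast_ge hk hdk
  rw [pointTwo, hdk']
  have h1 : ((2 * k + 2) ^ 2 - 3 * (2 * k + 2) + 2 : ℝ) / ((2 * k + 2) ^ 2 - 2 * (2 * k + 2) + 2) =
      k * (2 * k + 1) / (2 * k ^ 2 + 2 * k + 1) := by
    rw [div_eq_div_iff (by nlinarith) (by positivity)]
    ring
  have h2 : (2 * k + 2 - 2 : ℝ) / ((2 * k + 2) ^ 2 - 2 * (2 * k + 2) + 2) =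
      k / (2 * k ^ 2 + 2 * k + 1) := by
    rw [div_eq_div_iff (by nlinarith) (by positivity)]
    ring
  rw [h1, h2]
  refine ⟨by positivity, ?_, ?_, le_of_eq ?_, le_of_eq ?_⟩
  · refine div_lt_div_of_pos_right ?_ (by positivity)
    nlinarith
  · rw [div_le_div_iff₀ (by positivity) (by positivity)]
    nlinarith
  · ring
  · field_simp
    ring

/-- Boundedness in the region `Ω`, including the vertices. -/
lemma coneBounded_of_mem_regionOmega {d k : ℕ} (hd : 2 ≤ d) (hk : 1 ≤ k) (hdk : d = 2 * k + 2)
    {p r : ℝ≥0∞} (hp : 1 ≤ p) (h : recip p r ∈ regionOmega d) :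
    ConeBounded oddPrimePowers d hd p r := by
  obtain ⟨x, y, hxy⟩ : ∃ x y, recip p r = (x, y) := ⟨_, _, rfl⟩
  rw [hxy] at h
  obtain ⟨hx0, -, -, h2, -⟩ := (mem_regionOmega_iff (by omega)).1 h
  have hrec := hxy
  rw [recip, Prod.mk.injEq] at hrec
  rcases hx0.eq_or_lt with rfl | hx0
  · have hp' : p = ∞ := by
      have h := (ENNReal.toReal_eq_zero_iff _).1 hrec.1
      rw [ENNReal.inv_eq_zero, ENNReal.inv_eq_top] at h
      exact h.resolve_right (zero_lt_one.trans_le hp).ne'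
    subst hp'
    refine ⟨1, fun F _ _ _ => sInf_le fun f => ?_⟩
    rw [ENNReal.coe_one, one_mul]
    exact avgLpNorm_le_of_forall ⟨0, zero_mem_cone hd⟩ r
      (averaging_enorm_le (enorm_le_avgLpNorm_top f))
  · obtain ⟨y', hy', hadm⟩ := exists_admissibleExponents hk hdk h hx0
    have hy'0 := hadm.snd_pos (by exact_mod_cast hk)
    obtain ⟨K, hK⟩ := exists_avgLpNorm_cone_le hd hk hdk hadm
    refine ⟨K, fun F _ _ hF => sInf_le fun f => ?_⟩
    -- For a probability measure the norm increases with the exponent, so the bound at the lower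
    -- ordinate `y'` implies the one at `y`.
    refine (avgLpNorm_mono_exponent ⟨0, zero_mem_cone hd⟩ ?_ _).trans
      (hK p (ENNReal.ofReal y')⁻¹ ?_ F hF.2 f)
    · rw [ENNReal.le_inv_iff_le_inv, ← ENNReal.ofReal_toReal (a := r⁻¹), hrec.2]
      · exact ENNReal.ofReal_le_ofReal hy'
      · intro htop
        rw [htop, ENNReal.toReal_top] at hrec
        linarith [hrec.2]
    · rw [recip, inv_inv, ENNReal.toReal_ofReal hy'0.le, hrec.1]

end Region

/-! ### Necessity by test functions -/

section Necessity

lemma uniformOn_coe_finset {X : Type} [MeasurableSpace X] [MeasurableSingletonClass X]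
    {S G : Finset X} (hG : G ⊆ S) (hS : S.Nonempty) :
    uniformOn (S : Set X) G = ENNReal.ofReal (G.card / S.card) := by
  have hc : (0 : ℝ) < S.card := by exact_mod_cast hS.card_pos
  rw [uniformOn, cond_apply S.measurableSet, Set.inter_eq_self_of_subset_right (by exact_mod_cast hG),
    Measure.count_apply_finset, Measure.count_apply_finset, ENNReal.ofReal_div_of_pos hc,
    ENNReal.ofReal_natCast, ENNReal.ofReal_natCast, ENNReal.div_eq_inv_mul]

lemma avgLpNorm_indicator_le {X : Type} [Fintype X] [Nonempty X] (E : Finset X) {p : ℝ≥0∞} :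
    avgLpNorm Finset.univ p ((E : Set X).indicator (1 : X → ℂ)) ≤
      ENNReal.ofReal ((E.card / Fintype.card X : ℝ) ^ p⁻¹.toReal) := by
  let _ : MeasurableSpace X := ⊤
  refine (eLpNorm_indicator_const_le (1 : ℂ) p).trans (le_of_eq ?_)
  rw [uniformOn_coe_finset (Finset.subset_univ E) Finset.univ_nonempty, enorm_one, one_mul,
    ENNReal.toReal_inv, one_div, Finset.card_univ,
    ENNReal.ofReal_rpow_of_nonneg (by positivity) (by positivity)]

lemma le_avgLpNorm_of_forall {X : Type} {S G : Finset X} (hG : G ⊆ S) (hGne : G.Nonempty)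
    {r : ℝ≥0∞} (hr : r ≠ 0) {g : X → ℂ} {c : ℝ} (hc : 0 ≤ c) (hg : ∀ y ∈ G, c ≤ ‖g y‖) :
    ENNReal.ofReal (c * (G.card / S.card : ℝ) ^ r⁻¹.toReal) ≤ avgLpNorm S r g := by
  let _ : MeasurableSpace X := ⊤
  have hS : S.Nonempty := hGne.mono hG
  have hGc : (0 : ℝ) < G.card := by exact_mod_cast hGne.card_pos
  have hSc : (0 : ℝ) < S.card := by exact_mod_cast hS.card_pos
  have hμ : uniformOn (S : Set X) G ≠ 0 := by
    rw [uniformOn_coe_finset hG hS]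
    exact (ENNReal.ofReal_pos.2 (by positivity)).ne'
  calc ENNReal.ofReal (c * (G.card / S.card : ℝ) ^ r⁻¹.toReal)
      = eLpNorm ((G : Set X).indicator fun _ => (c : ℂ)) r (uniformOn (S : Set X)) := by
        rw [eLpNorm_indicator_const' G.measurableSet hμ hr, uniformOn_coe_finset hG hS,
          ENNReal.ofReal_mul hc, ENNReal.toReal_inv, one_div,
          ENNReal.ofReal_rpow_of_nonneg (by positivity) (by positivity), ← ofReal_norm,
          Complex.norm_real, Real.norm_of_nonneg hc]
    _ ≤ eLpNorm g r (uniformOn (S : Set X)) := by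
        refine eLpNorm_mono fun y => ?_
        by_cases hy : y ∈ (G : Set X)
        · rw [Set.indicator_of_mem hy, Complex.norm_real, Real.norm_of_nonneg hc]
          exact hg y hy
        · rw [Set.indicator_of_notMem hy, norm_zero]
          exact norm_nonneg _

/-- Testing the averaging estimate on the indicator function of a set. -/
lemma mul_rpow_le_of_averaging_bound {X : Type} [AddCommGroup X] [Fintype X] [DecidableEq X]
    {S E G : Finset X}
    {p r : ℝ≥0∞} (hr : r ≠ 0) {K : ℝ≥0}
    (hK : ∀ f : X → ℂ, avgLpNorm S r (averaging S f) ≤ K * avgLpNorm Finset.univ p f)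
    (hG : G ⊆ S) (hGne : G.Nonempty) {m : ℕ} (hm : ∀ y ∈ G, m ≤ {x ∈ S | y - x ∈ E}.card) :
    (m / S.card : ℝ) * (G.card / S.card : ℝ) ^ r⁻¹.toReal ≤
      K * (E.card / Fintype.card X : ℝ) ^ p⁻¹.toReal := by
  have h := (le_avgLpNorm_of_forall hG hGne hr (c := m / S.card) (by positivity) ?_).trans
    ((hK ((E : Set X).indicator 1)).trans (mul_le_mul_right (avgLpNorm_indicator_le E) _))
  · rw [← ENNReal.ofReal_coe_nnreal, ← ENNReal.ofReal_mul (by positivity)] at h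
    exact (ENNReal.ofReal_le_ofReal_iff (by positivity)).1 h
  · intro y hy
    have hsum : ∑ x ∈ S, (E : Set X).indicator (1 : X → ℂ) (y - x) =
        ({x ∈ S | y - x ∈ E}.card : ℂ) := by
      rw [Finset.card_filter, Nat.cast_sum]
      refine Finset.sum_congr rfl fun x _ => ?_
      simp [Set.indicator_apply]
    rw [averaging, hsum, norm_mul, norm_inv, Complex.norm_natCast, Complex.norm_natCast,
      div_eq_inv_mul]
    gcongr
    exact hm y hy

lemma Set.Infinite.le_of_rpow_le {Q : Set ℕ} (hQ : Q.Infinite) {a b M : ℝ}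
    (h : ∀ q ∈ Q, 0 < q → (q : ℝ) ^ a ≤ M * (q : ℝ) ^ b) : a ≤ b := by
  by_contra! hab
  have ht := ((tendsto_rpow_atTop (sub_pos.2 hab)).comp
    tendsto_natCast_atTop_atTop).eventually_gt_atTop M
  obtain ⟨n, hn⟩ := Filter.eventually_atTop.1 ht
  obtain ⟨q, hq, hnq⟩ := hQ.exists_gt n
  have hq0 : (0 : ℝ) < q := by exact_mod_cast (Nat.zero_le n).trans_lt hnq
  have h1 := h q hq (by exact_mod_cast hq0)
  have h2 : M < (q : ℝ) ^ (a - b) := hn q hnq.le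
  rw [Real.rpow_sub hq0, lt_div_iff₀ (by positivity)] at h2
  linarith

lemma exists_field_card_eq {q : ℕ} (hq : IsPrimePow q) :
    ∃ (F : Type) (_ : Field F) (_ : Fintype F), Fintype.card F = q := by
  obtain ⟨p, n, hp, hn, rfl⟩ := (isPrimePow_nat_iff q).1 hq
  have : Fact p.Prime := ⟨hp⟩
  have := Fintype.ofFinite (GaloisField p n)
  exact ⟨GaloisField p n, inferInstance, this, by
    rw [← Nat.card_eq_fintype_card, GaloisField.card p n hn.ne']⟩

lemma sum_range_two_mul_eq_zero {M : Type*} [AddCommMonoid M] (g : ℕ → M) (k : ℕ)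
    (hg : ∀ j, g (2 * j) + g (2 * j + 1) = 0) : ∑ i ∈ Finset.range (2 * k), g i = 0 := by
  induction k with
  | zero => simp
  | succ k ih =>
    rw [Nat.mul_succ, Finset.sum_range_succ, Finset.sum_range_succ, ih, zero_add, hg]

/-- If `-1` is a square, then the cone contains a subspace of dimension `d / 2`. -/
lemma exists_subgroup_subset_cone {F : Type} [Field F] [Fintype F] {d k : ℕ} (hd : 2 ≤ d)
    (hdk : d = 2 * k + 2) (hF : IsSquare (-1 : F)) :
    ∃ H : Finset (Fin d → F), H ⊆ cone F d hd ∧ H.card = Fintype.card F ^ (k + 1) ∧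
      ∀ x ∈ H, ∀ y ∈ H, x - y ∈ H := by
  classical
  obtain ⟨s, hs⟩ := hF
  subst hdk
  -- With `s * s = -1`, the coordinates come in pairs `(a_j, s a_j)` whose squares cancel. In the
  -- last pair `(a_k, 0)` the product vanishes.
  set ψ : (Fin (k + 1) → F) → Fin (2 * k + 2) → F := fun a i =>
    (if (i : ℕ) = 2 * k + 1 then 0 else if Even (i : ℕ) then 1 else s) *
      a (Fin.ofNat (k + 1) (i / 2)) with hψ
  have heven (a) (j : Fin (k + 1)) : ψ a ⟨2 * j, by omega⟩ = a j := by
    simp only [hψ]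
    rw [if_neg (by omega), if_pos (even_two_mul _), one_mul, Nat.mul_div_cancel_left _ two_pos]
    simp
  refine ⟨Finset.univ.image ψ, fun x hx => ?_, ?_, fun x hx y hy => ?_⟩
  · obtain ⟨a, -, rfl⟩ := Finset.mem_image.1 hx
    rw [mem_cone, coneForm_apply]
    have hlast : ψ a ⟨2 * k + 2 - 1, by omega⟩ = 0 := by
      simp [hψ]
    rw [hlast, mul_zero, sub_zero]
    have hsum := sum_range_two_mul_eq_zero (fun i : ℕ =>
      ((if Even i then 1 else s) * a (Fin.ofNat (k + 1) (i / 2))) ^ 2) k fun j => by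
        rw [if_pos (even_two_mul j), if_neg (by simp), Nat.mul_div_cancel_left _ two_pos,
          show (2 * j + 1) / 2 = j by omega]
        linear_combination (-(a (Fin.ofNat (k + 1) j)) ^ 2) * hs
    rw [Finset.sum_range] at hsum
    rw [← hsum]
    refine Finset.sum_congr rfl fun i _ => ?_
    simp only [hψ]
    rw [if_neg (by omega)]
  · rw [Finset.card_image_of_injective, Finset.card_univ, Fintype.card_pi_const]
    intro a b hab
    ext j
    rw [← heven a, ← heven b, hab]
  · obtain ⟨a, -, rfl⟩ := Finset.mem_image.1 hx
    obtain ⟨b, -, rfl⟩ := Finset.mem_image.1 hy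
    refine Finset.mem_image.2 ⟨a - b, Finset.mem_univ _, ?_⟩
    ext i
    simp only [hψ, Pi.sub_apply]
    ring

lemma card_cone_le {F : Type} [Field F] [Fintype F] (hF : Odd (Fintype.card F)) {d k : ℕ}
    (hd : 2 ≤ d) (hdk : d = 2 * k + 2) :
    ((cone F d hd).card : ℝ) ≤ 2 * (Fintype.card F : ℝ) ^ (d - 1) := by
  rw [show d - 1 = 2 * k + 1 by omega]
  exact card_zeros_le (coneForm_nondegenerate hd (two_ne_zero_of_odd_card hF))
    (by rw [Module.finrank_fin_fun, hdk]) fun y hy => (mem_cone hd).1 hy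

section Tests

variable {F : Type} [Field F] [Fintype F] {d k : ℕ} {hd : 2 ≤ d} {p r : ℝ≥0∞} {K : ℝ≥0}

/-- The point mass at the origin has average `1/|C|` everywhere on the cone. -/
lemma rpow_le_of_test_point (hF : Odd (Fintype.card F)) (hdk : d = 2 * k + 2) (hr : r ≠ 0)
    (hK : ∀ f : (Fin d → F) → ℂ, avgLpNorm (cone F d hd) r (averaging (cone F d hd) f) ≤
      K * avgLpNorm Finset.univ p f) :
    (Fintype.card F : ℝ) ^ (d * p⁻¹.toReal) ≤
      (2 * K : ℝ) * (Fintype.card F : ℝ) ^ ((d : ℝ) - 1) := by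
  classical
  have hS : (cone F d hd).Nonempty := ⟨0, zero_mem_cone hd⟩
  have hN : (0 : ℝ) < (cone F d hd).card := by exact_mod_cast hS.card_pos
  have hq : (0 : ℝ) < Fintype.card F := by exact_mod_cast Fintype.card_pos
  have h := mul_rpow_le_of_averaging_bound hr hK (E := {0}) (Finset.Subset.refl _) hS (m := 1)
    fun y hy => Finset.card_pos.2 ⟨y, Finset.mem_filter.2 ⟨hy, by simp⟩⟩
  have hle := card_cone_le hF hd hdk
  rw [div_self hN.ne', Real.one_rpow, mul_one, Fintype.card_pi_const, Finset.card_singleton,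
    Nat.cast_one, Nat.cast_pow, Real.div_rpow zero_le_one (by positivity), Real.one_rpow,
    ← Real.rpow_natCast, ← Real.rpow_mul hq.le, mul_one_div, div_le_div_iff₀ hN (by positivity),
    one_mul] at h
  rw [← Nat.cast_pred (by omega), Real.rpow_natCast]
  calc _ ≤ _ := h
    _ ≤ K * (2 * (Fintype.card F : ℝ) ^ (d - 1)) := by gcongr
    _ = _ := by ring

/-- As `C = -C`, the indicator function of the cone has average `1` at the origin, a point of
measure `1/|C|`. -/
lemma rpow_le_of_test_cone (hF : Odd (Fintype.card F)) (hdk : d = 2 * k + 2) (hp : 1 ≤ p)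
    (hr : 1 ≤ r)
    (hK : ∀ f : (Fin d → F) → ℂ, avgLpNorm (cone F d hd) r (averaging (cone F d hd) f) ≤
      K * avgLpNorm Finset.univ p f) :
    (Fintype.card F : ℝ) ^ p⁻¹.toReal ≤
      (4 * K : ℝ) * (Fintype.card F : ℝ) ^ (((d : ℝ) - 1) * r⁻¹.toReal) := by
  classical
  have hS : (cone F d hd).Nonempty := ⟨0, zero_mem_cone hd⟩
  have hN : (0 : ℝ) < (cone F d hd).card := by exact_mod_cast hS.card_pos
  have hq : (0 : ℝ) < Fintype.card F := by exact_mod_cast Fintype.card_pos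
  have h := mul_rpow_le_of_averaging_bound (zero_lt_one.trans_le hr).ne' hK (E := cone F d hd)
    (G := {0}) (by simpa using zero_mem_cone hd) (Finset.singleton_nonempty _)
    (m := (cone F d hd).card) fun y hy => by
      refine Finset.card_le_card fun x hx => Finset.mem_filter.2 ⟨hx, ?_⟩
      rw [Finset.mem_singleton.1 hy, zero_sub, mem_cone, QuadraticMap.map_neg]
      exact (mem_cone hd).1 hx
  have hle := card_cone_le hF hd hdk
  have hx0 : 0 ≤ p⁻¹.toReal := ENNReal.toReal_nonneg
  have hy0 : 0 ≤ r⁻¹.toReal := ENNReal.toReal_nonneg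
  have hx1 : p⁻¹.toReal ≤ 1 := ENNReal.toReal_le_of_le_ofReal zero_le_one (by simpa using hp)
  have hy1 : r⁻¹.toReal ≤ 1 := ENNReal.toReal_le_of_le_ofReal zero_le_one (by simpa using hr)
  generalize p⁻¹.toReal = x at *
  generalize r⁻¹.toReal = y at *
  rw [div_self hN.ne', one_mul, Finset.card_singleton, Nat.cast_one, one_div,
    Fintype.card_pi_const, Nat.cast_pow, Real.inv_rpow hN.le] at h
  generalize (Fintype.card F : ℝ) = q at *
  have h1 : ((cone F d hd).card : ℝ) ^ y ≤ 2 * q ^ (((d : ℝ) - 1) * y) := by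
    calc ((cone F d hd).card : ℝ) ^ y ≤ (2 * q ^ (d - 1)) ^ y := by gcongr
      _ = 2 ^ y * q ^ (((d : ℝ) - 1) * y) := by
        rw [Real.mul_rpow (by norm_num) (by positivity), ← Nat.cast_pred (by omega),
          Real.rpow_mul hq.le, Real.rpow_natCast]
      _ ≤ 2 ^ (1 : ℝ) * q ^ (((d : ℝ) - 1) * y) := by
        gcongr
        norm_num
      _ = _ := by rw [Real.rpow_one]
  have h2 : ((cone F d hd).card / q ^ d : ℝ) ^ x ≤ 2 * (q ^ x)⁻¹ := by
    calc ((cone F d hd).card / q ^ d : ℝ) ^ x ≤ (2 * q⁻¹) ^ x := by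
          gcongr
          rw [div_le_iff₀ (by positivity)]
          refine hle.trans (le_of_eq ?_)
          obtain ⟨e, rfl⟩ : ∃ e, d = e + 1 := ⟨d - 1, by omega⟩
          rw [Nat.add_sub_cancel, pow_succ]
          field_simp
      _ = 2 ^ x * (q ^ x)⁻¹ := by
        rw [Real.mul_rpow (by norm_num) (by positivity), Real.inv_rpow hq.le]
      _ ≤ 2 ^ (1 : ℝ) * (q ^ x)⁻¹ := by
        gcongr
        norm_num
      _ = _ := by rw [Real.rpow_one]
  have hqx : 0 < q ^ x := by positivity
  have hNy : 0 < ((cone F d hd).card : ℝ) ^ y := by positivity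
  have h3 : (((cone F d hd).card : ℝ) ^ y)⁻¹ ≤ K * (2 * (q ^ x)⁻¹) := h.trans (by gcongr)
  rw [inv_le_iff_one_le_mul₀ hNy, ← mul_assoc, mul_right_comm, ← div_eq_mul_inv,
    le_div_iff₀ hqx, one_mul] at h3
  calc q ^ x ≤ K * 2 * ((cone F d hd).card : ℝ) ^ y := h3
    _ ≤ K * 2 * (2 * q ^ (((d : ℝ) - 1) * y)) := by gcongr
    _ = _ := by ring

/-- On a subgroup `H` inside the cone, the average of the indicator function of `H` is at least
`|H|/|C|`. -/
lemma rpow_le_of_test_subgroup (hF : Odd (Fintype.card F)) (hdk : d = 2 * k + 2)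
    (hsq : IsSquare (-1 : F)) (hr : 1 ≤ r)
    (hK : ∀ f : (Fin d → F) → ℂ, avgLpNorm (cone F d hd) r (averaging (cone F d hd) f) ≤
      K * avgLpNorm Finset.univ p f) :
    (Fintype.card F : ℝ) ^ ((k + 1) * p⁻¹.toReal) ≤
      (4 * K : ℝ) * (Fintype.card F : ℝ) ^ (k * (1 + r⁻¹.toReal)) := by
  classical
  obtain ⟨H, hHS, hHcard, hHsub⟩ := exists_subgroup_subset_cone hd hdk hsq
  have hHne : H.Nonempty := by
    rw [← Finset.card_pos, hHcard]
    exact pow_pos Fintype.card_pos _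
  have hS : (cone F d hd).Nonempty := hHne.mono hHS
  have hN : (0 : ℝ) < (cone F d hd).card := by exact_mod_cast hS.card_pos
  have hq : (0 : ℝ) < Fintype.card F := by exact_mod_cast Fintype.card_pos
  have h := mul_rpow_le_of_averaging_bound (zero_lt_one.trans_le hr).ne' hK (E := H)
    hHS hHne (m := H.card) fun y hy =>
      Finset.card_le_card fun x hx => Finset.mem_filter.2 ⟨hHS hx, hHsub y hy x hx⟩
  have hle := card_cone_le hF hd hdk
  have hx0 : 0 ≤ p⁻¹.toReal := ENNReal.toReal_nonneg
  have hy0 : 0 ≤ r⁻¹.toReal := ENNReal.toReal_nonneg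
  have hy1 : r⁻¹.toReal ≤ 1 := ENNReal.toReal_le_of_le_ofReal zero_le_one (by simpa using hr)
  generalize p⁻¹.toReal = x at *
  generalize r⁻¹.toReal = y at *
  rw [hHcard, Fintype.card_pi_const, Nat.cast_pow, Nat.cast_pow] at h
  generalize (Fintype.card F : ℝ) = q at *
  have hqk : q ^ (k + 1) / q ^ d = (q ^ (k + 1))⁻¹ := by
    rw [hdk, show 2 * k + 2 = (k + 1) + (k + 1) by ring, pow_add q (k + 1) (k + 1),
      div_mul_cancel_left₀ (pow_ne_zero _ hq.ne')]
  rw [hqk, Real.inv_rpow (by positivity), ← Real.rpow_natCast q (k + 1), ← Real.rpow_mul hq.le,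
    Real.rpow_natCast] at h
  have h1 : (2 * q ^ k)⁻¹ ≤ q ^ (k + 1) / (cone F d hd).card := by
    rw [le_div_iff₀ hN, inv_mul_le_iff₀ (by positivity)]
    refine hle.trans (le_of_eq ?_)
    rw [show d - 1 = k + (k + 1) by omega, pow_add]
    ring
  have h2 : ((2 * q ^ k)⁻¹) ^ (1 + y) ≤ K * (q ^ ((k + 1 : ℕ) * x))⁻¹ := by
    refine le_trans ?_ h
    rw [Real.rpow_add (by positivity), Real.rpow_one]
    gcongr
  have h3 : (2 * q ^ k) ^ (1 + y) ≤ 4 * q ^ (k * (1 + y)) := by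
    rw [Real.mul_rpow (by norm_num) (by positivity), Real.rpow_mul hq.le, Real.rpow_natCast]
    gcongr
    calc (2 : ℝ) ^ (1 + y) ≤ 2 ^ (2 : ℝ) := by
          gcongr
          · norm_num
          · linarith
      _ = 4 := by norm_num
  have h4 : 0 < (2 * q ^ k) ^ (1 + y) := by positivity
  rw [Real.inv_rpow (by positivity), inv_le_iff_one_le_mul₀ h4, mul_right_comm, ← div_eq_mul_inv,
    le_div_iff₀ (by positivity), one_mul] at h2
  push_cast at h2
  calc _ ≤ _ := h2
    _ ≤ K * (4 * q ^ (k * (1 + y))) := by gcongr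
    _ = _ := by ring

end Tests

lemma mem_regionOmega_of_coneBounded {d k : ℕ} (hd : 2 ≤ d) (hk : 1 ≤ k) (hdk : d = 2 * k + 2)
    {Q : Set ℕ} (hQ : Q.Infinite) (hQodd : Q ⊆ oddPrimePowers)
    (hsq : ∀ (F : Type) [Field F] [Fintype F], Fintype.card F ∈ Q → IsSquare (-1 : F))
    {p r : ℝ≥0∞} (hp : 1 ≤ p) (hr : 1 ≤ r) (h : ConeBounded Q d hd p r) :
    recip p r ∈ regionOmega d := by
  obtain ⟨hdk', hk'⟩ := two_mul_add_two_cast_ge hk hdk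
  obtain ⟨K, hK⟩ := h
  have hbound (F : Type) [Field F] [Fintype F] (hF : Fintype.card F ∈ Q)
      (f : (Fin d → F) → ℂ) : avgLpNorm (cone F d hd) r (averaging (cone F d hd) f) ≤
        ((K + 1 : ℝ≥0) : ℝ≥0∞) * avgLpNorm Finset.univ p f := by
    -- Passing to `K + 1` makes the inequality strict, so an admissible constant below it exists
    -- without showing that the infimum is attained.
    have hlt : restrictedAvgConst (cone F d hd) p r < ((K + 1 : ℝ≥0) : ℝ≥0∞) :=
      (hK F hF).trans_lt (by exact_mod_cast lt_add_one K)
    obtain ⟨c, hc, hcK⟩ := sInf_lt_iff.1 hlt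
    exact (hc f).trans (by gcongr)
  rw [recip, mem_regionOmega_iff (by omega)]
  refine ⟨ENNReal.toReal_nonneg, ENNReal.toReal_le_of_le_ofReal zero_le_one (by simpa using hr),
    hQ.le_of_rpow_le (M := 2 * (K + 1 : ℝ≥0)) fun q hq _ => ?_,
    hQ.le_of_rpow_le (M := 4 * (K + 1 : ℝ≥0)) fun q hq _ => ?_, ?_⟩
  · obtain ⟨F, _, _, rfl⟩ := exists_field_card_eq (hQodd hq).1
    exact rpow_le_of_test_point (hQodd hq).2 hdk (zero_lt_one.trans_le hr).ne' (hbound F hq)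
  · obtain ⟨F, _, _, rfl⟩ := exists_field_card_eq (hQodd hq).1
    exact rpow_le_of_test_cone (hQodd hq).2 hdk hp hr (hbound F hq)
  · have := hQ.le_of_rpow_le (M := 4 * (K + 1 : ℝ≥0)) (a := (k + 1) * p⁻¹.toReal)
      (b := k * (1 + r⁻¹.toReal)) fun q hq _ => by
        obtain ⟨F, _, _, rfl⟩ := exists_field_card_eq (hQodd hq).1
        exact rpow_le_of_test_subgroup (hQodd hq).2 hdk (hsq F hq) hr (hbound F hq)
    rw [hdk']
    linarith

end Necessity

theorem theorem1p4 (d : ℕ) (hd : 4 ≤ d) (heven : Even d) :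
    -- (1) strong type bounds on `Ω` without `P₁`, `P₂`
    (∀ p r : ℝ≥0∞, 1 ≤ p → 1 ≤ r →
      recip p r ∈ regionOmega d \ {pointOne d, pointTwo d} →
      ConeBounded oddPrimePowers d (by omega) p r) ∧
    -- (2) necessity of `Ω`, along any infinite set of field sizes for which `-1` is a square
    (∀ Q : Set ℕ, Q.Infinite → Q ⊆ oddPrimePowers →
      (∀ (F : Type) [Field F] [Fintype F], Fintype.card F ∈ Q → IsSquare (-1 : F)) →
      ∀ p r : ℝ≥0∞, 1 ≤ p → 1 ≤ r →
        ConeBounded Q d (by omega) p r → recip p r ∈ regionOmega d) ∧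
    -- (3) restricted type estimate at `P₁`
    (∀ p r : ℝ≥0∞, 1 ≤ p → 1 ≤ r → recip p r = pointOne d →
      ∃ K : ℝ≥0, ∀ (F : Type) [Field F] [Fintype F], Fintype.card F ∈ oddPrimePowers →
        ∀ E : Set (Fin d → F),
          avgLpNorm (cone F d (by omega)) r
              (averaging (cone F d (by omega)) (E.indicator 1)) ≤
            K * avgLpNorm Finset.univ p (E.indicator (1 : (Fin d → F) → ℂ))) ∧
    -- (4) weak type estimate at `P₂`
    (∀ p r : ℝ≥0∞, 1 ≤ p → 1 ≤ r → recip p r = pointTwo d →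
      ∃ K : ℝ≥0, ∀ (F : Type) [Field F] [Fintype F], Fintype.card F ∈ oddPrimePowers →
        ∀ f : (Fin d → F) → ℂ,
          avgWeakLpNorm (cone F d (by omega)) r (averaging (cone F d (by omega)) f) ≤
            K * avgLpNorm Finset.univ p f) := by
  obtain ⟨k, hk, hdk⟩ : ∃ k, 1 ≤ k ∧ d = 2 * k + 2 := by
    obtain ⟨m, rfl⟩ := heven
    exact ⟨m - 1, by omega, by omega⟩
  have hd2 : 2 ≤ d := by omega
  refine ⟨fun p r hp _ h => coneBounded_of_mem_regionOmega hd2 hk hdk hp h.1,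
    fun Q hQ hQodd hsq p r hp hr h =>
      mem_regionOmega_of_coneBounded hd2 hk hdk hQ hQodd hsq hp hr h,
    fun p r _ _ hpr => ?_, fun p r _ hr hpr => ?_⟩
  -- Both vertices are admissible exponent pairs, so the strong bound holds there; the weak estimate
  -- follows from it by Chebyshev's inequality.
  · obtain ⟨K, hK⟩ := exists_avgLpNorm_cone_le hd2 hk hdk (pointOne_admissible hk hdk)
    exact ⟨K, fun F _ _ hF E => hK p r hpr F hF.2 _⟩
  · have hadm := pointTwo_admissible hk hdk
    obtain ⟨K, hK⟩ := exists_avgLpNorm_cone_le hd2 hk hdk hadm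
    have hr' : r ≠ ∞ := fun h => by
      have h2 := hadm.snd_pos (by exact_mod_cast hk)
      rw [← hpr, recip, h] at h2
      simp at h2
    exact ⟨K, fun F _ _ hF f => (avgWeakLpNorm_le _ (zero_lt_one.trans_le hr).ne' hr' _).trans
      (hK p r hpr F hF.2 f)⟩
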